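/- **Setting.** For $k,n\in\mathbb N$ let $\widetilde G\in(\mathbb R^n)^{\otimes k}$ have i.i.d. $\mathcal N(0,1)$ entries. A symmetrized Gaussian $k$-tensor is a random tensor with the law of $\frac{1}{\sqrt{k!}}\sum_{\pi\in S_k}\widetilde G^{\pi}$, where $\widetilde G^\pi_{i_1,\dots,i_k}=\widetilde G_{i_{\pi(1)},\dots,i_{\pi(k)}}$. For a tensor $T$ symmetric under permutations of its indices and a $k$-element set $S=\{i_1,\dots,i_k\}\subseteq[n]$ write $T_S=T_{i_1,\dots,i_k}$. For a set $V$ let $\mathrm{Part}_k(V)$ be the collection of partitions of $V$ into sets of size $k$, and let $\mathrm{Part}_k(\ell)=|\mathrm{Part}_k(V)|$ for $|V|=\ell$. For $\ell=ck$ with $c\in\mathbb N^+$ define: * the Kikuchi matrix $\mathcal K_\ell(T)=\sum_{S\in\binom{[n]}{k}}T_S\,\mathcal K_\ell(S)$, indexed by $\binom{[n]}{\ell}\times\binom{[n]}{\ell}$, where $\mathcal K_\ell(S)_{V,U}=1$ if $V\,\triangle\,U=S$ and $0$ otherwise; and $d_\ell=\binom{n-\ell}{k/2}\binom{\ell}{k/2}$;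 * the guiding vector $\Gamma^\ell(T)\in\mathbb R^{\binom{[n]}{\ell}}$ with coordinates $\Gamma^\ell(T)_V=\big(\binom n\ell\,\mathrm{Part}_k(\ell)\big)^{-1/2}\sum_{\{S_1,\dots,S_c\}\in\mathrm{Part}_k(V)}\prod_{j=1}^cT_{S_j}$. **Theorem.** Let $k\ge4$ be even and let $\gamma>0$ be a constant, $\gamma\neq1$. There is a function $\mathrm{err}(n)$, depending only on $k$ and $\gamma$, with $\mathrm{err}(n)\to0$ as $n\to\infty$, such that the following holds for all $n$, all $\ell=ck$ with $c\in\mathbb N^+$, all $z\in\{\pm1\}^n$, all $\varepsilon>0$ and all $0<\beta\le 0.1/\ell^{k/2}$ that satisfy $$\ell^{(k-2)/2}\ \ge\ C\cdot\frac{n^{k/2}}{\beta^2\binom nk}\cdot\ln n,\qquad C=\frac{2(1+\varepsilon)}{(1-\gamma)^2\binom{k}{k/2}} .$$ Let $G,H$ be independent symmetrized Gaussian $k$-tensors in dimension $n$, let $T=\beta z^{\otimes k}+G$, $\zeta=1/\ln n$, and $$T^+=T+\zeta H,\qquad T^-=T-\tfrac1\zeta H .$$ Let $\Gamma$ be the unit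 vector in the direction of $\Gamma^\ell(T^-)$. Then, with probability at least $1-\mathrm{err}(n)$, there is a unit vector $v$ in the span of the eigenspaces of $\mathcal K_\ell(T^+)$ for eigenvalues at least $(1-\gamma)\,d_\ell\,\beta$ such that $$\langle v,\Gamma\rangle^2\ \ge\ \beta^{2c}\,\xi,\qquad \xi=\mathrm{Part}_k(\ell)\cdot\frac{\gamma}{10}\cdot\Big(\frac1{1+\ln^2n}\Big)^{c}\cdot\frac1{\ln n}.$$ -/

import Mathlib

open MeasureTheory ProbabilityTheory

namespace TensorPCA

/-- Real tensors of order `k` in dimension `n`. -/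
abbrev Tensor (n k : ℕ) : Type := (Fin k → Fin n) → ℝ

/-- `(k!)^{-1/2} ∑_{π ∈ S_k} A^π`, where `A^π_{i₁,…,i_k} = A_{i_{π(1)},…,i_{π(k)}}`. -/
noncomputable def symmetrize {n k : ℕ} (A : Tensor n k) : Tensor n k :=
  fun i => (1 / Real.sqrt (k.factorial : ℝ)) * ∑ π : Equiv.Perm (Fin k), A (i ∘ π)

/-- The law of a symmetrized Gaussian `k`-tensor: the symmetrization of a tensor whose `n^k` entries
are i.i.d. standard Gaussian. -/
noncomputable def symmGaussianLaw (n k : ℕ) : Measure (Tensor n k) :=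
  (Measure.pi fun _ : Fin k → Fin n => gaussianReal 0 1).map symmetrize

/-- The spiked tensor `β z^{⊗k} + G`. -/
noncomputable def spiked {n k : ℕ} (β : ℝ) (z : Fin n → ℝ) (G : Tensor n k) : Tensor n k :=
  fun i => β * ∏ j, z (i j) + G i

/-- `T⁺ = T + ζ H`. -/
noncomputable def splitPlus {n k : ℕ} (ζ : ℝ) (T H : Tensor n k) : Tensor n k := T + ζ • H

/-- `T⁻ = T - ζ⁻¹ H`. -/
noncomputable def splitMinus {n k : ℕ} (ζ : ℝ) (T H : Tensor n k) : Tensor n k := T - (1 / ζ) • H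

/-- The entry `T_S` of a (symmetric) tensor at a `k`-element set `S = {i₁ < ⋯ < i_k}` of indices.
It is only used for sets of cardinality `k`. -/
noncomputable def entry {n k : ℕ} (T : Tensor n k) (S : Finset (Fin n)) : ℝ :=
  if h : S.card = k then T (S.orderEmbOfFin h) else 0

/-- The `ℓ`-element subsets of `[n]`. -/
abbrev Sub (n ℓ : ℕ) : Type := {V : Finset (Fin n) // V.card = ℓ}

/-- The adjacency matrix of the Kikuchi matching of `S`: the sets `V`, `U` are matched iff
`V ∆ U = S`. -/
def kikuchiMatching (n ℓ : ℕ) (S : Finset (Fin n)) : Matrix (Sub n ℓ) (Sub n ℓ) ℝ :=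
  Matrix.of fun V U => if symmDiff V.1 U.1 = S then 1 else 0

/-- The Kikuchi matrix `𝒦_ℓ(T) = ∑_{|S| = k} T_S 𝒦_ℓ(S)`. -/
noncomputable def kikuchi {n k : ℕ} (ℓ : ℕ) (T : Tensor n k) : Matrix (Sub n ℓ) (Sub n ℓ) ℝ :=
  ∑ S ∈ (Finset.univ : Finset (Fin n)).powersetCard k, entry T S • kikuchiMatching n ℓ S

/-- The degree `d_ℓ = C(n - ℓ, k/2) C(ℓ, k/2)` of the Kikuchi graph. -/
def kikuchiDegree (n k ℓ : ℕ) : ℕ := (n - ℓ).choose (k / 2) * ℓ.choose (k / 2)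

/-- `Part_k(V)`: the partitions of the set `V` into sets of cardinality `k`. -/
def parts {α : Type*} [DecidableEq α] (k : ℕ) (V : Finset α) : Finset (Finset (Finset α)) :=
  {P ∈ (V.powersetCard k).powerset |
    (∀ S ∈ P, ∀ S' ∈ P, S ≠ S' → Disjoint S S') ∧ P.biUnion id = V}

/-- `Part_k(ℓ)`: the number of partitions of an `ℓ`-element set into sets of cardinality `k`. -/
def numParts (k ℓ : ℕ) : ℕ := (parts k (Finset.univ : Finset (Fin ℓ))).card

/-- The guiding vector `Γ^ℓ(T)`, with `V`-coordinate
`(C(n,ℓ) Part_k(ℓ))^{-1/2} ∑_{{S₁,…,S_c} ∈ Part_k(V)} ∏_j T_{S_j}`. -/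
noncomputable def guidingVector {n k : ℕ} (ℓ : ℕ) (T : Tensor n k) :
    EuclideanSpace ℝ (Sub n ℓ) :=
  WithLp.toLp 2 fun V =>
    (1 / Real.sqrt ((n.choose ℓ : ℝ) * (numParts k ℓ : ℝ))) *
      ∑ P ∈ parts k V.1, ∏ S ∈ P, entry T S

/-- The guiding state: the unit vector in the direction of the guiding vector. -/
noncomputable def guidingState {n k : ℕ} (ℓ : ℕ) (T : Tensor n k) :
    EuclideanSpace ℝ (Sub n ℓ) :=
  ‖guidingVector ℓ T‖⁻¹ • guidingVector ℓ T

/-- The span of the eigenspaces of the matrix `K` for the eigenvalues that are at least `θ`. -/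
noncomputable def cutoffEigenspace {ι : Type*} [Fintype ι] [DecidableEq ι]
    (K : Matrix ι ι ℝ) (θ : ℝ) : Submodule ℝ (EuclideanSpace ℝ ι) :=
  ⨆ μ : ℝ, ⨆ _ : θ ≤ μ, Module.End.eigenspace (Matrix.toEuclideanLin K) μ

end TensorPCA

/-! Write L = ln n, s = √(1 + L²), κ = k/2. The noises of T⁺ and T⁻ are s/L and s times the two
components of an orthogonal transformation of the pair (G, H), so they are independent
(`gaussPi_prod_map_rotation`). The witness v is built from T⁺ alone, and its overlap with the
guiding vector of T⁻ is studied with v frozen.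

For T⁺: let u be the planted unit vector, with coordinates z_V / √C(n,ℓ). It is an exact
eigenvector, for d_ℓ, of the Kikuchi matrix of the signal, and the Kikuchi matrix of the noise
satisfies E‖K(G)u‖² = d_ℓ (`integral_norm_sq_kikuchiOf`). Hence u is an approximate eigenvector of
K(T⁺) for βd_ℓ, with squared error of order d_ℓ, to be compared with the squared window width
(γβd_ℓ)². As β²d_ℓ is at least of order L, the part v of u in the spectral window [(1-γ)βd_ℓ,
(1+γ)βd_ℓ] satisfies ⟨u,v⟩ ≥ 1/2 with high probability (`exists_tendsto_windowVec`). No bound on the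
operator norm of the noise matrix is needed.

For T⁻: put Q = ⟨v, Γ^ℓ(T⁻)⟩, a polynomial in the noise y with mean Λ = β^c √Part_k(ℓ) ⟨u,v⟩. Its
variance need not be small against Λ², because x = c²s²/(β²C(n,k)) is bounded but need not tend to
0. So Q is compared not with Λ but with ΛY, where Y = ∏_S exp(τ z_S y_S - τ²/2) is log-normal of
mean one and sτ/β = x/c. In E(Q - ΛY)², in units of β^{2c} Part_k(ℓ), one has E Y² = e^x;
Cameron–Martin makes the cross moment ⟨u,v⟩²(1 + x/c)^c; and E Q² is at most about ⟨u,v⟩² e^x + x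
e^x / c. These cancel up to terms that vanish with x/c and with ℓ/n
(`integral_inner_guidingOf_sub_sq_le`, `deviation_le`).

The bound on E Q² comes from grouping pairs of partitions by a set of j common blocks. This gives
squared sums of v over the ℓ-supersets of jk-sets, and the spectral gap of the Johnson scheme
(`sum_supersetSum_sq_le`) shows that the component of v orthogonal to u enters with a factor j/c
only.

Three Markov bounds finish the argument: E(1/Y) = e^x keeps Y away from 0, the deviation bound gives
Q > β^c √Part_k(ℓ) η, and E‖Γ^ℓ(T⁻)‖² ≤ 2 s^{2c}, where β ≤ 0.1/ℓ^κ is used. That bound on β and the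
threshold also force A L ℓ^{κ+1} ≤ n^κ/100, where A is the constant C at ε = 0; so ℓ/n is
polynomially small and x ≤ 1/(50A²). -/

namespace TensorPCA

/-- The standard Gaussian measure on `ι → ℝ`. -/
noncomputable abbrev gaussPi (ι : Type*) [Fintype ι] : Measure (ι → ℝ) :=
  Measure.pi fun _ : ι => gaussianReal 0 1

/-! ### Gaussian laws through characteristic functions. -/

section Law

variable {α β ι : Type*} [Fintype α] [Fintype β] [Fintype ι]
  [DecidableEq α] [DecidableEq β] [DecidableEq ι]

theorem charFunDual_gaussianReal_std (L : StrongDual ℝ ℝ) :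
    charFunDual (gaussianReal 0 1) L = Complex.exp (-((L 1 ^ 2 : ℝ) : ℂ) / 2) := by
  have h : charFunDual (gaussianReal 0 1) L = charFun (gaussianReal 0 1) (L 1) := by
    rw [charFunDual_apply, charFun_apply_real]
    congr 1
    ext x
    have : L x = L 1 * x := by
      conv_lhs => rw [← mul_one x, ← smul_eq_mul, map_smul, smul_eq_mul, mul_comm]
    rw [this]
    push_cast
    rfl
  rw [h, charFun_gaussianReal]
  congr 1
  push_cast
  ring

theorem charFunDual_gaussPi (L : StrongDual ℝ (ι → ℝ)) :
    charFunDual (gaussPi ι) L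
      = Complex.exp (-((∑ i, L (Pi.single i 1) ^ 2 : ℝ) : ℂ) / 2) := by
  rw [gaussPi, charFunDual_pi]
  simp_rw [charFunDual_gaussianReal_std]
  rw [← Complex.exp_sum]
  congr 1
  push_cast
  rw [← Finset.sum_div, Finset.sum_neg_distrib]
  simp

/-- A centred Gaussian law is determined by its covariance: the exponent of the characteristic
function at L is a quadratic form in the values of L on the basis, with the covariance matrix as
coefficients. The two sources may have different dimensions. -/
theorem gaussPi_map_eq (A : (α → ℝ) →L[ℝ] (ι → ℝ)) (B : (β → ℝ) →L[ℝ] (ι → ℝ))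
    (h : ∀ s t, ∑ i, A (Pi.single i 1) s * A (Pi.single i 1) t
      = ∑ i, B (Pi.single i 1) s * B (Pi.single i 1) t) :
    (gaussPi α).map A = (gaussPi β).map B := by
  have : IsFiniteMeasure ((gaussPi α).map A) := Measure.isFiniteMeasure_map _ _
  have : IsFiniteMeasure ((gaussPi β).map B) := Measure.isFiniteMeasure_map _ _
  apply Measure.ext_of_charFunDual
  funext L
  rw [charFunDual_map, charFunDual_map, charFunDual_gaussPi, charFunDual_gaussPi]
  have key : ∀ v : ι → ℝ, L v = ∑ s, v s * L (Pi.single s 1) := by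
    intro v
    conv_lhs => rw [pi_eq_sum_univ' v]
    rw [map_sum]
    refine Finset.sum_congr rfl fun s _ => ?_
    rw [map_smul, smul_eq_mul]
  have sq : ∀ v : ι → ℝ, L v ^ 2
      = ∑ s, ∑ t, L (Pi.single s 1) * L (Pi.single t 1) * (v s * v t) := by
    intro v
    rw [key v, pow_two, Finset.sum_mul_sum]
    refine Finset.sum_congr rfl fun s _ => Finset.sum_congr rfl fun t _ => by ring
  congr 3
  norm_cast
  simp_rw [ContinuousLinearMap.comp_apply, sq]
  rw [Finset.sum_comm]
  conv_rhs => rw [Finset.sum_comm]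
  refine Finset.sum_congr rfl fun s _ => ?_
  rw [Finset.sum_comm]
  conv_rhs => rw [Finset.sum_comm]
  refine Finset.sum_congr rfl fun t _ => ?_
  rw [← Finset.mul_sum, ← Finset.mul_sum, h]

/-- A plane rotation applied to each pair of coordinates of two independent standard Gaussian
vectors preserves their joint law. -/
theorem gaussPi_prod_map_rotation (p q : ℝ) (hpq : p ^ 2 + q ^ 2 = 1) :
    ((gaussPi ι).prod (gaussPi ι)).map
        (fun w : (ι → ℝ) × (ι → ℝ) => (p • w.1 + q • w.2, q • w.1 - p • w.2))
      = (gaussPi ι).prod (gaussPi ι) := by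
  let R : ((ι → ℝ) × (ι → ℝ)) →L[ℝ] ((ι → ℝ) × (ι → ℝ)) :=
    (p • ContinuousLinearMap.fst ℝ (ι → ℝ) (ι → ℝ) +
      q • ContinuousLinearMap.snd ℝ (ι → ℝ) (ι → ℝ)).prod
    (q • ContinuousLinearMap.fst ℝ (ι → ℝ) (ι → ℝ) -
      p • ContinuousLinearMap.snd ℝ (ι → ℝ) (ι → ℝ))
  change Measure.map R _ = _
  have : IsFiniteMeasure (((gaussPi ι).prod (gaussPi ι)).map R) :=
    Measure.isFiniteMeasure_map _ _
  apply Measure.ext_of_charFunDual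
  funext L
  rw [charFunDual_map, charFunDual_prod, charFunDual_prod, charFunDual_gaussPi,
    charFunDual_gaussPi, charFunDual_gaussPi, charFunDual_gaussPi, ← Complex.exp_add,
    ← Complex.exp_add]
  congr 1
  rw [← add_div, ← add_div, ← neg_add, ← neg_add]
  congr 2
  norm_cast
  rw [← Finset.sum_add_distrib, ← Finset.sum_add_distrib]
  refine Finset.sum_congr rfl fun i _ => ?_
  set e : ι → ℝ := Pi.single i 1
  have h1 : R (e, 0) = p • (e, 0) + q • (0, e) := by simp [R]
  have h2 : R (0, e) = q • (e, 0) - p • (0, e) := by simp [R]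
  simp only [ContinuousLinearMap.comp_apply, ContinuousLinearMap.inl_apply,
    ContinuousLinearMap.inr_apply]
  rw [h1, h2, map_add, map_sub, map_smul, map_smul, map_smul, map_smul]
  simp only [smul_eq_mul]
  -- The mixed terms ±2pq L(e,0) L(0,e) cancel between the two squares.
  linear_combination (L (e, 0) ^ 2 + L (0, e) ^ 2) * hpq

end Law

/-! ### Entries of a symmetrized Gaussian tensor at sets of distinct indices. -/

/-- The vector of the entries of a tensor at the sets of cardinality `k`. -/
noncomputable def entries {n k : ℕ} (T : Tensor n k) : Finset (Fin n) → ℝ := fun S => entry T S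

/-- Keeps the coordinates at the sets of cardinality `k`. -/
def truncate {n : ℕ} (k : ℕ) (x : Finset (Fin n) → ℝ) : Finset (Fin n) → ℝ :=
  fun S => if S.card = k then x S else 0

theorem measurable_symmetrize {n k : ℕ} : Measurable (symmetrize : Tensor n k → Tensor n k) := by
  unfold symmetrize
  fun_prop

theorem measurable_entries {n k : ℕ} : Measurable (entries : Tensor n k → _) := by
  refine measurable_pi_lambda _ fun S => ?_
  unfold entries entry
  split_ifs <;> fun_prop

theorem measurable_truncate {n k : ℕ} :
    Measurable (truncate k : (Finset (Fin n) → ℝ) → _) := by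
  refine measurable_pi_lambda _ fun S => ?_
  unfold truncate
  split_ifs <;> fun_prop

/-- The range of the tuple recovers the set, and injectivity of the enumeration then recovers the
permutation. Hence the k! index tuples over a set are distinct, and those over different sets never
meet; this makes the covariance of the entries diagonal. -/
theorem orderEmbOfFin_comp_perm_inj {n k : ℕ} {S S' : Finset (Fin n)} (h : S.card = k)
    (h' : S'.card = k) (π π' : Equiv.Perm (Fin k))
    (he : S.orderEmbOfFin h ∘ π = S'.orderEmbOfFin h' ∘ π') : S = S' ∧ π = π' := by
  have hS : S = S' := by
    have := congrArg Set.range he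
    rw [EquivLike.range_comp, EquivLike.range_comp, Finset.range_orderEmbOfFin,
      Finset.range_orderEmbOfFin] at this
    exact_mod_cast this
  subst hS
  refine ⟨rfl, Equiv.ext fun i => ?_⟩
  exact (S.orderEmbOfFin h).injective (congrFun he i)

/-- The entries of a symmetrized Gaussian tensor are independent standard Gaussians. -/
theorem symmGaussianLaw_map_entries (n k : ℕ) :
    (symmGaussianLaw n k).map entries = (gaussPi (Finset (Fin n))).map (truncate k) := by
  rw [symmGaussianLaw, Measure.map_map measurable_entries measurable_symmetrize]
  let A₀ : Tensor n k →ₗ[ℝ] (Finset (Fin n) → ℝ) :=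
    { toFun := entries ∘ symmetrize
      map_add' := fun x y => by
        funext S
        simp only [Function.comp_apply, entries, entry, symmetrize, Pi.add_apply]
        split_ifs
        · rw [Finset.sum_add_distrib, mul_add]
        · simp
      map_smul' := fun r x => by
        funext S
        simp only [Function.comp_apply, entries, entry, symmetrize, Pi.smul_apply, smul_eq_mul,
          RingHom.id_apply]
        split_ifs
        · rw [← Finset.mul_sum]
          ring
        · simp }
  let B₀ : (Finset (Fin n) → ℝ) →ₗ[ℝ] (Finset (Fin n) → ℝ) :=
    { toFun := truncate k
      map_add' := fun x y => by
        funext S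
        simp only [truncate, Pi.add_apply]
        split_ifs <;> simp
      map_smul' := fun r x => by
        funext S
        simp only [truncate, Pi.smul_apply, smul_eq_mul, RingHom.id_apply]
        split_ifs <;> simp }
  -- Both sides are linear images of standard Gaussians, so only covariances have to be compared: a
  -- pair S = S' has k! matching permutations, which cancel the factor 1/k! of the normalization.
  refine gaussPi_map_eq (LinearMap.toContinuousLinearMap A₀)
    (LinearMap.toContinuousLinearMap B₀) fun S S' => ?_
  change ∑ i, entry (symmetrize (Pi.single i 1)) S * entry (symmetrize (Pi.single i 1)) S'
    = ∑ i, truncate k (Pi.single i 1) S * truncate k (Pi.single i 1) S'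
  simp only [truncate, entry]
  by_cases h : S.card = k
  swap
  · simp [h]
  by_cases h' : S'.card = k
  swap
  · simp [h']
  simp only [h, h', dite_true, if_true, symmetrize]
  have hR : ∑ i : Finset (Fin n), (Pi.single i 1 : Finset (Fin n) → ℝ) S *
      (Pi.single i 1 : Finset (Fin n) → ℝ) S' = if S = S' then 1 else 0 := by
    simp [Pi.single_apply]
  rw [hR]
  have hL : ∀ i : Fin k → Fin n,
      (1 / Real.sqrt (k.factorial : ℝ) * ∑ π : Equiv.Perm (Fin k),
          (Pi.single i 1 : Tensor n k) (S.orderEmbOfFin h ∘ π)) *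
        (1 / Real.sqrt (k.factorial : ℝ) * ∑ π : Equiv.Perm (Fin k),
          (Pi.single i 1 : Tensor n k) (S'.orderEmbOfFin h' ∘ π))
      = (1 / (k.factorial : ℝ)) * ∑ π : Equiv.Perm (Fin k), ∑ π' : Equiv.Perm (Fin k),
          (Pi.single i 1 : Tensor n k) (S.orderEmbOfFin h ∘ π) *
          (Pi.single i 1 : Tensor n k) (S'.orderEmbOfFin h' ∘ π') := by
    intro i
    rw [mul_mul_mul_comm, Finset.sum_mul_sum, one_div_mul_one_div,
      Real.mul_self_sqrt (Nat.cast_nonneg _)]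
  simp_rw [hL]
  rw [← Finset.mul_sum, Finset.sum_comm]
  have hin : ∀ π : Equiv.Perm (Fin k), ∑ i : Fin k → Fin n, ∑ π' : Equiv.Perm (Fin k),
      (Pi.single i 1 : Tensor n k) (S.orderEmbOfFin h ∘ π) *
        (Pi.single i 1 : Tensor n k) (S'.orderEmbOfFin h' ∘ π') = if S = S' then 1 else 0 := by
    intro π
    rw [Finset.sum_comm]
    have : ∀ π' : Equiv.Perm (Fin k), ∑ i : Fin k → Fin n,
        (Pi.single i 1 : Tensor n k) (S.orderEmbOfFin h ∘ π) *
        (Pi.single i 1 : Tensor n k) (S'.orderEmbOfFin h' ∘ π')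
        = if S = S' ∧ π = π' then 1 else 0 := by
      intro π'
      simp only [Pi.single_apply, ite_mul, one_mul, zero_mul, Finset.sum_ite_eq,
        Finset.mem_univ, if_true]
      by_cases hc : S = S' ∧ π = π'
      · obtain ⟨rfl, rfl⟩ := hc
        simp
      · rw [if_neg hc, if_neg]
        intro he
        exact hc (orderEmbOfFin_comp_perm_inj h h' π π' he.symm |>.imp (fun e => e) (fun e => e))
    simp_rw [this]
    by_cases hS : S = S' <;> simp [hS]
  simp_rw [hin]
  rw [Finset.sum_const, Finset.card_univ, Fintype.card_perm, Fintype.card_fin, nsmul_eq_mul,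
    ← mul_assoc, one_div_mul_cancel (by positivity), one_mul]

/-! ### One-dimensional Gaussian moments. -/

section Moments

theorem integral_sq_gaussianReal_std : ∫ x, x ^ 2 ∂gaussianReal 0 1 = 1 := by
  have h := variance_fun_id_gaussianReal (μ := 0) (v := 1)
  rw [variance_eq_integral aemeasurable_id'] at h
  simpa using h

theorem integral_exp_gaussianReal_std (s : ℝ) :
    ∫ x, Real.exp (s * x - s ^ 2 / 2) ∂gaussianReal 0 1 = 1 := by
  have h := congrFun (mgf_fun_id_gaussianReal (μ := 0) (v := 1)) s
  simp only [mgf] at h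
  simp_rw [Real.exp_sub]
  rw [integral_div, h, div_eq_one_iff_eq (Real.exp_ne_zero _)]
  simp

/-- Differentiate the moment generating function. Under the exponential weight the mean moves from 0
to s, which is the one-dimensional Cameron–Martin shift. -/
theorem integral_mul_exp_gaussianReal_std (s : ℝ) :
    ∫ x, x * Real.exp (s * x - s ^ 2 / 2) ∂gaussianReal 0 1 = s := by
  have hs : s ∈ interior (integrableExpSet (fun x : ℝ => x) (gaussianReal 0 1)) := by
    rw [integrableExpSet_fun_id_gaussianReal]
    simp
  have h := hasDerivAt_mgf hs
  rw [mgf_fun_id_gaussianReal] at h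
  have h2 : HasDerivAt (fun t : ℝ => Real.exp (0 * t + (1 : NNReal) * t ^ 2 / 2))
      (Real.exp (s ^ 2 / 2) * s) s := by
    have : HasDerivAt (fun t : ℝ => 0 * t + (1 : NNReal) * t ^ 2 / 2) s s := by
      simp only [zero_mul, zero_add, NNReal.coe_one, one_mul]
      have := (hasDerivAt_pow 2 s).div_const 2
      simpa using this
    have h3 := this.exp
    simpa using h3
  have h4 := h.unique h2
  simp_rw [Real.exp_sub, ← mul_div_assoc]
  rw [integral_div, h4]
  field_simp

theorem integrable_exp_gaussianReal_std (s r : ℝ) :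
    Integrable (fun x => Real.exp (s * x - r)) (gaussianReal 0 1) := by
  simp_rw [Real.exp_sub]
  exact (integrable_exp_mul_gaussianReal s).div_const _

theorem integrable_mul_exp_gaussianReal_std (s r : ℝ) :
    Integrable (fun x => x * Real.exp (s * x - r)) (gaussianReal 0 1) := by
  simp_rw [Real.exp_sub, ← mul_div_assoc]
  refine Integrable.div_const ?_ _
  have hs : s ∈ interior (integrableExpSet (fun x : ℝ => x) (gaussianReal 0 1)) := by
    rw [integrableExpSet_fun_id_gaussianReal]
    simp
  simpa using integrable_pow_mul_exp_of_mem_interior_integrableExpSet hs 1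

theorem integrable_id_gaussianReal_std : Integrable (fun x : ℝ => x) (gaussianReal 0 1) :=
  (memLp_id_gaussianReal 1).integrable le_rfl

theorem integrable_sq_gaussianReal_std : Integrable (fun x : ℝ => x ^ 2) (gaussianReal 0 1) :=
  (memLp_id_gaussianReal 2).integrable_sq

end Moments

end TensorPCA

namespace TensorPCA

/-! ### Counting partitions into blocks of size k. -/

section Partitions

variable {α : Type*} [DecidableEq α] {k : ℕ}

theorem mem_parts {V : Finset α} {P : Finset (Finset α)} :
    P ∈ parts k V ↔ (∀ S ∈ P, S ⊆ V ∧ S.card = k) ∧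
      (∀ S ∈ P, ∀ S' ∈ P, S ≠ S' → Disjoint S S') ∧ P.biUnion id = V := by
  simp only [parts, Finset.mem_filter, Finset.mem_powerset, Finset.subset_iff,
    Finset.mem_powersetCard]

theorem card_eq_of_mem_parts {V : Finset α} {P : Finset (Finset α)} (h : P ∈ parts k V) :
    V.card = P.card * k := by
  obtain ⟨h1, h2, h3⟩ := mem_parts.1 h
  rw [← h3, Finset.card_biUnion (t := id) (fun S hS S' hS' => h2 S hS S' hS')]
  exact Finset.sum_const_nat fun S hS => (h1 S hS).2

theorem mem_parts_of_subset {V : Finset α} {P B : Finset (Finset α)} (h : P ∈ parts k V)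
    (hB : B ⊆ P) : B ∈ parts k (B.biUnion id) ∧ B.biUnion id ⊆ V := by
  obtain ⟨h1, h2, h3⟩ := mem_parts.1 h
  refine ⟨mem_parts.2 ⟨fun S hS => ⟨?_, (h1 S (hB hS)).2⟩,
    fun S hS S' hS' => h2 S (hB hS) S' (hB hS'), rfl⟩, ?_⟩
  · exact Finset.subset_biUnion_of_mem id hS
  · rw [← h3]
    exact Finset.biUnion_subset_biUnion_of_subset_left _ hB

theorem singleton_mem_parts {S : Finset α} (h : S.card = k) : {S} ∈ parts k S := by
  refine mem_parts.2 ⟨?_, ?_, ?_⟩ <;> simp [h]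

theorem biUnion_id_sdiff_of_pairwise {P B : Finset (Finset α)}
    (h : ∀ S ∈ P, ∀ S' ∈ P, S ≠ S' → Disjoint S S') (hB : B ⊆ P) :
    (P \ B).biUnion id = P.biUnion id \ B.biUnion id := by
  ext a
  simp only [Finset.mem_biUnion, Finset.mem_sdiff, id]
  constructor
  · rintro ⟨S, ⟨hS, hSB⟩, ha⟩
    refine ⟨⟨S, hS, ha⟩, ?_⟩
    rintro ⟨S', hS', ha'⟩
    have hne : S ≠ S' := fun e => hSB (e ▸ hS')
    exact Finset.disjoint_left.1 (h S hS S' (hB hS') hne) ha ha'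
  · rintro ⟨⟨S, hS, ha⟩, hn⟩
    exact ⟨S, ⟨hS, fun hSB => hn ⟨S, hSB, ha⟩⟩, ha⟩

/-- The partitions of `V` that extend a given partition of a subset `W` correspond to the
partitions of `V \ W`. -/
theorem card_parts_filter_superset (hk : 0 < k) {V W : Finset α} {B : Finset (Finset α)}
    (hB : B ∈ parts k W) (hW : W ⊆ V) :
    ((parts k V).filter (B ⊆ ·)).card = (parts k (V \ W)).card := by
  obtain ⟨b1, b2, b3⟩ := mem_parts.1 hB
  have hdisj : ∀ Q ∈ parts k (V \ W), Disjoint Q B := by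
    intro Q hQ
    obtain ⟨q1, -, -⟩ := mem_parts.1 hQ
    rw [Finset.disjoint_left]
    intro S hSQ hSB
    have hne : S.Nonempty := Finset.card_pos.1 (by rw [(b1 S hSB).2]; exact hk)
    obtain ⟨a, ha⟩ := hne
    exact (Finset.mem_sdiff.1 ((q1 S hSQ).1 ha)).2 ((b1 S hSB).1 ha)
  refine Finset.card_bij' (fun P _ => P \ B) (fun Q _ => Q ∪ B) ?_ ?_ ?_ ?_
  · intro P hP
    obtain ⟨hP, hBP⟩ := Finset.mem_filter.1 hP
    obtain ⟨h1, h2, h3⟩ := mem_parts.1 hP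
    have hU : (P \ B).biUnion id = V \ W := by
      rw [biUnion_id_sdiff_of_pairwise h2 hBP, h3, b3]
    refine mem_parts.2 ⟨fun S hS => ⟨?_, (h1 S (Finset.mem_sdiff.1 hS).1).2⟩, ?_, hU⟩
    · rw [← hU]
      exact Finset.subset_biUnion_of_mem id hS
    · intro S hS S' hS'
      exact h2 S (Finset.mem_sdiff.1 hS).1 S' (Finset.mem_sdiff.1 hS').1
  · intro Q hQ
    obtain ⟨q1, q2, q3⟩ := mem_parts.1 hQ
    refine Finset.mem_filter.2 ⟨mem_parts.2 ⟨?_, ?_, ?_⟩, Finset.subset_union_right⟩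
    · intro S hS
      rcases Finset.mem_union.1 hS with h | h
      · exact ⟨(q1 S h).1.trans Finset.sdiff_subset, (q1 S h).2⟩
      · exact ⟨(b1 S h).1.trans hW, (b1 S h).2⟩
    · have cross : ∀ S ∈ Q, ∀ S' ∈ B, Disjoint S S' := fun S hS S' hS' =>
        Finset.disjoint_of_subset_left (q1 S hS).1
          (Finset.disjoint_of_subset_right (b1 S' hS').1 Finset.sdiff_disjoint)
      intro S hS S' hS' hne
      rcases Finset.mem_union.1 hS with h | h <;> rcases Finset.mem_union.1 hS' with h' | h'
      · exact q2 S h S' h' hne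
      · exact cross S h S' h'
      · exact (cross S' h' S h).symm
      · exact b2 S h S' h' hne
    · rw [Finset.union_biUnion, q3, b3, Finset.sdiff_union_of_subset hW]
  · intro P hP
    exact Finset.sdiff_union_of_subset (Finset.mem_filter.1 hP).2
  · intro Q hQ
    rw [Finset.union_sdiff_right]
    exact Finset.sdiff_eq_self_of_disjoint (hdisj Q hQ)

theorem parts_empty (hk : 0 < k) : parts k (∅ : Finset α) = {∅} := by
  ext P
  rw [mem_parts, Finset.mem_singleton]
  constructor
  · rintro ⟨h1, -, -⟩
    refine Finset.eq_empty_of_forall_notMem fun S hS => ?_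
    obtain ⟨h, hc⟩ := h1 S hS
    rw [Finset.subset_empty.1 h] at hc
    simp at hc
    omega
  · rintro rfl
    simp

/-- Double counting of pairs of a partition and one of its blocks: every partition has m + 1 blocks,
and the partitions through a given block are those of its complement. -/
theorem card_parts_mul (hk : 0 < k) (m : ℕ) (V : Finset α) (hV : V.card = m * k) :
    (parts k V).card * (k.factorial ^ m * m.factorial) = (m * k).factorial := by
  induction m generalizing V with
  | zero =>
    have : V = ∅ := Finset.card_eq_zero.1 (by simpa using hV)
    subst this
    simp [parts_empty hk]
  | succ m ih =>
    have hcount : ∑ S ∈ V.powersetCard k, ((parts k V).filter ({S} ⊆ ·)).card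
        = (parts k V).card * (m + 1) := by
      simp_rw [Finset.card_eq_sum_ones, Finset.sum_filter]
      rw [Finset.sum_comm, Finset.sum_mul]
      refine Finset.sum_congr rfl fun P hP => ?_
      have hc := card_eq_of_mem_parts hP
      have hPc : P.card = m + 1 := by
        rw [hV] at hc
        exact (Nat.eq_of_mul_eq_mul_right hk hc).symm
      rw [← Finset.sum_filter, ← Finset.card_eq_sum_ones, one_mul, ← hPc]
      congr 1
      ext S
      simp only [Finset.mem_filter, Finset.singleton_subset_iff, and_iff_right_iff_imp,
        Finset.mem_powersetCard]
      exact fun hS => (mem_parts.1 hP).1 S hS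
    have hS : ∀ S ∈ V.powersetCard k,
        ((parts k V).filter ({S} ⊆ ·)).card * (k.factorial ^ m * m.factorial)
          = (m * k).factorial := by
      intro S hS
      obtain ⟨hSV, hSc⟩ := Finset.mem_powersetCard.1 hS
      rw [card_parts_filter_superset hk (singleton_mem_parts hSc) hSV]
      apply ih
      rw [Finset.card_sdiff_of_subset hSV, hV, hSc, Nat.succ_mul, Nat.add_sub_cancel]
    have h2 : (parts k V).card * (m + 1) * (k.factorial ^ m * m.factorial)
        = ((m + 1) * k).choose k * (m * k).factorial := by
      rw [← hcount, Finset.sum_mul, Finset.sum_congr rfl hS, Finset.sum_const,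
        Finset.card_powersetCard, hV, smul_eq_mul]
    have h3 := Nat.choose_mul_factorial_mul_factorial (n := (m + 1) * k) (k := k)
      (Nat.le_mul_of_pos_left _ (Nat.succ_pos m))
    rw [show (m + 1) * k - k = m * k by rw [Nat.succ_mul, Nat.add_sub_cancel]] at h3
    rw [← h3, pow_succ, Nat.factorial_succ]
    calc _ = (parts k V).card * (m + 1) * (k.factorial ^ m * m.factorial) * k.factorial := by ring
      _ = _ := by rw [h2]; ring

theorem card_parts_eq_numParts (hk : 0 < k) {m : ℕ} {V : Finset α} (hV : V.card = m * k) :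
    (parts k V).card = numParts k (m * k) := by
  have h1 := card_parts_mul hk m V hV
  have h2 := card_parts_mul hk m (Finset.univ : Finset (Fin (m * k))) (by simp)
  rw [← h2] at h1
  exact Nat.eq_of_mul_eq_mul_right (by positivity) h1

theorem numParts_mul (hk : 0 < k) (m : ℕ) :
    numParts k (m * k) * (k.factorial ^ m * m.factorial) = (m * k).factorial :=
  card_parts_mul hk m _ (by simp)

theorem numParts_pos (hk : 0 < k) (m : ℕ) : 0 < numParts k (m * k) := by
  have h := numParts_mul hk m
  by_contra h0
  have : numParts k (m * k) = 0 := by omega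
  rw [this, zero_mul] at h
  exact (Nat.factorial_ne_zero _) h.symm

theorem numParts_eq_div (hk : 0 < k) (m : ℕ) :
    (numParts k (m * k) : ℝ) = (m * k).factorial / (k.factorial ^ m * m.factorial) := by
  rw [eq_div_iff (by positivity)]
  exact_mod_cast numParts_mul hk m

theorem card_eq_of_mem_parts_mul (hk : 0 < k) {c : ℕ} {V : Finset α} (hV : V.card = c * k)
    {P : Finset (Finset α)} (hP : P ∈ parts k V) : P.card = c := by
  have := card_eq_of_mem_parts hP
  rw [hV] at this
  exact (Nat.eq_of_mul_eq_mul_right hk this).symm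

theorem prod_parts_eq {V : Finset α} {P : Finset (Finset α)} (hP : P ∈ parts k V) (z : α → ℝ) :
    ∏ S ∈ P, ∏ i ∈ S, z i = ∏ i ∈ V, z i := by
  obtain ⟨-, h2, h3⟩ := mem_parts.1 hP
  rw [← h3, Finset.prod_biUnion (t := id) (fun S hS S' hS' => h2 S hS S' hS')]
  rfl

/-- Splitting a partition of a set of size `c k` into `j` and `c - j` blocks. -/
theorem choose_mul_numParts_mul_numParts (hk : 0 < k) {c j : ℕ} (hj : j ≤ c) :
    ((c * k).choose (j * k) : ℝ) * numParts k (j * k) * numParts k ((c - j) * k)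
      = c.choose j * numParts k (c * k) := by
  have hjk : j * k ≤ c * k := Nat.mul_le_mul_right k hj
  rw [numParts_eq_div hk, numParts_eq_div hk, numParts_eq_div hk, Nat.cast_choose ℝ hjk,
    Nat.cast_choose ℝ hj, ← Nat.sub_mul]
  have hp : (k.factorial : ℝ) ^ c = (k.factorial : ℝ) ^ j * (k.factorial : ℝ) ^ (c - j) := by
    rw [← pow_add, Nat.add_sub_cancel' hj]
  rw [hp]
  have := fun m : ℕ => (Nat.cast_ne_zero (R := ℝ)).2 (Nat.factorial_ne_zero m)
  field_simp [this]

end Partitions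

end TensorPCA

namespace TensorPCA

/-! ### Spectral gap of the inclusion operators between levels of the Boolean lattice. -/

section Johnson

variable {α : Type*} [Fintype α] [DecidableEq α]

/-- The sum of `f` over the sets obtained from `W` by adding one element. -/
def levelDown (f : Finset α → ℝ) (W : Finset α) : ℝ := ∑ x ∈ Wᶜ, f (insert x W)

/-- The sum of `f` over the sets obtained from `V` by removing one element. -/
def levelUp (f : Finset α → ℝ) (V : Finset α) : ℝ := ∑ x ∈ V, f (V.erase x)

/-- The `m`-element subsets of a finite type. -/
abbrev level (α : Type*) [Fintype α] (m : ℕ) : Finset (Finset α) :=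
  (Finset.univ : Finset α).powersetCard m

/-- The two level operators are adjoint: pairs (V, x ∈ V) correspond to pairs (W, x ∉ W) through V =
W ∪ {x}. -/
theorem sum_levelUp_mul (m : ℕ) (g h : Finset α → ℝ) :
    ∑ V ∈ level α (m + 1), g V * levelUp h V = ∑ W ∈ level α m, levelDown g W * h W := by
  simp_rw [levelUp, levelDown, Finset.mul_sum, Finset.sum_mul]
  rw [Finset.sum_sigma', Finset.sum_sigma']
  refine Finset.sum_bij' (fun p _ => ⟨p.1.erase p.2, p.2⟩) (fun p _ => ⟨insert p.2 p.1, p.2⟩)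
    ?_ ?_ ?_ ?_ ?_
  · rintro ⟨V, x⟩ hp
    simp only [Finset.mem_sigma, Finset.mem_powersetCard_univ, Finset.mem_compl] at hp ⊢
    refine ⟨?_, Finset.notMem_erase _ _⟩
    rw [Finset.card_erase_of_mem hp.2, hp.1]
    rfl
  · rintro ⟨W, x⟩ hp
    simp only [Finset.mem_sigma, Finset.mem_powersetCard_univ, Finset.mem_compl] at hp ⊢
    refine ⟨?_, Finset.mem_insert_self _ _⟩
    rw [Finset.card_insert_of_notMem hp.2, hp.1]
  · rintro ⟨V, x⟩ hp
    simp only [Finset.mem_sigma] at hp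
    simp [Finset.insert_erase hp.2]
  · rintro ⟨W, x⟩ hp
    simp only [Finset.mem_sigma, Finset.mem_compl] at hp
    simp [Finset.erase_insert hp.2]
  · rintro ⟨V, x⟩ hp
    simp only [Finset.mem_sigma] at hp
    simp [Finset.insert_erase hp.2]

/-- Exchanging an element x outside W for an element y inside gives the same sum in either order.
The operators differ on the diagonal only, by n - |W| against |W|. -/
theorem levelDown_levelUp (h : Finset α → ℝ) (W : Finset α) :
    levelDown (levelUp h) W
      = levelUp (levelDown h) W + ((Fintype.card α : ℝ) - 2 * W.card) * h W := by
  have h1 : levelDown (levelUp h) W = (Wᶜ.card : ℝ) * h W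
      + ∑ x ∈ Wᶜ, ∑ y ∈ W, h (insert x (W.erase y)) := by
    have : ∀ x ∈ Wᶜ, levelUp h (insert x W) = h W + ∑ y ∈ W, h (insert x (W.erase y)) := by
      intro x hx
      rw [Finset.mem_compl] at hx
      rw [levelUp, Finset.sum_insert hx, Finset.erase_insert hx]
      congr 1
      refine Finset.sum_congr rfl fun y hy => ?_
      rw [Finset.erase_insert_of_ne]
      rintro rfl
      exact hx hy
    rw [levelDown, Finset.sum_congr rfl this, Finset.sum_add_distrib, Finset.sum_const,
      nsmul_eq_mul]
  have h2 : levelUp (levelDown h) W = (W.card : ℝ) * h W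
      + ∑ x ∈ Wᶜ, ∑ y ∈ W, h (insert x (W.erase y)) := by
    have : ∀ y ∈ W, levelDown h (W.erase y) = h W + ∑ x ∈ Wᶜ, h (insert x (W.erase y)) := by
      intro y hy
      rw [levelDown, Finset.compl_erase, Finset.sum_insert (by simpa using hy),
        Finset.insert_erase hy]
    rw [levelUp, Finset.sum_congr rfl this, Finset.sum_add_distrib, Finset.sum_const,
      nsmul_eq_mul, Finset.sum_comm]
  have h3 : (Wᶜ.card : ℝ) = Fintype.card α - W.card := by
    rw [Finset.card_compl, Nat.cast_sub (Finset.card_le_univ W)]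
  rw [h1, h2, h3]
  ring

theorem sum_levelDown (m : ℕ) (g : Finset α → ℝ) :
    ∑ W ∈ level α m, levelDown g W = (m + 1) * ∑ V ∈ level α (m + 1), g V := by
  have := sum_levelUp_mul m g (fun _ => 1)
  simp only [mul_one] at this
  rw [← this, Finset.mul_sum]
  refine Finset.sum_congr rfl fun V hV => ?_
  rw [Finset.mem_powersetCard_univ] at hV
  simp [levelUp, hV, mul_comm]

/-- The second largest eigenvalue of `UD` on the `m + 1`-element sets is `m (n - m - 1)`. -/
theorem sum_levelDown_sq_le (m : ℕ) (hm : m + 1 ≤ Fintype.card α) (g : Finset α → ℝ)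
    (hg : ∑ V ∈ level α (m + 1), g V = 0) :
    ∑ W ∈ level α m, levelDown g W ^ 2
      ≤ (m * ((Fintype.card α : ℝ) - m - 1)) * ∑ V ∈ level α (m + 1), g V ^ 2 := by
  induction m generalizing g with
  | zero =>
    have h := sum_levelDown 0 g
    rw [hg, mul_zero] at h
    simp only [level, Finset.powersetCard_zero, Finset.sum_singleton] at h ⊢
    simp [h]
  | succ m ih =>
    set h := levelDown g with hh
    have hs : ∑ W ∈ level α (m + 1), h W = 0 := by
      rw [hh, sum_levelDown, hg, mul_zero]
    have h1 := ih (by omega) h hs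
    set a := ∑ W ∈ level α (m + 1), h W ^ 2 with ha
    set b := ∑ V ∈ level α (m + 2), g V ^ 2 with hb
    have ha0 : 0 ≤ a := Finset.sum_nonneg fun _ _ => sq_nonneg _
    have hb0 : 0 ≤ b := Finset.sum_nonneg fun _ _ => sq_nonneg _
    have e1 : a = ∑ V ∈ level α (m + 2), g V * levelUp h V := by
      rw [sum_levelUp_mul, ha]
      exact Finset.sum_congr rfl fun W _ => pow_two _
    have e2 : ∑ V ∈ level α (m + 2), levelUp h V ^ 2
        = ∑ W ∈ level α m, levelDown h W ^ 2
          + ((Fintype.card α : ℝ) - 2 * (m + 1)) * a := by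
      have : ∑ V ∈ level α (m + 2), levelUp h V ^ 2
          = ∑ V ∈ level α (m + 2), levelUp h V * levelUp h V :=
        Finset.sum_congr rfl fun W _ => pow_two _
      rw [this, sum_levelUp_mul]
      have e3 : ∀ W ∈ level α (m + 1), levelDown (levelUp h) W * h W
          = h W * levelUp (levelDown h) W
            + ((Fintype.card α : ℝ) - 2 * (m + 1)) * h W ^ 2 := by
        intro W hW
        rw [Finset.mem_powersetCard_univ] at hW
        rw [levelDown_levelUp, hW]
        push_cast
        ring
      rw [Finset.sum_congr rfl e3, Finset.sum_add_distrib, sum_levelUp_mul, ← Finset.mul_sum]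
      congr 1
      exact Finset.sum_congr rfl fun W _ => (pow_two _).symm
    -- With h = Dg, adjointness gives ‖h‖² = ⟨g, Uh⟩. Cauchy–Schwarz then reduces the claim to
    -- ‖Uh‖², which the commutation relation expresses through ‖Dh‖², that is, through the level
    -- below.
    have cs := Finset.sum_mul_sq_le_sq_mul_sq (level α (m + 2)) g (levelUp h)
    rw [← e1, e2, ← hb] at cs
    -- The induction closes because m(n - m - 1) + (n - 2(m + 1)) = (m + 1)(n - m - 2).
    have hle : a ^ 2 ≤ b * (((m + 1 : ℕ) * ((Fintype.card α : ℝ) - (m + 1 : ℕ) - 1)) * a) := by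
      refine cs.trans (mul_le_mul_of_nonneg_left ?_ hb0)
      push_cast
      linarith
    have hm' : ((m + 2 : ℕ) : ℝ) ≤ Fintype.card α := by exact_mod_cast hm
    push_cast at hm'
    rcases ha0.eq_or_lt with h0 | hpos
    · rw [← h0]
      refine mul_nonneg (mul_nonneg (Nat.cast_nonneg _) ?_) hb0
      push_cast
      linarith
    · have : a * a ≤ (((m + 1 : ℕ) * ((Fintype.card α : ℝ) - (m + 1 : ℕ) - 1)) * b) * a := by
        rw [← pow_two]
        exact hle.trans (le_of_eq (by ring))
      exact le_of_mul_le_mul_right this hpos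

/-- The sum of `f` over the `ℓ`-element supersets of `W`. -/
def supersetSum (ℓ : ℕ) (f : Finset α → ℝ) (W : Finset α) : ℝ :=
  ∑ V ∈ (level α ℓ).filter (W ⊆ ·), f V

/-- Each ℓ-set V ⊇ W is reached once through every one of its ℓ - m elements outside W. -/
theorem levelDown_supersetSum (ℓ m : ℕ) (f : Finset α → ℝ) (W : Finset α) (hW : W.card = m) :
    levelDown (supersetSum ℓ f) W = ((ℓ : ℝ) - m) * supersetSum ℓ f W := by
  simp_rw [levelDown, supersetSum, Finset.sum_filter]
  rw [Finset.sum_comm, Finset.mul_sum]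
  refine Finset.sum_congr rfl fun V hV => ?_
  rw [Finset.mem_powersetCard_univ] at hV
  by_cases hWV : W ⊆ V
  · rw [if_pos hWV, ← Finset.sum_filter, Finset.sum_const, nsmul_eq_mul]
    congr 1
    have : Wᶜ.filter (fun x => insert x W ⊆ V) = V \ W := by
      ext x
      simp [Finset.insert_subset_iff, hWV, and_comm]
    rw [this, Finset.card_sdiff_of_subset hWV, hV, hW, Nat.cast_sub]
    rw [← hV, ← hW]
    exact Finset.card_le_card hWV
  · rw [if_neg hWV, mul_zero]
    refine Finset.sum_eq_zero fun x _ => if_neg fun h => hWV ?_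
    exact (Finset.subset_insert x W).trans h

theorem card_filter_subset_level {W : Finset α} (ℓ : ℕ) (hℓ : W.card ≤ ℓ) :
    ((level α ℓ).filter (W ⊆ ·)).card
      = (Fintype.card α - W.card).choose (ℓ - W.card) := by
  have : (Fintype.card α - W.card).choose (ℓ - W.card)
      = (Wᶜ.powersetCard (ℓ - W.card)).card := by
    rw [Finset.card_powersetCard, Finset.card_compl]
  rw [this]
  refine Finset.card_bij' (fun V _ => V \ W) (fun U _ => U ∪ W) ?_ ?_ ?_ ?_
  · intro V hV
    simp only [Finset.mem_filter, Finset.mem_powersetCard] at hV ⊢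
    refine ⟨fun x hx => by simpa using (Finset.mem_sdiff.1 hx).2, ?_⟩
    rw [Finset.card_sdiff_of_subset hV.2, hV.1.2]
  · intro U hU
    simp only [Finset.mem_filter, Finset.mem_powersetCard] at hU ⊢
    refine ⟨⟨Finset.subset_univ _, ?_⟩, Finset.subset_union_right⟩
    rw [Finset.card_union_of_disjoint, hU.2, Nat.sub_add_cancel hℓ]
    exact Finset.disjoint_left.2 fun x hx => by simpa using hU.1 hx
  · intro V hV
    exact Finset.sdiff_union_of_subset (Finset.mem_filter.1 hV).2
  · intro U hU
    rw [Finset.mem_powersetCard] at hU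
    rw [Finset.union_sdiff_right]
    refine Finset.sdiff_eq_self_of_disjoint (Finset.disjoint_left.2 fun x hx => ?_)
    simpa using hU.1 hx

theorem sum_supersetSum (ℓ m : ℕ) (f : Finset α → ℝ) :
    ∑ W ∈ level α m, supersetSum ℓ f W = ℓ.choose m * ∑ V ∈ level α ℓ, f V := by
  simp_rw [supersetSum, Finset.sum_filter]
  rw [Finset.sum_comm, Finset.mul_sum]
  refine Finset.sum_congr rfl fun V hV => ?_
  rw [Finset.mem_powersetCard_univ] at hV
  rw [← Finset.sum_filter, Finset.sum_const, nsmul_eq_mul]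
  congr 2
  rw [← hV, ← Finset.card_powersetCard]
  congr 1
  ext W
  simp [Finset.mem_powersetCard, and_comm]

/-- Descent from m = ℓ, where the superset sum is f itself. One step down is D divided by ℓ - m, and
the gap of D on sums of mean zero applies at every level. Relative to the norm on constants the
factors telescope to m/ℓ. -/
theorem sum_supersetSum_sq_le_of_sum_eq_zero (ℓ m : ℕ) (hm : m ≤ ℓ) (hℓ : ℓ ≤ Fintype.card α)
    (f : Finset α → ℝ) (hf : ∑ V ∈ level α ℓ, f V = 0) :
    (ℓ : ℝ) * ∑ W ∈ level α m, supersetSum ℓ f W ^ 2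
      ≤ m * ((Fintype.card α - m).choose (ℓ - m) * ℓ.choose m) *
        ∑ V ∈ level α ℓ, f V ^ 2 := by
  induction hm using Nat.decreasingInduction with
  | self =>
    have : ∀ W ∈ level α ℓ, supersetSum ℓ f W = f W := by
      intro W hW
      rw [Finset.mem_powersetCard_univ] at hW
      rw [supersetSum]
      have : (level α ℓ).filter (W ⊆ ·) = {W} := by
        ext V
        simp only [Finset.mem_filter, Finset.mem_powersetCard_univ, Finset.mem_singleton]
        constructor
        · rintro ⟨h, hs⟩
          exact (Finset.eq_of_subset_of_card_le hs (by omega)).symm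
        · rintro rfl
          exact ⟨hW, subset_rfl⟩
      rw [this, Finset.sum_singleton]
    rw [Finset.sum_congr rfl fun W hW => by rw [this W hW]]
    simp
  | of_succ m hm ih =>
    set n := Fintype.card α with hn
    have hmℓ : (0 : ℝ) < (ℓ : ℝ) - m := by
      rw [sub_pos]
      exact_mod_cast hm
    have hmn : ((m + 1 : ℕ) : ℝ) ≤ n := by exact_mod_cast (Nat.succ_le_of_lt hm).trans hℓ
    push_cast at hmn
    have hsum : ∑ V ∈ level α (m + 1), supersetSum ℓ f V = 0 := by
      rw [sum_supersetSum, hf, mul_zero]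
    have h1 := sum_levelDown_sq_le m (by omega) (supersetSum ℓ f) hsum
    have h2 : ∑ W ∈ level α m, levelDown (supersetSum ℓ f) W ^ 2
        = ((ℓ : ℝ) - m) ^ 2 * ∑ W ∈ level α m, supersetSum ℓ f W ^ 2 := by
      rw [Finset.mul_sum]
      refine Finset.sum_congr rfl fun W hW => ?_
      rw [levelDown_supersetSum ℓ m f W (Finset.mem_powersetCard_univ.1 hW), mul_pow]
    rw [h2, ← hn] at h1
    set X := ∑ W ∈ level α m, supersetSum ℓ f W ^ 2
    set X' := ∑ W ∈ level α (m + 1), supersetSum ℓ f W ^ 2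
    set F := ∑ V ∈ level α ℓ, f V ^ 2
    have hF : 0 ≤ F := Finset.sum_nonneg fun _ _ => sq_nonneg _
    have c1 : ((ℓ : ℝ) - m) * (n - m).choose (ℓ - m)
        = ((n : ℝ) - m) * (n - (m + 1)).choose (ℓ - (m + 1)) := by
      have := Nat.add_one_mul_choose_eq (n - (m + 1)) (ℓ - (m + 1))
      rw [show n - (m + 1) + 1 = n - m by omega, show ℓ - (m + 1) + 1 = ℓ - m by omega] at this
      rw [← Nat.cast_sub hm.le, ← Nat.cast_sub (hm.le.trans hℓ)]
      exact_mod_cast (by rw [this, mul_comm])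
    have c2 : ((ℓ : ℝ) - m) * ℓ.choose m = ((m : ℝ) + 1) * ℓ.choose (m + 1) := by
      have := Nat.choose_succ_right_eq ℓ m
      rw [← Nat.cast_sub hm.le]
      exact_mod_cast (by rw [mul_comm, ← this, mul_comm])
    set A : ℝ := (((n - m).choose (ℓ - m) : ℕ) : ℝ)
    set A' : ℝ := (((n - (m + 1)).choose (ℓ - (m + 1)) : ℕ) : ℝ)
    set C : ℝ := ((ℓ.choose m : ℕ) : ℝ)
    set C' : ℝ := ((ℓ.choose (m + 1) : ℕ) : ℝ)
    have hA' : 0 ≤ A' := Nat.cast_nonneg _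
    have hC' : 0 ≤ C' := Nat.cast_nonneg _
    push_cast at ih
    have hm0 : (0 : ℝ) ≤ m := Nat.cast_nonneg _
    have hl0 : (0 : ℝ) ≤ ℓ := Nat.cast_nonneg _
    have hk : ((ℓ : ℝ) - m) ^ 2 * (ℓ * X) ≤ ((ℓ : ℝ) - m) ^ 2 * (m * (A * C) * F) := by
      calc ((ℓ : ℝ) - m) ^ 2 * (ℓ * X) = ℓ * (((ℓ : ℝ) - m) ^ 2 * X) := by ring
        _ ≤ ℓ * (m * ((n : ℝ) - m - 1) * X') := mul_le_mul_of_nonneg_left h1 hl0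
        _ = m * ((n : ℝ) - m - 1) * (ℓ * X') := by ring
        _ ≤ m * ((n : ℝ) - m - 1) * ((m + 1) * (A' * C') * F) :=
            mul_le_mul_of_nonneg_left ih (mul_nonneg hm0 (by linarith))
        -- The gap has n - m - 1; weakening it to n - m makes the binomial coefficients telescope
        -- exactly.
        _ ≤ m * ((n : ℝ) - m) * ((m + 1) * (A' * C') * F) := by
            refine mul_le_mul_of_nonneg_right ?_ (by positivity)
            exact mul_le_mul_of_nonneg_left (by linarith) hm0
        _ = m * (((n : ℝ) - m) * A') * ((m + 1) * C') * F := by ring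
        _ = ((ℓ : ℝ) - m) ^ 2 * (m * (A * C) * F) := by rw [← c1, ← c2]; ring
    exact le_of_mul_le_mul_left hk (by positivity)

theorem choose_mul_choose_cast {n ℓ m : ℕ} (hm : m ≤ ℓ) :
    (n.choose m : ℝ) * (n - m).choose (ℓ - m) = n.choose ℓ * ℓ.choose m := by
  exact_mod_cast (Nat.choose_mul hm).symm

/-- The subset-averaging operator contracts the orthogonal complement of the constants by
the factor `m / ℓ`. -/
theorem sum_supersetSum_sq_le (ℓ m : ℕ) (hm : m ≤ ℓ) (hℓ : ℓ ≤ Fintype.card α) (h0 : 0 < ℓ)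
    (f : Finset α → ℝ) :
    ∑ W ∈ level α m, supersetSum ℓ f W ^ 2
      ≤ ((Fintype.card α - m).choose (ℓ - m) * ℓ.choose m) *
        ((∑ V ∈ level α ℓ, f V) ^ 2 / (Fintype.card α).choose ℓ
          + m / ℓ * ∑ V ∈ level α ℓ, f V ^ 2) := by
  set n := Fintype.card α with hn
  set N : ℝ := ((n.choose ℓ : ℕ) : ℝ) with hN
  have hNpos : 0 < N := by
    rw [hN]
    exact_mod_cast Nat.choose_pos hℓ
  have hcard : ((level α ℓ).card : ℝ) = N := by
    rw [Finset.card_powersetCard, Finset.card_univ]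
  set s := (∑ V ∈ level α ℓ, f V) / N with hs
  -- Orthogonal splitting into the mean s, on which the operator norm is attained, and a part of sum
  -- zero, on which the gap applies.
  set g : Finset α → ℝ := fun V => f V - s with hg
  have hg0 : ∑ V ∈ level α ℓ, g V = 0 := by
    rw [hg, Finset.sum_sub_distrib, Finset.sum_const, nsmul_eq_mul, hcard, hs]
    field_simp
    ring
  have hgsq : ∑ V ∈ level α ℓ, g V ^ 2 ≤ ∑ V ∈ level α ℓ, f V ^ 2 := by
    have : ∑ V ∈ level α ℓ, f V ^ 2 = ∑ V ∈ level α ℓ, g V ^ 2 + N * s ^ 2 := by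
      have e : ∀ V ∈ level α ℓ, f V ^ 2 = g V ^ 2 + (2 * s) * g V + s ^ 2 := by
        intro V _
        simp only [hg]
        ring
      rw [Finset.sum_congr rfl e, Finset.sum_add_distrib, Finset.sum_add_distrib,
        ← Finset.mul_sum, hg0, Finset.sum_const, nsmul_eq_mul, hcard]
      ring
    rw [this]
    nlinarith [sq_nonneg s]
  set A : ℝ := (((n - m).choose (ℓ - m) : ℕ) : ℝ) with hA
  set C : ℝ := ((ℓ.choose m : ℕ) : ℝ) with hC
  have hFW : ∀ W ∈ level α m, supersetSum ℓ f W = supersetSum ℓ g W + s * A := by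
    intro W hW
    rw [Finset.mem_powersetCard_univ] at hW
    have : ∀ V, f V = g V + s := fun V => by simp [hg]
    simp_rw [supersetSum, this, Finset.sum_add_distrib, Finset.sum_const, nsmul_eq_mul]
    rw [card_filter_subset_level ℓ (by omega), hW, ← hn, ← hA]
    ring
  have hcm : ((level α m).card : ℝ) * A = N * C := by
    rw [Finset.card_powersetCard, Finset.card_univ, ← hn, hA, hN, hC]
    exact choose_mul_choose_cast hm
  have hexp : ∑ W ∈ level α m, supersetSum ℓ f W ^ 2
      = ∑ W ∈ level α m, supersetSum ℓ g W ^ 2 + N * C * A * s ^ 2 := by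
    have e : ∀ W ∈ level α m, supersetSum ℓ f W ^ 2
        = supersetSum ℓ g W ^ 2 + (2 * s * A) * supersetSum ℓ g W + (s * A) ^ 2 := by
      intro W hW
      rw [hFW W hW]
      ring
    rw [Finset.sum_congr rfl e, Finset.sum_add_distrib, Finset.sum_add_distrib,
      ← Finset.mul_sum, sum_supersetSum, hg0, Finset.sum_const, nsmul_eq_mul, ← hcm]
    ring
  have hgap := sum_supersetSum_sq_le_of_sum_eq_zero ℓ m hm hℓ g hg0
  rw [← hn, ← hA, ← hC] at hgap
  have hl : (0 : ℝ) < ℓ := by exact_mod_cast h0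
  have hgap' : ∑ W ∈ level α m, supersetSum ℓ g W ^ 2
      ≤ A * C * (m / ℓ * ∑ V ∈ level α ℓ, f V ^ 2) := by
    have : ∑ W ∈ level α m, supersetSum ℓ g W ^ 2
        ≤ (m * (A * C) * ∑ V ∈ level α ℓ, g V ^ 2) / ℓ := by
      rw [le_div_iff₀ hl, mul_comm]
      exact hgap
    refine this.trans ?_
    have h2 : (m * (A * C) * ∑ V ∈ level α ℓ, g V ^ 2) / ℓ
        ≤ (m * (A * C) * ∑ V ∈ level α ℓ, f V ^ 2) / ℓ := by
      have : (0 : ℝ) ≤ m * (A * C) := by positivity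
      gcongr
    refine h2.trans (le_of_eq ?_)
    ring
  rw [hexp, mul_add]
  have : A * C * ((∑ V ∈ level α ℓ, f V) ^ 2 / N) = N * C * A * s ^ 2 := by
    rw [hs]
    field_simp
  linarith

end Johnson

end TensorPCA

namespace TensorPCA

/-! ### Spectral truncation as a measurable function of the matrix. -/

section Spectral

variable {ι : Type*} [Fintype ι] [DecidableEq ι]

/-- The matrix `1 + ((K - a) / b) ^ (2 m)`. -/
noncomputable def windowMatrix (K : Matrix ι ι ℝ) (a b : ℝ) (m : ℕ) : Matrix ι ι ℝ :=
  1 + (b⁻¹ • (K - a • (1 : Matrix ι ι ℝ))) ^ (2 * m)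

/-- A rational approximation of the projection of `u` to the eigenspaces of `K` with eigenvalues
in the window `[a - b, a + b]`. -/
noncomputable def windowVec (K : Matrix ι ι ℝ) (a b : ℝ) (u : EuclideanSpace ℝ ι) (m : ℕ) :
    EuclideanSpace ℝ ι :=
  WithLp.toLp 2 ((windowMatrix K a b m)⁻¹.mulVec u.ofLp)

/-- The even power is a Gram matrix, so adding the identity makes the matrix invertible for every
symmetric K. -/
theorem windowMatrix_posDef {K : Matrix ι ι ℝ} (hK : K.IsHermitian) (a b : ℝ) (m : ℕ) :
    (windowMatrix K a b m).PosDef := by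
  have hA : (b⁻¹ • (K - a • (1 : Matrix ι ι ℝ))).IsHermitian := by
    refine Matrix.IsHermitian.ext fun i j => ?_
    have h := hK.apply i j
    simp only [star_trivial] at h
    simp [h, Matrix.one_apply, eq_comm]
  have hp : (b⁻¹ • (K - a • (1 : Matrix ι ι ℝ))) ^ (2 * m)
      = ((b⁻¹ • (K - a • (1 : Matrix ι ι ℝ))) ^ m).conjTranspose
        * (b⁻¹ • (K - a • (1 : Matrix ι ι ℝ))) ^ m := by
    rw [Matrix.conjTranspose_pow, hA.eq, ← pow_add, two_mul]
  rw [windowMatrix, hp]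
  exact Matrix.PosDef.one.add_posSemidef (Matrix.posSemidef_conjTranspose_mul_self _)

theorem pow_mulVec_of_eigen {A : Matrix ι ι ℝ} {e : ι → ℝ} {t : ℝ} (h : A.mulVec e = t • e)
    (m : ℕ) : (A ^ m).mulVec e = t ^ m • e := by
  induction m with
  | zero => simp
  | succ m ih => rw [pow_succ', ← Matrix.mulVec_mulVec, ih, Matrix.mulVec_smul, h, smul_smul,
      pow_succ]

theorem windowMatrix_inv_mulVec {K : Matrix ι ι ℝ} (hK : K.IsHermitian) (a b : ℝ) (m : ℕ)
    {e : ι → ℝ} {μ : ℝ} (he : K.mulVec e = μ • e) :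
    (windowMatrix K a b m)⁻¹.mulVec e = (1 + ((μ - a) / b) ^ (2 * m))⁻¹ • e := by
  have h1 : (b⁻¹ • (K - a • (1 : Matrix ι ι ℝ))).mulVec e = ((μ - a) / b) • e := by
    rw [Matrix.smul_mulVec, Matrix.sub_mulVec, he, Matrix.smul_mulVec, Matrix.one_mulVec,
      ← sub_smul, smul_smul, div_eq_inv_mul]
  have h2 : (windowMatrix K a b m).mulVec e = (1 + ((μ - a) / b) ^ (2 * m)) • e := by
    rw [windowMatrix, Matrix.add_mulVec, Matrix.one_mulVec, pow_mulVec_of_eigen h1, add_smul,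
      one_smul]
  have hpos : (0 : ℝ) < 1 + ((μ - a) / b) ^ (2 * m) := by
    rw [pow_mul]
    positivity
  have hu : IsUnit (windowMatrix K a b m).det :=
    (Matrix.isUnit_iff_isUnit_det _).1 (windowMatrix_posDef hK a b m).isUnit
  have h3 : (windowMatrix K a b m)⁻¹.mulVec ((windowMatrix K a b m).mulVec e) = e := by
    rw [Matrix.mulVec_mulVec, Matrix.nonsing_inv_mul _ hu, Matrix.one_mulVec]
  rw [h2, Matrix.mulVec_smul] at h3
  calc _ = (1 + ((μ - a) / b) ^ (2 * m))⁻¹ •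
        ((1 + ((μ - a) / b) ^ (2 * m)) • (windowMatrix K a b m)⁻¹.mulVec e) := by
        rw [smul_smul, inv_mul_cancel₀ hpos.ne', one_smul]
    _ = _ := by rw [h3]

/-- Spectral projections are not continuous in the matrix. These rational functions of it are, and
they converge pointwise, which yields the measurability of the witness that Fubini requires. -/
theorem continuous_windowVec {X : Type*} [TopologicalSpace X] {F : X → Matrix ι ι ℝ}
    (hF : Continuous F) (hH : ∀ x, (F x).IsHermitian) (a b : ℝ) (u : EuclideanSpace ℝ ι)
    (m : ℕ) : Continuous fun x => windowVec (F x) a b u m := by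
  have hM : Continuous fun x => windowMatrix (F x) a b m := by
    unfold windowMatrix
    fun_prop
  have hinv : Continuous fun x => (windowMatrix (F x) a b m)⁻¹ := by
    have : ∀ x, (windowMatrix (F x) a b m)⁻¹
        = (windowMatrix (F x) a b m).det⁻¹ • (windowMatrix (F x) a b m).adjugate := fun x => by
      rw [Matrix.inv_def, Ring.inverse_eq_inv']
    simp_rw [this]
    refine Continuous.smul (Continuous.inv₀ hM.matrix_det fun x => ?_) hM.matrix_adjugate
    exact (windowMatrix_posDef (hH x) a b m).det_pos.ne'
  unfold windowVec
  exact (PiLp.continuous_toLp 2 _).comp (hinv.matrix_mulVec continuous_const)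

/-- The limit of `(1 + t ^ (2 m))⁻¹`. -/
noncomputable def windowLimit (t : ℝ) : ℝ :=
  if t ^ 2 < 1 then 1 else if t ^ 2 = 1 then 1 / 2 else 0

theorem tendsto_windowLimit (t : ℝ) :
    Filter.Tendsto (fun m : ℕ => (1 + t ^ (2 * m))⁻¹) Filter.atTop (nhds (windowLimit t)) := by
  simp_rw [pow_mul]
  unfold windowLimit
  split_ifs with h1 h2
  · have := (tendsto_pow_atTop_nhds_zero_of_lt_one (sq_nonneg t) h1).const_add 1
    simpa using this.inv₀ (by norm_num)
  · simp only [h2, one_pow]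
    norm_num
  · have h3 : 1 < t ^ 2 := lt_of_le_of_ne (not_lt.1 h1) (Ne.symm h2)
    exact (Filter.tendsto_atTop_add_const_left _ _
      (tendsto_pow_atTop_atTop_of_one_lt h3)).inv_tendsto_atTop

theorem windowLimit_nonneg (t : ℝ) : 0 ≤ windowLimit t := by
  unfold windowLimit
  split_ifs <;> norm_num

theorem windowLimit_le_one (t : ℝ) : windowLimit t ≤ 1 := by
  unfold windowLimit
  split_ifs <;> norm_num

/-- A Chebyshev bound: the mass of u lost outside the window is at most its squared eigenvalue error
divided by b². -/
theorem one_sub_sq_le_windowLimit (t : ℝ) : 1 - t ^ 2 ≤ windowLimit t := by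
  unfold windowLimit
  split_ifs with h1 h2 <;> nlinarith [sq_nonneg t]

theorem neg_one_le_of_windowLimit_ne_zero {t : ℝ} (h : windowLimit t ≠ 0) : -1 ≤ t := by
  by_contra hn
  push Not at hn
  apply h
  unfold windowLimit
  rw [if_neg (by nlinarith), if_neg (by nlinarith)]

/-- If `u` is close to being an eigenvector of `K` for `a`, then its truncation to the window
`[a - b, a + b]` of eigenvalues has a large component along `u`. -/
theorem exists_tendsto_windowVec {K : Matrix ι ι ℝ} (hK : K.IsHermitian) (a b : ℝ) (hb : 0 < b)
    (u : EuclideanSpace ℝ ι) :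
    ∃ v : EuclideanSpace ℝ ι,
      Filter.Tendsto (fun m => windowVec K a b u m) Filter.atTop (nhds v) ∧
      v ∈ cutoffEigenspace K (a - b) ∧ ‖v‖ ≤ ‖u‖ ∧
      ‖u‖ ^ 2 - ‖Matrix.toEuclideanLin K u - a • u‖ ^ 2 / b ^ 2 ≤ inner ℝ u v := by
  set e := hK.eigenvectorBasis with he
  set lam := hK.eigenvalues with hlam
  set c : ι → ℝ := fun i => inner ℝ (e i) u with hc
  set h : ι → ℝ := fun i => windowLimit ((lam i - a) / b) with hh
  have hue : u = ∑ i, c i • e i := (e.sum_repr' u).symm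
  have hwin : ∀ m, windowVec K a b u m
      = ∑ i, ((1 + ((lam i - a) / b) ^ (2 * m))⁻¹ * c i) • e i := by
    intro m
    have : windowVec K a b u m
        = Matrix.toEuclideanLin (windowMatrix K a b m)⁻¹ u := rfl
    rw [this]
    conv_lhs => rw [hue]
    rw [map_sum]
    refine Finset.sum_congr rfl fun i _ => ?_
    rw [map_smul]
    have hi : Matrix.toEuclideanLin (windowMatrix K a b m)⁻¹ (e i)
        = (1 + ((lam i - a) / b) ^ (2 * m))⁻¹ • e i := by
      have := windowMatrix_inv_mulVec hK a b m (hK.mulVec_eigenvectorBasis i)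
      exact congrArg (WithLp.toLp 2) this
    rw [hi, smul_smul, mul_comm]
  have hKe : ∀ i, Matrix.toEuclideanLin K (e i) = lam i • e i := fun i =>
    congrArg (WithLp.toLp 2) (hK.mulVec_eigenvectorBasis i)
  set v : EuclideanSpace ℝ ι := ∑ i, (h i * c i) • e i with hv
  have hev : ∀ i, inner ℝ (e i) v = h i * c i := fun i => by
    rw [hv, e.orthonormal.inner_right_fintype]
  have hnorm : ∀ w : EuclideanSpace ℝ ι, ‖w‖ ^ 2 = ∑ i, (inner ℝ (e i) w : ℝ) ^ 2 := fun w => by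
    rw [← e.sum_sq_norm_inner_right w]
    simp
  refine ⟨v, ?_, ?_, ?_, ?_⟩
  · simp_rw [hwin]
    exact tendsto_finsetSum _ fun i _ => ((tendsto_windowLimit _).mul_const _).smul_const _
  · refine Submodule.sum_mem _ fun i _ => ?_
    -- Only eigenvalues of at least a - b carry a nonzero weight; on the edge of the window the
    -- weight is 1/2.
    by_cases h0 : h i = 0
    · rw [h0, zero_mul, zero_smul]
      exact Submodule.zero_mem _
    · refine Submodule.smul_mem _ _ ?_
      have hl : a - b ≤ lam i := by
        have := neg_one_le_of_windowLimit_ne_zero h0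
        rw [le_div_iff₀ hb] at this
        linarith
      have hm : e i ∈ Module.End.eigenspace (Matrix.toEuclideanLin K) (lam i) :=
        Module.End.mem_eigenspace_iff.2 (hKe i)
      exact Submodule.mem_iSup_of_mem (lam i) (Submodule.mem_iSup_of_mem hl hm)
  · refine le_of_sq_le_sq ?_ (norm_nonneg _)
    rw [hnorm v, hnorm u]
    refine Finset.sum_le_sum fun i _ => ?_
    rw [hev, mul_pow]
    have h1 := windowLimit_nonneg ((lam i - a) / b)
    have h2 := windowLimit_le_one ((lam i - a) / b)
    exact mul_le_of_le_one_left (sq_nonneg _) (pow_le_one₀ h1 h2)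
  · have hKu : ∀ i, inner ℝ (e i) (Matrix.toEuclideanLin K u - a • u) = (lam i - a) * c i := by
      intro i
      have : Matrix.toEuclideanLin K u - a • u = ∑ i, ((lam i - a) * c i) • e i := by
        conv_lhs => rw [hue]
        rw [map_sum, Finset.smul_sum, ← Finset.sum_sub_distrib]
        refine Finset.sum_congr rfl fun i _ => ?_
        rw [map_smul, hKe, smul_smul, smul_smul, ← sub_smul]
        congr 1
        ring
      rw [this, e.orthonormal.inner_right_fintype]
    have huv : (inner ℝ u v : ℝ) = ∑ i, h i * c i ^ 2 := by
      rw [← e.sum_inner_mul_inner u v]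
      refine Finset.sum_congr rfl fun i _ => ?_
      rw [hev, real_inner_comm]
      ring
    rw [hnorm, hnorm (_ - _), huv, Finset.sum_div, ← Finset.sum_sub_distrib]
    refine Finset.sum_le_sum fun i _ => ?_
    rw [hKu]
    have := mul_le_mul_of_nonneg_right (one_sub_sq_le_windowLimit ((lam i - a) / b))
      (sq_nonneg (c i))
    refine le_trans (le_of_eq ?_) this
    rw [div_pow]
    ring

end Spectral

end TensorPCA

namespace TensorPCA

/-! ### Mixed moments of products of independent affine and exponential factors. -/

section GaussianProducts

variable {ι : Type*} [Fintype ι] [DecidableEq ι]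

theorem prod_mul_prod_eq_prod_univ (P P' : Finset ι) (f g : ι → ℝ) :
    (∏ i ∈ P, f i) * ∏ i ∈ P', g i
      = ∏ i, ((if i ∈ P then f i else 1) * (if i ∈ P' then g i else 1)) := by
  rw [Finset.prod_mul_distrib, Finset.prod_ite_mem, Finset.prod_ite_mem, Finset.univ_inter,
    Finset.univ_inter]

theorem integrable_affine_gaussianReal_std (p s : ℝ) :
    Integrable (fun x => p + s * x) (gaussianReal 0 1) :=
  (integrable_const p).add (integrable_id_gaussianReal_std.const_mul s)

theorem integral_affine_gaussianReal_std (p s : ℝ) :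
    ∫ x, (p + s * x) ∂gaussianReal 0 1 = p := by
  rw [integral_add (integrable_const p) (integrable_id_gaussianReal_std.const_mul s),
    integral_const_mul, integral_id_gaussianReal]
  simp

theorem affine_sq_eq (p s : ℝ) :
    (fun x : ℝ => (p + s * x) * (p + s * x)) = fun x => (p ^ 2 + (2 * p * s) * x) + s ^ 2 * x ^ 2 := by
  funext x
  ring

theorem integrable_affine_sq_gaussianReal_std (p s : ℝ) :
    Integrable (fun x => (p + s * x) * (p + s * x)) (gaussianReal 0 1) := by
  rw [affine_sq_eq]
  exact (integrable_affine_gaussianReal_std _ _).add (integrable_sq_gaussianReal_std.const_mul _)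

theorem integral_affine_sq_gaussianReal_std (p s : ℝ) :
    ∫ x, (p + s * x) * (p + s * x) ∂gaussianReal 0 1 = p ^ 2 + s ^ 2 := by
  rw [affine_sq_eq, integral_add (integrable_affine_gaussianReal_std _ _)
    (integrable_sq_gaussianReal_std.const_mul _), integral_affine_gaussianReal_std,
    integral_const_mul, integral_sq_gaussianReal_std, mul_one]

variable (P P' : Finset ι) (p : ι → ℝ) (s : ℝ)

theorem integrable_prod_mul_prod_affine :
    Integrable (fun y : ι → ℝ => (∏ i ∈ P, (p i + s * y i)) * ∏ i ∈ P', (p i + s * y i))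
      (gaussPi ι) := by
  simp_rw [prod_mul_prod_eq_prod_univ]
  refine Integrable.fintype_prod (f := fun i y => (if i ∈ P then (p i + s * y) else 1) *
    (if i ∈ P' then (p i + s * y) else 1)) fun i => ?_
  by_cases h : i ∈ P <;> by_cases h' : i ∈ P' <;> simp only [h, h', if_true, if_false, one_mul,
    mul_one]
  · exact integrable_affine_sq_gaussianReal_std _ _
  · exact integrable_affine_gaussianReal_std _ _
  · exact integrable_affine_gaussianReal_std _ _
  · exact integrable_const _

theorem integral_prod_mul_prod_affine :
    ∫ y : ι → ℝ, (∏ i ∈ P, (p i + s * y i)) * ∏ i ∈ P', (p i + s * y i) ∂gaussPi ι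
      = ∏ i, if i ∈ P then (if i ∈ P' then p i ^ 2 + s ^ 2 else p i)
          else if i ∈ P' then p i else 1 := by
  simp_rw [prod_mul_prod_eq_prod_univ]
  rw [integral_fintype_prod_eq_prod (f := fun i y => (if i ∈ P then (p i + s * y) else 1) *
    (if i ∈ P' then (p i + s * y) else 1))]
  refine Finset.prod_congr rfl fun i _ => ?_
  by_cases h : i ∈ P <;> by_cases h' : i ∈ P' <;> simp only [h, h', if_true, if_false, one_mul,
    mul_one]
  · exact integral_affine_sq_gaussianReal_std _ _
  · exact integral_affine_gaussianReal_std _ _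
  · exact integral_affine_gaussianReal_std _ _
  · simp

/-- The correlation of two monomials in `β w + s y`, where the `w i` are signs. -/
theorem integral_prod_mul_prod_spiked (w : ι → ℝ) (hw : ∀ i, w i ^ 2 = 1) (β : ℝ) (hβ : β ≠ 0) :
    ∫ y : ι → ℝ, (∏ i ∈ P, (β * w i + s * y i)) * ∏ i ∈ P', (β * w i + s * y i) ∂gaussPi ι
      = (β ^ P.card * ∏ i ∈ P, w i) * (β ^ P'.card * ∏ i ∈ P', w i) *
        ∑ B ∈ (P ∩ P').powerset, (s ^ 2 / β ^ 2) ^ B.card := by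
  rw [integral_prod_mul_prod_affine P P' (fun i => β * w i) s]
  -- A common index contributes β² + s² = β²(1 + s²/β²). The product of these factors is kept
  -- expanded over subsets B of the common indices, so that a sum over pairs (P, P') can later be
  -- regrouped into squares.
  have h1 : ∑ B ∈ (P ∩ P').powerset, (s ^ 2 / β ^ 2) ^ B.card
      = ∏ i ∈ P ∩ P', (1 + s ^ 2 / β ^ 2) := by
    rw [Finset.prod_one_add]
    exact Finset.sum_congr rfl fun B _ => by rw [Finset.prod_const]
  have h2 : ∀ Q : Finset ι, β ^ Q.card * ∏ i ∈ Q, w i = ∏ i ∈ Q, (β * w i) := fun Q => by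
    rw [Finset.prod_mul_distrib, Finset.prod_const]
  rw [h1, h2, h2, prod_mul_prod_eq_prod_univ, ← Finset.univ_inter (P ∩ P'),
    ← Finset.prod_ite_mem, ← Finset.prod_mul_distrib]
  refine Finset.prod_congr rfl fun i _ => ?_
  have hi := hw i
  by_cases h : i ∈ P <;> by_cases h' : i ∈ P' <;> simp only [h, h', if_true, if_false, one_mul,
    mul_one, Finset.mem_inter, and_true, true_and, and_self]
  field_simp
  rw [hi]
  ring

theorem integral_sum_sq (A : Finset ι) (c : ι → ℝ) :
    Integrable (fun y : ι → ℝ => (∑ i ∈ A, c i * y i) ^ 2) (gaussPi ι) ∧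
      ∫ y : ι → ℝ, (∑ i ∈ A, c i * y i) ^ 2 ∂gaussPi ι = ∑ i ∈ A, c i ^ 2 := by
  -- Each coordinate is written as a one-element affine product with offset 0 and slope 1, so that
  -- the moment formula above applies.
  have hexp : (fun y : ι → ℝ => (∑ i ∈ A, c i * y i) ^ 2)
      = fun y => ∑ i ∈ A, ∑ j ∈ A, (c i * c j) *
        ((∏ q ∈ ({i} : Finset ι), ((fun _ => (0 : ℝ)) q + 1 * y q)) *
          ∏ q ∈ ({j} : Finset ι), ((fun _ => (0 : ℝ)) q + 1 * y q)) := by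
    funext y
    rw [pow_two, Finset.sum_mul_sum]
    refine Finset.sum_congr rfl fun i _ => Finset.sum_congr rfl fun j _ => ?_
    simp only [Finset.prod_singleton]
    ring
  have hint := fun i j : ι => (integrable_prod_mul_prod_affine {i} {j} (fun _ : ι => (0 : ℝ))
    1).const_mul (c i * c j)
  rw [hexp]
  refine ⟨integrable_finsetSum _ fun i _ => integrable_finsetSum _ fun j _ => hint i j, ?_⟩
  rw [integral_finsetSum _ fun i _ => integrable_finsetSum _ fun j _ => hint i j]
  refine Finset.sum_congr rfl fun i hi => ?_
  rw [integral_finsetSum _ fun j _ => hint i j]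
  have hij : ∀ j ∈ A, ∫ y : ι → ℝ, (c i * c j) *
        ((∏ q ∈ ({i} : Finset ι), ((fun _ => (0 : ℝ)) q + 1 * y q)) *
          ∏ q ∈ ({j} : Finset ι), ((fun _ => (0 : ℝ)) q + 1 * y q)) ∂gaussPi ι
      = if i = j then c i ^ 2 else 0 := by
    intro j _
    rw [integral_const_mul, integral_prod_mul_prod_affine]
    by_cases h : i = j
    · subst h
      rw [if_pos rfl, Finset.prod_eq_one, mul_one, pow_two]
      intro q _
      by_cases hq : q = i <;> simp [hq]
    · rw [if_neg h, Finset.prod_eq_zero (Finset.mem_univ i), mul_zero]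
      simp [h]
  rw [Finset.sum_congr rfl hij, Finset.sum_ite_eq, if_pos hi]

/-- The free offset r lets the same formula serve for the second moment of the tilt weight and for
the mean of its inverse. -/
theorem integral_prod_exp (T : Finset ι) (t : ι → ℝ) (r : ℝ) :
    Integrable (fun y : ι → ℝ => ∏ i ∈ T, Real.exp (t i * y i - r)) (gaussPi ι) ∧
      ∫ y : ι → ℝ, ∏ i ∈ T, Real.exp (t i * y i - r) ∂gaussPi ι
        = ∏ i ∈ T, Real.exp (t i ^ 2 / 2 - r) := by
  have h : ∀ y : ι → ℝ, ∏ i ∈ T, Real.exp (t i * y i - r)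
      = ∏ i, (fun (i : ι) (x : ℝ) => if i ∈ T then Real.exp (t i * x - r) else 1) i (y i) := by
    intro y
    rw [Finset.prod_ite_mem, Finset.univ_inter]
  simp_rw [h]
  constructor
  · refine Integrable.fintype_prod
      (f := fun (i : ι) (x : ℝ) => if i ∈ T then Real.exp (t i * x - r) else 1) fun i => ?_
    by_cases hi : i ∈ T <;> simp only [hi, if_true, if_false]
    · exact integrable_exp_gaussianReal_std _ _
    · exact integrable_const _
  · rw [integral_fintype_prod_eq_prod
      (f := fun (i : ι) (x : ℝ) => if i ∈ T then Real.exp (t i * x - r) else 1),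
      ← Finset.univ_inter T, ← Finset.prod_ite_mem]
    refine Finset.prod_congr rfl fun i _ => ?_
    by_cases hi : i ∈ T <;> simp only [hi, if_true, if_false, Finset.univ_inter]
    · have : (fun x => Real.exp (t i * x - r))
          = fun x => Real.exp (t i ^ 2 / 2 - r) * Real.exp (t i * x - t i ^ 2 / 2) := by
        funext x
        rw [← Real.exp_add]
        congr 1
        ring
      rw [this, integral_const_mul, integral_exp_gaussianReal_std, mul_one]
    · simp

/-- Weighting by an exponential shifts the mean (Cameron–Martin). -/
theorem integral_prod_exp_mul_prod_spiked (T : Finset ι) (hP : P ⊆ T) (w : ι → ℝ)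
    (hw : ∀ i, w i ^ 2 = 1) (β τ : ℝ) :
    Integrable (fun y : ι → ℝ => (∏ i ∈ T, Real.exp (τ * w i * y i - τ ^ 2 / 2)) *
        ∏ i ∈ P, (β * w i + s * y i)) (gaussPi ι) ∧
      ∫ y : ι → ℝ, (∏ i ∈ T, Real.exp (τ * w i * y i - τ ^ 2 / 2)) *
        ∏ i ∈ P, (β * w i + s * y i) ∂gaussPi ι
        = (β + s * τ) ^ P.card * ∏ i ∈ P, w i := by
  have h : ∀ y : ι → ℝ, (∏ i ∈ T, Real.exp (τ * w i * y i - τ ^ 2 / 2)) *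
        ∏ i ∈ P, (β * w i + s * y i)
      = ∏ i, (fun (i : ι) (x : ℝ) => (if i ∈ T then Real.exp (τ * w i * x - τ ^ 2 / 2) else 1) *
          (if i ∈ P then β * w i + s * x else 1)) i (y i) := by
    intro y
    rw [prod_mul_prod_eq_prod_univ]
  simp_rw [h]
  have hsplit : ∀ i, (fun x : ℝ => Real.exp (τ * w i * x - τ ^ 2 / 2) * (β * w i + s * x))
      = fun x => (β * w i) * Real.exp (τ * w i * x - τ ^ 2 / 2)
        + s * (x * Real.exp (τ * w i * x - τ ^ 2 / 2)) := by
    intro i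
    funext x
    ring
  have hsq : ∀ i, τ ^ 2 / 2 = (τ * w i) ^ 2 / 2 := fun i => by rw [mul_pow, hw, mul_one]
  constructor
  · refine Integrable.fintype_prod
      (f := fun (i : ι) (x : ℝ) =>
      (if i ∈ T then Real.exp (τ * w i * x - τ ^ 2 / 2) else 1) *
        (if i ∈ P then β * w i + s * x else 1)) fun i => ?_
    by_cases hi : i ∈ T <;> by_cases hi' : i ∈ P <;>
      simp only [hi, hi', if_true, if_false, one_mul, mul_one]
    · rw [hsplit]
      exact ((integrable_exp_gaussianReal_std _ _).const_mul _).add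
        ((integrable_mul_exp_gaussianReal_std _ _).const_mul _)
    · exact integrable_exp_gaussianReal_std _ _
    · exact absurd (hP hi') hi
    · exact integrable_const _
  · rw [integral_fintype_prod_eq_prod
      (f := fun (i : ι) (x : ℝ) =>
      (if i ∈ T then Real.exp (τ * w i * x - τ ^ 2 / 2) else 1) *
        (if i ∈ P then β * w i + s * x else 1)),
      ← Finset.prod_const, ← Finset.prod_mul_distrib,
      ← Finset.univ_inter P, ← Finset.prod_ite_mem]
    refine Finset.prod_congr rfl fun i _ => ?_
    simp only [Finset.univ_inter]
    by_cases hi : i ∈ T <;> by_cases hi' : i ∈ P <;>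
      simp only [hi, hi', if_true, if_false, one_mul, mul_one]
    · rw [hsplit, integral_add ((integrable_exp_gaussianReal_std _ _).const_mul _)
        ((integrable_mul_exp_gaussianReal_std _ _).const_mul _), integral_const_mul,
        integral_const_mul, hsq i, integral_exp_gaussianReal_std,
        integral_mul_exp_gaussianReal_std]
      ring
    · rw [hsq i, integral_exp_gaussianReal_std]
    · exact absurd (hP hi') hi
    · simp

end GaussianProducts

/-! ### The planted vector as an approximate eigenvector of the Kikuchi matrix. -/

section Kikuchi

variable {n k ℓ : ℕ}

/-- The Kikuchi matrix of a family of entries. -/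
noncomputable def kikuchiOf (k ℓ : ℕ) (t : Finset (Fin n) → ℝ) :
    Matrix (Sub n ℓ) (Sub n ℓ) ℝ :=
  ∑ S ∈ level (Fin n) k, t S • kikuchiMatching n ℓ S

theorem kikuchi_eq_kikuchiOf (T : Tensor n k) : kikuchi ℓ T = kikuchiOf k ℓ (entries T) := rfl

theorem kikuchiOf_isHermitian (t : Finset (Fin n) → ℝ) : (kikuchiOf k ℓ t).IsHermitian := by
  refine Matrix.IsHermitian.ext fun V U => ?_
  simp only [kikuchiOf, Matrix.sum_apply, Matrix.smul_apply, kikuchiMatching, Matrix.of_apply,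
    star_trivial]
  simp_rw [symmDiff_comm]

theorem continuous_kikuchiOf : Continuous (kikuchiOf k ℓ : (Finset (Fin n) → ℝ) → _) := by
  unfold kikuchiOf
  fun_prop

theorem kikuchiOf_add_smul (t t' : Finset (Fin n) → ℝ) (a b : ℝ) :
    kikuchiOf k ℓ (a • t + b • t') = a • kikuchiOf k ℓ t + b • kikuchiOf k ℓ t' := by
  simp only [kikuchiOf, Finset.smul_sum, ← Finset.sum_add_distrib]
  refine Finset.sum_congr rfl fun S _ => ?_
  simp only [Pi.add_apply, Pi.smul_apply, smul_eq_mul, add_smul, smul_smul]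

/-- `z_S = ∏_{i ∈ S} z_i`. -/
def signProd (z : Fin n → ℝ) (S : Finset (Fin n)) : ℝ := ∏ i ∈ S, z i

variable {z : Fin n → ℝ}

theorem signProd_sq (hz : ∀ i, z i = 1 ∨ z i = -1) (S : Finset (Fin n)) : signProd z S ^ 2 = 1 := by
  rw [signProd, ← Finset.prod_pow]
  refine Finset.prod_eq_one fun i _ => ?_
  rcases hz i with h | h <;> simp [h]

/-- Elements of V ∩ S occur twice on the right, and signs square to one. This multiplicativity is
why the planted vector is an eigenvector. -/
theorem signProd_symmDiff (hz : ∀ i, z i = 1 ∨ z i = -1) (V S : Finset (Fin n)) :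
    signProd z (symmDiff V S) = signProd z V * signProd z S := by
  have h1 : signProd z V = signProd z (V \ S) * signProd z (V ∩ S) := by
    rw [signProd, signProd, signProd, ← Finset.prod_union (Finset.disjoint_sdiff_inter V S),
      Finset.sdiff_union_inter]
  have h2 : signProd z S = signProd z (S \ V) * signProd z (V ∩ S) := by
    rw [signProd, signProd, signProd, Finset.inter_comm,
      ← Finset.prod_union (Finset.disjoint_sdiff_inter S V), Finset.sdiff_union_inter]
  have h3 : signProd z (symmDiff V S) = signProd z (V \ S) * signProd z (S \ V) := by
    rw [symmDiff_def, Finset.sup_eq_union, signProd, Finset.prod_union]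
    · rfl
    · exact Finset.disjoint_of_subset_right Finset.sdiff_subset Finset.sdiff_disjoint
  have h4 := signProd_sq hz (V ∩ S)
  rw [h1, h2, h3]
  linear_combination -(signProd z (V \ S) * signProd z (S \ V)) * h4

/-- The planted unit vector, with coordinates `z_V / √C(n,ℓ)`. -/
noncomputable def plantedVec (ℓ : ℕ) (z : Fin n → ℝ) : EuclideanSpace ℝ (Sub n ℓ) :=
  WithLp.toLp 2 fun V => signProd z V.1 / Real.sqrt (n.choose ℓ)

theorem card_sub (n ℓ : ℕ) : Fintype.card (Sub n ℓ) = n.choose ℓ := by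
  simp

theorem sum_sub_eq (f : Finset (Fin n) → ℝ) :
    ∑ V : Sub n ℓ, f V.1 = ∑ V ∈ level (Fin n) ℓ, f V :=
  (Finset.sum_subtype _ (fun _ => Finset.mem_powersetCard_univ) f).symm

theorem norm_plantedVec (hz : ∀ i, z i = 1 ∨ z i = -1) (hℓ : ℓ ≤ n) : ‖plantedVec ℓ z‖ = 1 := by
  have hN : (0 : ℝ) < n.choose ℓ := by exact_mod_cast Nat.choose_pos hℓ
  have : ‖plantedVec ℓ z‖ ^ 2 = 1 := by
    rw [EuclideanSpace.norm_sq_eq]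
    have : ∀ V : Sub n ℓ, ‖(plantedVec ℓ z) V‖ ^ 2 = 1 / (n.choose ℓ : ℝ) := by
      intro V
      rw [Real.norm_eq_abs, sq_abs]
      simp only [plantedVec]
      rw [div_pow, signProd_sq hz, Real.sq_sqrt hN.le]
    rw [Finset.sum_congr rfl fun V _ => this V, Finset.sum_const, Finset.card_univ, card_sub,
      nsmul_eq_mul]
    field_simp
  exact (pow_eq_one_iff_of_nonneg (norm_nonneg _) two_ne_zero).1 this

theorem card_symmDiff_add (V S : Finset (Fin n)) :
    (symmDiff V S).card + 2 * (S ∩ V).card = V.card + S.card := by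
  have h1 := Finset.card_sdiff_add_card_inter V S
  have h2 := Finset.card_sdiff_add_card_inter S V
  have h3 : (symmDiff V S).card = (V \ S).card + (S \ V).card := by
    rw [symmDiff_def, Finset.sup_eq_union, Finset.card_union_of_disjoint]
    exact Finset.disjoint_of_subset_right Finset.sdiff_subset Finset.sdiff_disjoint
  rw [Finset.inter_comm V S] at h1
  omega

/-- The Kikuchi graph is regular of degree `d_ℓ`. -/
theorem card_filter_symmDiff (hk : Even k) (V : Finset (Fin n)) (hV : V.card = ℓ) :
    ((level (Fin n) k).filter fun S => (symmDiff V S).card = ℓ).card = kikuchiDegree n k ℓ := by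
  obtain ⟨r, hr⟩ := hk
  have hr2 : k / 2 = r := by omega
  have hcard : kikuchiDegree n k ℓ
      = ((Vᶜ.powersetCard r) ×ˢ (V.powersetCard r)).card := by
    rw [Finset.card_product, Finset.card_powersetCard, Finset.card_powersetCard,
      Finset.card_compl, Fintype.card_fin, hV, kikuchiDegree, hr2]
  rw [hcard]
  -- |V ∆ S| = |V| forces S to have half of its elements inside V and half outside, and the two
  -- halves are arbitrary.
  refine Finset.card_bij' (fun S _ => (S \ V, S ∩ V)) (fun p _ => p.1 ∪ p.2) ?_ ?_ ?_ ?_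
  · intro S hS
    rw [Finset.mem_filter, Finset.mem_powersetCard_univ] at hS
    have h1 := card_symmDiff_add V S
    have h2 := Finset.card_sdiff_add_card_inter S V
    rw [Finset.mem_product, Finset.mem_powersetCard, Finset.mem_powersetCard]
    refine ⟨⟨fun x hx => by simpa using (Finset.mem_sdiff.1 hx).2, ?_⟩,
      Finset.inter_subset_right, ?_⟩ <;> simp only <;> omega
  · rintro ⟨A, B⟩ hp
    simp only [Finset.mem_product, Finset.mem_powersetCard] at hp
    obtain ⟨⟨hA, hAc⟩, hB, hBc⟩ := hp
    have hAV : Disjoint A V := Finset.disjoint_left.2 fun x hx => by simpa using hA hx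
    have hi : (A ∪ B) ∩ V = B := by
      rw [Finset.union_inter_distrib_right, Finset.disjoint_iff_inter_eq_empty.1 hAV,
        Finset.empty_union, Finset.inter_eq_left.2 hB]
    have hc : (A ∪ B).card = k := by
      rw [Finset.card_union_of_disjoint (Finset.disjoint_of_subset_right hB hAV)]
      omega
    have h1 := card_symmDiff_add V (A ∪ B)
    rw [hi] at h1
    rw [Finset.mem_filter, Finset.mem_powersetCard_univ]
    refine ⟨hc, ?_⟩
    simp only
    omega
  · intro S _
    exact Finset.sdiff_union_inter S V
  · rintro ⟨A, B⟩ hp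
    simp only [Finset.mem_product, Finset.mem_powersetCard] at hp
    obtain ⟨⟨hA, -⟩, hB, -⟩ := hp
    have hAV : Disjoint A V := Finset.disjoint_left.2 fun x hx => by simpa using hA hx
    refine Prod.ext ?_ ?_
    · simp only
      rw [Finset.union_sdiff_distrib, Finset.sdiff_eq_empty_iff_subset.2 hB, Finset.union_empty,
        Finset.sdiff_eq_self_of_disjoint hAV]
    · simp only
      rw [Finset.union_inter_distrib_right, Finset.disjoint_iff_inter_eq_empty.1 hAV,
        Finset.empty_union, Finset.inter_eq_left.2 hB]

/-- The `V`-coordinate of the matching of `S` applied to the planted vector. -/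
noncomputable def matchingCoeff (ℓ : ℕ) (z : Fin n → ℝ) (V S : Finset (Fin n)) : ℝ :=
  if (symmDiff V S).card = ℓ then signProd z V * signProd z S / Real.sqrt (n.choose ℓ) else 0

theorem kikuchiMatching_mulVec_plantedVec (hz : ∀ i, z i = 1 ∨ z i = -1) (V : Sub n ℓ) (S : Finset (Fin n)) :
    (kikuchiMatching n ℓ S).mulVec (plantedVec ℓ z).ofLp V = matchingCoeff ℓ z V.1 S := by
  have hiff : ∀ U : Finset (Fin n), symmDiff V.1 U = S ↔ U = symmDiff V.1 S := by
    intro U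
    constructor
    · rintro rfl
      rw [symmDiff_symmDiff_cancel_left]
    · rintro rfl
      rw [symmDiff_symmDiff_cancel_left]
  simp only [Matrix.mulVec, dotProduct, kikuchiMatching, Matrix.of_apply, ite_mul, one_mul,
    zero_mul, hiff]
  unfold matchingCoeff
  split_ifs with h
  · rw [Finset.sum_eq_single_of_mem (⟨symmDiff V.1 S, h⟩ : Sub n ℓ) (Finset.mem_univ _)]
    · rw [if_pos rfl]
      simp only [plantedVec]
      rw [signProd_symmDiff hz]
    · intro U _ hU
      exact if_neg fun e => hU (Subtype.ext e)
  · refine Finset.sum_eq_zero fun U _ => if_neg fun e => h ?_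
    rw [← e, U.2]

theorem kikuchiOf_mulVec_plantedVec (hz : ∀ i, z i = 1 ∨ z i = -1) (t : Finset (Fin n) → ℝ) (V : Sub n ℓ) :
    (kikuchiOf k ℓ t).mulVec (plantedVec ℓ z).ofLp V
      = ∑ S ∈ level (Fin n) k, matchingCoeff ℓ z V.1 S * t S := by
  rw [kikuchiOf, Matrix.sum_mulVec, Finset.sum_apply]
  refine Finset.sum_congr rfl fun S _ => ?_
  rw [Matrix.smul_mulVec, Pi.smul_apply, kikuchiMatching_mulVec_plantedVec hz, smul_eq_mul,
    mul_comm]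

/-- The planted vector is an eigenvector of the Kikuchi matrix of the signal. -/
theorem toEuclideanLin_kikuchiOf_signProd (hz : ∀ i, z i = 1 ∨ z i = -1) (hk : Even k) :
    Matrix.toEuclideanLin (kikuchiOf k ℓ (signProd z)) (plantedVec ℓ z)
      = (kikuchiDegree n k ℓ : ℝ) • plantedVec ℓ z := by
  ext V
  change (kikuchiOf k ℓ (signProd z)).mulVec (plantedVec ℓ z).ofLp V = _
  rw [kikuchiOf_mulVec_plantedVec hz]
  simp only [PiLp.smul_apply, smul_eq_mul, plantedVec]
  have : ∀ S ∈ level (Fin n) k, matchingCoeff ℓ z V.1 S * signProd z S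
      = if (symmDiff V.1 S).card = ℓ then signProd z V.1 / Real.sqrt (n.choose ℓ) else 0 := by
    intro S _
    unfold matchingCoeff
    split_ifs
    · linear_combination signProd z V.1 / Real.sqrt (n.choose ℓ) * signProd_sq hz S
    · rw [zero_mul]
  rw [Finset.sum_congr rfl this, ← Finset.sum_filter, Finset.sum_const,
    card_filter_symmDiff hk V.1 V.2, nsmul_eq_mul]

/-- Each coordinate of the image is a sum of d_ℓ independent Gaussians with coefficients ±1/√C(n,ℓ).
Correlations between coordinates do not affect the expected squared norm. -/
theorem integral_norm_sq_kikuchiOf (hz : ∀ i, z i = 1 ∨ z i = -1) (hk : Even k) (hℓ : ℓ ≤ n) :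
    Integrable (fun x => ‖Matrix.toEuclideanLin (kikuchiOf k ℓ x) (plantedVec ℓ z)‖ ^ 2)
        (gaussPi (Finset (Fin n))) ∧
      ∫ x, ‖Matrix.toEuclideanLin (kikuchiOf k ℓ x) (plantedVec ℓ z)‖ ^ 2
        ∂gaussPi (Finset (Fin n)) = kikuchiDegree n k ℓ := by
  have hN : (0 : ℝ) < n.choose ℓ := by exact_mod_cast Nat.choose_pos hℓ
  have hexp : ∀ x : Finset (Fin n) → ℝ,
      ‖Matrix.toEuclideanLin (kikuchiOf k ℓ x) (plantedVec ℓ z)‖ ^ 2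
        = ∑ V : Sub n ℓ, (∑ S ∈ level (Fin n) k, matchingCoeff ℓ z V.1 S * x S) ^ 2 := by
    intro x
    rw [EuclideanSpace.norm_sq_eq]
    refine Finset.sum_congr rfl fun V _ => ?_
    rw [Real.norm_eq_abs, sq_abs, ← kikuchiOf_mulVec_plantedVec hz]
    rfl
  simp_rw [hexp]
  have hV := fun V : Sub n ℓ => integral_sum_sq (level (Fin n) k) (matchingCoeff ℓ z V.1)
  refine ⟨integrable_finsetSum _ fun V _ => (hV V).1, ?_⟩
  rw [integral_finsetSum _ fun V _ => (hV V).1]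
  have hval : ∀ V : Sub n ℓ, ∫ x, (∑ S ∈ level (Fin n) k, matchingCoeff ℓ z V.1 S * x S) ^ 2
      ∂gaussPi (Finset (Fin n)) = kikuchiDegree n k ℓ / n.choose ℓ := by
    intro V
    rw [(hV V).2]
    have : ∀ S ∈ level (Fin n) k, matchingCoeff ℓ z V.1 S ^ 2
        = if (symmDiff V.1 S).card = ℓ then 1 / (n.choose ℓ : ℝ) else 0 := by
      intro S _
      unfold matchingCoeff
      split_ifs
      · rw [div_pow, mul_pow, signProd_sq hz, signProd_sq hz, Real.sq_sqrt hN.le, mul_one]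
      · simp
    rw [Finset.sum_congr rfl this, ← Finset.sum_filter, Finset.sum_const,
      card_filter_symmDiff hk V.1 V.2, nsmul_eq_mul, mul_one_div]
  rw [Finset.sum_congr rfl fun V _ => hval V, Finset.sum_const, Finset.card_univ, card_sub,
    nsmul_eq_mul]
  field_simp

end Kikuchi

end TensorPCA

namespace TensorPCA

/-! ### First and second moments of the overlap with the guiding vector. -/

section Guiding

variable {n k ℓ c : ℕ}

/-- The polynomial `∑_V g_V ∑_{P ∈ Part_k(V)} ∏_{S ∈ P} t_S`. -/
noncomputable def partitionPoly (k ℓ : ℕ) (g : Finset (Fin n) → ℝ) (t : Finset (Fin n) → ℝ) : ℝ :=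
  ∑ V ∈ level (Fin n) ℓ, g V * ∑ P ∈ parts k V, ∏ S ∈ P, t S

theorem partitionPoly_eq_sum_sigma (g t : Finset (Fin n) → ℝ) :
    partitionPoly k ℓ g t
      = ∑ q ∈ (level (Fin n) ℓ).sigma (parts k), g q.1 * ∏ S ∈ q.2, t S := by
  simp_rw [partitionPoly, Finset.mul_sum]
  rw [Finset.sum_sigma]

/-- The affine image `β z_S + s y_S` of the noise. -/
noncomputable def noisy (β : ℝ) (z : Fin n → ℝ) (s : ℝ) (y : Finset (Fin n) → ℝ) :
    Finset (Fin n) → ℝ := fun S => β * signProd z S + s * y S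

theorem continuous_noisy (β : ℝ) (z : Fin n → ℝ) (s : ℝ) : Continuous (noisy β z s) := by
  unfold noisy
  fun_prop

/-- The count depends on B only through its number of blocks and the set it covers; this allows the
grouping by covered sets below. -/
theorem card_filter_parts_superset_eq (hk : 0 < k) (hℓ : ℓ = c * k) {V : Finset (Fin n)}
    (hV : V ∈ level (Fin n) ℓ) (B : Finset (Finset (Fin n))) :
    ((parts k V).filter (B ⊆ ·)).card
      = if B ∈ parts k (B.biUnion id) ∧ B.biUnion id ⊆ V then
          numParts k ((c - B.card) * k) else 0 := by
  rw [Finset.mem_powersetCard_univ] at hV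
  split_ifs with h
  · rw [card_parts_filter_superset hk h.1 h.2]
    apply card_parts_eq_numParts hk
    rw [Finset.card_sdiff_of_subset h.2, card_eq_of_mem_parts h.1, hV, hℓ, Nat.sub_mul]
  · rw [Finset.card_eq_zero, Finset.filter_eq_empty_iff]
    intro P hP hB
    exact h (mem_parts_of_subset hP hB)

theorem supersetSum_eq_zero {W : Finset (Fin n)} (hW : ℓ < W.card) (f : Finset (Fin n) → ℝ) :
    supersetSum ℓ f W = 0 := by
  rw [supersetSum, Finset.sum_eq_zero]
  intro V hV
  rw [Finset.mem_filter, Finset.mem_powersetCard_univ] at hV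
  have := Finset.card_le_card hV.2
  omega

/-- Summation over all matchings, grouped by the covered set. -/
theorem sum_matchings (hk : 0 < k) (hℓ : ℓ = c * k) (f : Finset (Fin n) → ℝ) (r : ℝ) :
    ∑ B : Finset (Finset (Fin n)), r ^ B.card *
        (if B ∈ parts k (B.biUnion id) then
          (numParts k ((c - B.card) * k) : ℝ) * supersetSum ℓ f (B.biUnion id) else 0) ^ 2
      = ∑ j ∈ Finset.range (c + 1), r ^ j * numParts k (j * k) *
          (numParts k ((c - j) * k) : ℝ) ^ 2 *
          ∑ W ∈ level (Fin n) (j * k), supersetSum ℓ f W ^ 2 := by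
  set H : Finset (Fin n) → ℝ := fun W => ∑ B ∈ parts k W, r ^ B.card *
    ((numParts k ((c - B.card) * k) : ℝ) * supersetSum ℓ f W) ^ 2 with hH
  have h1 : ∑ B : Finset (Finset (Fin n)), r ^ B.card *
        (if B ∈ parts k (B.biUnion id) then
          (numParts k ((c - B.card) * k) : ℝ) * supersetSum ℓ f (B.biUnion id) else 0) ^ 2
      = ∑ W, H W := by
    rw [← Finset.sum_fiberwise (s := Finset.univ)
      (g := fun B : Finset (Finset (Fin n)) => B.biUnion id)]
    refine Finset.sum_congr rfl fun W _ => ?_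
    have hsub : parts k W ⊆ Finset.univ.filter fun B => B.biUnion id = W := by
      intro B hB
      rw [Finset.mem_filter]
      exact ⟨Finset.mem_univ _, (mem_parts.1 hB).2.2⟩
    rw [← Finset.sum_subset hsub]
    · refine Finset.sum_congr rfl fun B hB => ?_
      have hU := (mem_parts.1 hB).2.2
      rw [hU, if_pos hB]
    · intro B hB hBn
      rw [(Finset.mem_filter.1 hB).2, if_neg hBn]
      simp
  have h2 : ∀ j ∈ Finset.range (c + 1), r ^ j * numParts k (j * k) *
          (numParts k ((c - j) * k) : ℝ) ^ 2 *
          ∑ W ∈ level (Fin n) (j * k), supersetSum ℓ f W ^ 2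
      = ∑ W, if W.card = j * k then H W else 0 := by
    intro j _
    have hlev : level (Fin n) (j * k) = Finset.univ.filter fun W => W.card = j * k := by
      ext W
      simp
    rw [hlev, Finset.mul_sum, ← Finset.sum_filter]
    refine Finset.sum_congr rfl fun W hW => ?_
    have hWc := (Finset.mem_filter.1 hW).2
    have : ∀ B ∈ parts k W, r ^ B.card *
        ((numParts k ((c - B.card) * k) : ℝ) * supersetSum ℓ f W) ^ 2
        = r ^ j * ((numParts k ((c - j) * k) : ℝ) * supersetSum ℓ f W) ^ 2 := by
      intro B hB
      rw [card_eq_of_mem_parts_mul hk hWc hB]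
    rw [hH]
    simp only
    rw [Finset.sum_congr rfl this, Finset.sum_const, card_parts_eq_numParts hk hWc,
      nsmul_eq_mul]
    ring
  rw [h1, Finset.sum_congr rfl h2, Finset.sum_comm]
  refine Finset.sum_congr rfl fun W _ => ?_
  by_cases hW : ∃ j ∈ Finset.range (c + 1), W.card = j * k
  · obtain ⟨j, hj, hWj⟩ := hW
    rw [Finset.sum_eq_single_of_mem j hj, if_pos hWj]
    intro i _ hij
    rw [if_neg]
    intro h
    exact hij (Nat.eq_of_mul_eq_mul_right hk (h.symm.trans hWj))
  -- No j ≤ c fits this W, so a matching that covers it has more than c blocks; then |W| > ℓ and W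
  -- has no ℓ-element superset.
  · rw [Finset.sum_eq_zero fun j hj => if_neg fun h => hW ⟨j, hj, h⟩]
    refine Finset.sum_eq_zero fun B hB => ?_
    have hc := card_eq_of_mem_parts hB
    have hlt : c < B.card := by
      by_contra hle
      exact hW ⟨B.card, by simp; omega, hc⟩
    rw [supersetSum_eq_zero (by rw [hc, hℓ]; exact Nat.mul_lt_mul_of_pos_right hlt hk)]
    ring

/-- The second moment of a linear functional of the unnormalized guiding vector. -/
theorem integral_partitionPoly_sq (hk : 0 < k) (hℓ : ℓ = c * k) {z : Fin n → ℝ}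
    (hz : ∀ i, z i = 1 ∨ z i = -1) (β s : ℝ) (hβ : β ≠ 0) (g : Finset (Fin n) → ℝ) :
    Integrable (fun y => partitionPoly k ℓ g (noisy β z s y) ^ 2) (gaussPi (Finset (Fin n))) ∧
      ∫ y, partitionPoly k ℓ g (noisy β z s y) ^ 2 ∂gaussPi (Finset (Fin n))
        = β ^ (2 * c) * ∑ j ∈ Finset.range (c + 1), (s ^ 2 / β ^ 2) ^ j * numParts k (j * k) *
          (numParts k ((c - j) * k) : ℝ) ^ 2 *
          ∑ W ∈ level (Fin n) (j * k), supersetSum ℓ (fun V => g V * signProd z V) W ^ 2 := by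
  set I := (level (Fin n) ℓ).sigma (parts k) with hI
  have hexp : (fun y => partitionPoly k ℓ g (noisy β z s y) ^ 2)
      = fun y => ∑ q ∈ I, ∑ q' ∈ I, (g q.1 * g q'.1) *
        ((∏ S ∈ q.2, (β * signProd z S + s * y S)) *
          ∏ S ∈ q'.2, (β * signProd z S + s * y S)) := by
    funext y
    rw [partitionPoly_eq_sum_sigma, pow_two, Finset.sum_mul_sum]
    refine Finset.sum_congr rfl fun q _ => Finset.sum_congr rfl fun q' _ => ?_
    simp only [noisy]
    ring
  have hint := fun q q' : (_ : Finset (Fin n)) × Finset (Finset (Fin n)) =>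
    (integrable_prod_mul_prod_affine q.2 q'.2 (fun S => β * signProd z S) s).const_mul
      (g q.1 * g q'.1)
  rw [hexp]
  refine ⟨integrable_finsetSum _ fun q _ => integrable_finsetSum _ fun q' _ => hint q q', ?_⟩
  rw [integral_finsetSum _ fun q _ => integrable_finsetSum _ fun q' _ => hint q q']
  have hval : ∀ q ∈ I, β ^ q.2.card * ∏ S ∈ q.2, signProd z S = β ^ c * signProd z q.1 := by
    intro q hq
    rw [hI, Finset.mem_sigma, Finset.mem_powersetCard_univ] at hq
    rw [card_eq_of_mem_parts_mul hk (hq.1.trans hℓ) hq.2]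
    congr 1
    exact prod_parts_eq hq.2 z
  have hstep : ∀ q ∈ I, ∫ y, ∑ q' ∈ I, (g q.1 * g q'.1) *
        ((∏ S ∈ q.2, (β * signProd z S + s * y S)) *
          ∏ S ∈ q'.2, (β * signProd z S + s * y S)) ∂gaussPi (Finset (Fin n))
      = ∑ q' ∈ I, ∑ B : Finset (Finset (Fin n)), β ^ (2 * c) * ((s ^ 2 / β ^ 2) ^ B.card *
          ((if B ⊆ q.2 then g q.1 * signProd z q.1 else 0) *
          (if B ⊆ q'.2 then g q'.1 * signProd z q'.1 else 0))) := by
    intro q hq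
    rw [integral_finsetSum _ fun q' _ => hint q q']
    refine Finset.sum_congr rfl fun q' hq' => ?_
    rw [integral_const_mul, integral_prod_mul_prod_spiked _ _ s (signProd z) (signProd_sq hz) β hβ,
      hval q hq, hval q' hq', Finset.mul_sum, Finset.mul_sum]
    have hpow : (q.2 ∩ q'.2).powerset
        = Finset.univ.filter fun B => B ⊆ q.2 ∧ B ⊆ q'.2 := by
      ext B
      rw [Finset.mem_powerset, Finset.subset_inter_iff, Finset.mem_filter]
      simp
    rw [hpow, Finset.sum_filter]
    refine Finset.sum_congr rfl fun B _ => ?_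
    by_cases h : B ⊆ q.2 <;> by_cases h' : B ⊆ q'.2 <;> simp only [h, h', and_self, if_true,
      if_false, mul_zero, zero_mul, and_true, and_false]
    ring
  rw [Finset.sum_congr rfl hstep]
  -- Summing over the common submatching B first turns the double sum over pairs of partitions into
  -- a nonnegative combination of squares.
  have hswap : ∑ q ∈ I, ∑ q' ∈ I, ∑ B : Finset (Finset (Fin n)),
        β ^ (2 * c) * ((s ^ 2 / β ^ 2) ^ B.card *
          ((if B ⊆ q.2 then g q.1 * signProd z q.1 else 0) *
          (if B ⊆ q'.2 then g q'.1 * signProd z q'.1 else 0)))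
      = β ^ (2 * c) * ∑ B : Finset (Finset (Fin n)), (s ^ 2 / β ^ 2) ^ B.card *
          (∑ q ∈ I, if B ⊆ q.2 then g q.1 * signProd z q.1 else 0) ^ 2 := by
    simp_rw [pow_two (∑ q ∈ I, _), Finset.sum_mul_sum, Finset.mul_sum]
    rw [Finset.sum_comm]
    conv_rhs => rw [Finset.sum_comm]
    rw [Finset.sum_comm]
    refine Finset.sum_congr rfl fun q _ => ?_
    rw [Finset.sum_comm]
  rw [hswap, ← sum_matchings hk hℓ]
  congr 1
  refine Finset.sum_congr rfl fun B _ => ?_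
  congr 2
  rw [hI, Finset.sum_sigma]
  have hV : ∀ V ∈ level (Fin n) ℓ, (∑ P ∈ parts k V, if B ⊆ P then g V * signProd z V else 0)
      = (if B ∈ parts k (B.biUnion id) ∧ B.biUnion id ⊆ V then
          (numParts k ((c - B.card) * k) : ℝ) else 0) * (g V * signProd z V) := by
    intro V hV
    rw [← Finset.sum_filter, Finset.sum_const, card_filter_parts_superset_eq hk hℓ hV,
      nsmul_eq_mul]
    push_cast
    rfl
  rw [Finset.sum_congr rfl hV]
  by_cases hB : B ∈ parts k (B.biUnion id)
  · simp only [hB, true_and, if_true, supersetSum, Finset.mul_sum, Finset.sum_filter, ite_mul,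
      zero_mul, mul_ite, mul_zero]
  · simp [hB]

/-- The exponential weight that shifts the noise in the direction of the signal. -/
noncomputable def tiltWeight (k : ℕ) (z : Fin n → ℝ) (τ : ℝ) (y : Finset (Fin n) → ℝ) : ℝ :=
  ∏ S ∈ level (Fin n) k, Real.exp (τ * signProd z S * y S - τ ^ 2 / 2)

theorem continuous_tiltWeight (k : ℕ) (z : Fin n → ℝ) (τ : ℝ) :
    Continuous (tiltWeight k z τ) := by
  unfold tiltWeight
  fun_prop

theorem tiltWeight_pos (k : ℕ) (z : Fin n → ℝ) (τ : ℝ) (y : Finset (Fin n) → ℝ) :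
    0 < tiltWeight k z τ y := Finset.prod_pos fun _ _ => Real.exp_pos _

theorem card_level (m : ℕ) : (level (Fin n) m).card = n.choose m := by
  rw [Finset.card_powersetCard, Finset.card_univ, Fintype.card_fin]

theorem integral_tiltWeight_sq {z : Fin n → ℝ} (hz : ∀ i, z i = 1 ∨ z i = -1) (τ : ℝ) :
    Integrable (fun y => tiltWeight k z τ y ^ 2) (gaussPi (Finset (Fin n))) ∧
      ∫ y, tiltWeight k z τ y ^ 2 ∂gaussPi (Finset (Fin n))
        = Real.exp (n.choose k * τ ^ 2) := by
  have h : (fun y => tiltWeight k z τ y ^ 2) = fun y : Finset (Fin n) → ℝ =>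
      ∏ S ∈ level (Fin n) k, Real.exp ((2 * τ * signProd z S) * y S - τ ^ 2) := by
    funext y
    rw [tiltWeight, ← Finset.prod_pow]
    refine Finset.prod_congr rfl fun S _ => ?_
    rw [← Real.exp_nat_mul]
    congr 1
    push_cast
    ring
  have h2 := integral_prod_exp (level (Fin n) k) (fun S => 2 * τ * signProd z S) (τ ^ 2)
  rw [h]
  refine ⟨h2.1, h2.2.trans ?_⟩
  rw [← Real.exp_sum]
  congr 1
  have : ∀ S ∈ level (Fin n) k, (2 * τ * signProd z S) ^ 2 / 2 - τ ^ 2 = τ ^ 2 := fun S _ => by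
    linear_combination 2 * τ ^ 2 * signProd_sq hz S
  rw [Finset.sum_congr rfl this, Finset.sum_const, card_level, nsmul_eq_mul]

/-- Serves as a lower-tail bound: Markov's inequality for the inverse keeps the weight away from 0.
-/
theorem integral_tiltWeight_inv {z : Fin n → ℝ} (hz : ∀ i, z i = 1 ∨ z i = -1) (τ : ℝ) :
    Integrable (fun y => (tiltWeight k z τ y)⁻¹) (gaussPi (Finset (Fin n))) ∧
      ∫ y, (tiltWeight k z τ y)⁻¹ ∂gaussPi (Finset (Fin n))
        = Real.exp (n.choose k * τ ^ 2) := by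
  have h : (fun y => (tiltWeight k z τ y)⁻¹) = fun y : Finset (Fin n) → ℝ =>
      ∏ S ∈ level (Fin n) k, Real.exp ((-τ * signProd z S) * y S - (-(τ ^ 2 / 2))) := by
    funext y
    rw [tiltWeight, ← Finset.prod_inv_distrib]
    refine Finset.prod_congr rfl fun S _ => ?_
    rw [← Real.exp_neg]
    congr 1
    ring
  have h2 := integral_prod_exp (level (Fin n) k) (fun S => -τ * signProd z S) (-(τ ^ 2 / 2))
  rw [h]
  refine ⟨h2.1, h2.2.trans ?_⟩
  rw [← Real.exp_sum]
  congr 1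
  have : ∀ S ∈ level (Fin n) k, (-τ * signProd z S) ^ 2 / 2 - (-(τ ^ 2 / 2)) = τ ^ 2 :=
    fun S _ => by linear_combination τ ^ 2 / 2 * signProd_sq hz S
  rw [Finset.sum_congr rfl this, Finset.sum_const, card_level, nsmul_eq_mul]

/-- Weighting shifts y_S by τ z_S, so the signal strength β becomes β + sτ. All partitions of V then
contribute equally, since the product of the signs of the blocks is z_V. -/
theorem integral_tiltWeight_mul_partitionPoly (hk : 0 < k) (hℓ : ℓ = c * k) {z : Fin n → ℝ}
    (hz : ∀ i, z i = 1 ∨ z i = -1) (β s τ : ℝ) (g : Finset (Fin n) → ℝ) :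
    Integrable (fun y => tiltWeight k z τ y * partitionPoly k ℓ g (noisy β z s y))
        (gaussPi (Finset (Fin n))) ∧
      ∫ y, tiltWeight k z τ y * partitionPoly k ℓ g (noisy β z s y) ∂gaussPi (Finset (Fin n))
        = (β + s * τ) ^ c * numParts k (c * k) *
          ∑ V ∈ level (Fin n) ℓ, g V * signProd z V := by
  set I := (level (Fin n) ℓ).sigma (parts k) with hI
  have hexp : (fun y => tiltWeight k z τ y * partitionPoly k ℓ g (noisy β z s y))
      = fun y => ∑ q ∈ I, g q.1 *
        ((∏ S ∈ level (Fin n) k, Real.exp (τ * signProd z S * y S - τ ^ 2 / 2)) *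
          ∏ S ∈ q.2, (β * signProd z S + s * y S)) := by
    funext y
    rw [partitionPoly_eq_sum_sigma, Finset.mul_sum]
    refine Finset.sum_congr rfl fun q _ => ?_
    simp only [noisy, tiltWeight]
    ring
  have hsub : ∀ q ∈ I, q.2 ⊆ level (Fin n) k := by
    intro q hq S hS
    rw [Finset.mem_powersetCard_univ]
    exact ((mem_parts.1 (Finset.mem_sigma.1 hq).2).1 S hS).2
  have hq := fun q (hq : q ∈ I) => integral_prod_exp_mul_prod_spiked q.2 s (level (Fin n) k)
    (hsub q hq) (signProd z) (signProd_sq hz) β τ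
  rw [hexp]
  refine ⟨integrable_finsetSum _ fun q h => (hq q h).1.const_mul _, ?_⟩
  rw [integral_finsetSum _ fun q h => (hq q h).1.const_mul _]
  have hval : ∀ q ∈ I, ∫ y, g q.1 *
        ((∏ S ∈ level (Fin n) k, Real.exp (τ * signProd z S * y S - τ ^ 2 / 2)) *
          ∏ S ∈ q.2, (β * signProd z S + s * y S)) ∂gaussPi (Finset (Fin n))
      = (β + s * τ) ^ c * (g q.1 * signProd z q.1) := by
    intro q h
    rw [integral_const_mul, (hq q h).2]
    rw [hI, Finset.mem_sigma, Finset.mem_powersetCard_univ] at h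
    rw [card_eq_of_mem_parts_mul hk (h.1.trans hℓ) h.2,
      show ∏ S ∈ q.2, signProd z S = signProd z q.1 from prod_parts_eq h.2 z]
    ring
  rw [Finset.sum_congr rfl hval, hI, Finset.sum_sigma, Finset.mul_sum]
  refine Finset.sum_congr rfl fun V hV => ?_
  rw [Finset.mem_powersetCard_univ] at hV
  simp only [Finset.sum_const, nsmul_eq_mul]
  rw [card_parts_eq_numParts hk (hV.trans hℓ)]
  ring

/-- The guiding vector of a family of entries. -/
noncomputable def guidingOf (k ℓ : ℕ) (t : Finset (Fin n) → ℝ) : EuclideanSpace ℝ (Sub n ℓ) :=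
  WithLp.toLp 2 fun V =>
    (1 / Real.sqrt ((n.choose ℓ : ℝ) * (numParts k ℓ : ℝ))) * ∑ P ∈ parts k V.1, ∏ S ∈ P, t S

theorem guidingVector_eq_guidingOf (T : Tensor n k) :
    guidingVector ℓ T = guidingOf k ℓ (entries T) := rfl

theorem continuous_guidingOf : Continuous (guidingOf k ℓ : (Finset (Fin n) → ℝ) → _) := by
  unfold guidingOf
  refine (PiLp.continuous_toLp 2 _).comp ?_
  fun_prop

/-- The extension of a vector indexed by the `ℓ`-element sets by zero. -/
noncomputable def extendZero (v : EuclideanSpace ℝ (Sub n ℓ)) (V : Finset (Fin n)) : ℝ :=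
  if h : V.card = ℓ then v ⟨V, h⟩ else 0

theorem extendZero_coe (v : EuclideanSpace ℝ (Sub n ℓ)) (V : Sub n ℓ) :
    extendZero v V.1 = v V := by
  rw [extendZero, dif_pos V.2]

theorem inner_guidingOf (v : EuclideanSpace ℝ (Sub n ℓ)) (t : Finset (Fin n) → ℝ) :
    inner ℝ v (guidingOf k ℓ t)
      = (1 / Real.sqrt ((n.choose ℓ : ℝ) * (numParts k ℓ : ℝ))) *
        partitionPoly k ℓ (extendZero v) t := by
  rw [PiLp.inner_apply, partitionPoly, ← sum_sub_eq, Finset.mul_sum]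
  refine Finset.sum_congr rfl fun V _ => ?_
  rw [extendZero_coe]
  simp only [guidingOf, RCLike.inner_apply, conj_trivial]
  ring

theorem inner_plantedVec (v : EuclideanSpace ℝ (Sub n ℓ)) (z : Fin n → ℝ) :
    inner ℝ (plantedVec ℓ z) v
      = (∑ V ∈ level (Fin n) ℓ, extendZero v V * signProd z V) / Real.sqrt (n.choose ℓ) := by
  rw [PiLp.inner_apply, ← sum_sub_eq, Finset.sum_div]
  refine Finset.sum_congr rfl fun V _ => ?_
  rw [extendZero_coe]
  simp only [plantedVec, RCLike.inner_apply, conj_trivial]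
  ring

theorem norm_sq_eq_sum_level (v : EuclideanSpace ℝ (Sub n ℓ)) {z : Fin n → ℝ}
    (hz : ∀ i, z i = 1 ∨ z i = -1) :
    ‖v‖ ^ 2 = ∑ V ∈ level (Fin n) ℓ, (extendZero v V * signProd z V) ^ 2 := by
  rw [EuclideanSpace.norm_sq_eq, ← sum_sub_eq]
  refine Finset.sum_congr rfl fun V _ => ?_
  rw [extendZero_coe, mul_pow, signProd_sq hz, mul_one, Real.norm_eq_abs, sq_abs]

/-- The normalized variance factor of the degree-`j` part of the overlap with the guiding
vector. -/
noncomputable def chaosWeight (n k c : ℕ) (ρ : ℝ) (j : ℕ) : ℝ :=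
  ρ ^ j * (c.choose j : ℝ) ^ 2 / (numParts k (j * k) * n.choose (j * k))

/-- The Johnson gap is applied to V ↦ v_V z_V: its mean is the overlap with the planted vector, and
the rest is damped by jk/ℓ = j/c. In particular there is no contribution at j = 0 from directions
orthogonal to the planted one. -/
theorem integral_inner_guidingOf_sq_le (hk : 0 < k) (hc : 0 < c) (hℓ : ℓ = c * k) (hn : ℓ ≤ n)
    {z : Fin n → ℝ} (hz : ∀ i, z i = 1 ∨ z i = -1) (β s : ℝ) (hβ : 0 < β)
    (v : EuclideanSpace ℝ (Sub n ℓ)) (hv : ‖v‖ ≤ 1) :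
    ∫ y, (inner ℝ v (guidingOf k ℓ (noisy β z s y)) : ℝ) ^ 2 ∂gaussPi (Finset (Fin n))
      ≤ β ^ (2 * c) * numParts k ℓ * ∑ j ∈ Finset.range (c + 1),
          chaosWeight n k c (s ^ 2 / β ^ 2) j *
            ((inner ℝ (plantedVec ℓ z) v : ℝ) ^ 2 + j / c) := by
  have hN : (0 : ℝ) < n.choose ℓ := by exact_mod_cast Nat.choose_pos hn
  have hp : ∀ m, (0 : ℝ) < numParts k (m * k) := fun m => by exact_mod_cast numParts_pos hk m
  have hpc : (0 : ℝ) < numParts k ℓ := by rw [hℓ]; exact hp c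
  simp_rw [inner_guidingOf, mul_pow]
  rw [integral_const_mul, (integral_partitionPoly_sq hk hℓ hz β s hβ.ne' _).2, div_pow, one_pow,
    Real.sq_sqrt (by positivity), inner_plantedVec, div_pow, Real.sq_sqrt hN.le]
  rw [Finset.mul_sum, Finset.mul_sum, Finset.mul_sum]
  refine Finset.sum_le_sum fun j hj => ?_
  have hjc : j ≤ c := by
    rw [Finset.mem_range] at hj
    omega
  have hjℓ : j * k ≤ ℓ := by rw [hℓ]; exact Nat.mul_le_mul_right k hjc
  have hℓ0 : 0 < ℓ := by rw [hℓ]; positivity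
  have hJ := sum_supersetSum_sq_le (α := Fin n) ℓ (j * k) hjℓ (by simpa using hn) hℓ0
    (fun V => extendZero v V * signProd z V)
  rw [← norm_sq_eq_sum_level v hz, Fintype.card_fin] at hJ
  set X := ∑ W ∈ level (Fin n) (j * k),
    supersetSum ℓ (fun V => extendZero v V * signProd z V) W ^ 2
  set s2 := (∑ V ∈ level (Fin n) ℓ, extendZero v V * signProd z V) ^ 2 / (n.choose ℓ : ℝ)
  have hratio : ((j * k : ℕ) : ℝ) / ℓ = j / c := by
    have : (k : ℝ) ≠ 0 := by exact_mod_cast hk.ne'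
    rw [hℓ]
    push_cast
    field_simp
  have hJ' : X ≤ ((n - j * k).choose (ℓ - j * k) * ℓ.choose (j * k)) * (s2 + j / c) := by
    refine hJ.trans ?_
    refine mul_le_mul_of_nonneg_left ?_ (by positivity)
    rw [hratio]
    have : (j : ℝ) / c * ‖v‖ ^ 2 ≤ j / c * 1 :=
      mul_le_mul_of_nonneg_left (pow_le_one₀ (norm_nonneg _) hv) (by positivity)
    linarith
  have hc1 := choose_mul_choose_cast (n := n) hjℓ
  have hc2 := choose_mul_numParts_mul_numParts hk hjc
  rw [← hℓ] at hc2
  have hnj : (0 : ℝ) < n.choose (j * k) := by exact_mod_cast Nat.choose_pos (hjℓ.trans hn)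
  have hpj := hp j
  have hρ : (0 : ℝ) ≤ s ^ 2 / β ^ 2 := by positivity
  have hs2 : 0 ≤ s2 + j / c := by positivity
  calc 1 / (n.choose ℓ * numParts k ℓ : ℝ) * (β ^ (2 * c) * ((s ^ 2 / β ^ 2) ^ j *
        numParts k (j * k) * (numParts k ((c - j) * k) : ℝ) ^ 2 * X))
      ≤ 1 / (n.choose ℓ * numParts k ℓ : ℝ) * (β ^ (2 * c) * ((s ^ 2 / β ^ 2) ^ j *
        numParts k (j * k) * (numParts k ((c - j) * k) : ℝ) ^ 2 *
          (((n - j * k).choose (ℓ - j * k) * ℓ.choose (j * k)) * (s2 + j / c)))) := by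
        gcongr
    _ = β ^ (2 * c) * numParts k ℓ * (chaosWeight n k c (s ^ 2 / β ^ 2) j * (s2 + j / c)) := by
        unfold chaosWeight
        have e1 : ((n - j * k).choose (ℓ - j * k) : ℝ)
            = n.choose ℓ * ℓ.choose (j * k) / n.choose (j * k) := by
          rw [eq_div_iff hnj.ne', mul_comm]
          exact hc1
        -- A partition into c blocks with j of them marked is a choice of the covered jk-set and of
        -- a partition on each side; this absorbs the partition counts into C(c,j).
        have e2 : (c.choose j : ℝ) = ℓ.choose (j * k) * numParts k (j * k) *
            numParts k ((c - j) * k) / numParts k ℓ := by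
          rw [eq_div_iff hpc.ne']
          exact hc2.symm
        rw [e1, e2]
        field_simp

theorem integrable_inner_guidingOf_sq (hk : 0 < k) (hℓ : ℓ = c * k)
    {z : Fin n → ℝ} (hz : ∀ i, z i = 1 ∨ z i = -1) (β s : ℝ) (hβ : β ≠ 0)
    (v : EuclideanSpace ℝ (Sub n ℓ)) :
    Integrable (fun y => (inner ℝ v (guidingOf k ℓ (noisy β z s y)) : ℝ) ^ 2)
      (gaussPi (Finset (Fin n))) := by
  simp_rw [inner_guidingOf, mul_pow]
  exact (integral_partitionPoly_sq hk hℓ hz β s hβ _).1.const_mul _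

/-- The overlap with the guiding vector is close in mean square to a log-normal variable. -/
theorem integral_inner_guidingOf_sub_sq_le (hk : 0 < k) (hc : 0 < c) (hℓ : ℓ = c * k)
    (hn : ℓ ≤ n) {z : Fin n → ℝ} (hz : ∀ i, z i = 1 ∨ z i = -1) (β s τ : ℝ) (hβ : 0 < β)
    (v : EuclideanSpace ℝ (Sub n ℓ)) (hv : ‖v‖ ≤ 1) :
    Integrable (fun y => ((inner ℝ v (guidingOf k ℓ (noisy β z s y)) : ℝ)
        - β ^ c * Real.sqrt (numParts k ℓ) * inner ℝ (plantedVec ℓ z) v * tiltWeight k z τ y) ^ 2)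
        (gaussPi (Finset (Fin n))) ∧
      ∫ y, ((inner ℝ v (guidingOf k ℓ (noisy β z s y)) : ℝ)
        - β ^ c * Real.sqrt (numParts k ℓ) * inner ℝ (plantedVec ℓ z) v * tiltWeight k z τ y) ^ 2
        ∂gaussPi (Finset (Fin n))
      ≤ β ^ (2 * c) * numParts k ℓ * ((∑ j ∈ Finset.range (c + 1),
          chaosWeight n k c (s ^ 2 / β ^ 2) j *
            ((inner ℝ (plantedVec ℓ z) v : ℝ) ^ 2 + j / c))
          - 2 * (inner ℝ (plantedVec ℓ z) v : ℝ) ^ 2 * (1 + s * τ / β) ^ c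
          + (inner ℝ (plantedVec ℓ z) v : ℝ) ^ 2 * Real.exp (n.choose k * τ ^ 2)) := by
  have hN : (0 : ℝ) < n.choose ℓ := by exact_mod_cast Nat.choose_pos hn
  have hpc : (0 : ℝ) < numParts k ℓ := by rw [hℓ]; exact_mod_cast numParts_pos hk c
  set a : ℝ := inner ℝ (plantedVec ℓ z) v with ha
  set Λ : ℝ := β ^ c * Real.sqrt (numParts k ℓ) * a with hΛ
  set κ : ℝ := 1 / Real.sqrt ((n.choose ℓ : ℝ) * (numParts k ℓ : ℝ)) with hκ
  have hQ := integrable_inner_guidingOf_sq (k := k) (s := s) hk hℓ hz β hβ.ne' v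
  have hYQ := integral_tiltWeight_mul_partitionPoly hk hℓ hz β s τ (extendZero v)
  have hY := integral_tiltWeight_sq (k := k) hz τ
  have hexp : (fun y => ((inner ℝ v (guidingOf k ℓ (noisy β z s y)) : ℝ)
        - Λ * tiltWeight k z τ y) ^ 2)
      = fun y => ((inner ℝ v (guidingOf k ℓ (noisy β z s y)) : ℝ) ^ 2
        - (2 * Λ * κ) * (tiltWeight k z τ y *
          partitionPoly k ℓ (extendZero v) (noisy β z s y)))
        + Λ ^ 2 * tiltWeight k z τ y ^ 2 := by
    funext y
    rw [inner_guidingOf]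
    ring
  have hi1 := hQ.sub (hYQ.1.const_mul (2 * Λ * κ))
  have hi2 := hY.1.const_mul (Λ ^ 2)
  rw [hexp]
  refine ⟨hi1.add hi2, ?_⟩
  have hval := integral_add hi1 hi2
  simp only [Pi.sub_apply] at hval
  rw [hval, integral_sub hQ (hYQ.1.const_mul _), integral_const_mul, integral_const_mul, hYQ.2,
    hY.2]
  have hle := integral_inner_guidingOf_sq_le hk hc hℓ hn hz β s hβ v hv
  rw [← ha] at hle
  have hsum : ∑ V ∈ level (Fin n) ℓ, extendZero v V * signProd z V
      = Real.sqrt (n.choose ℓ) * a := by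
    rw [ha, inner_plantedVec]
    field_simp
  have hκ' : κ * (Real.sqrt (n.choose ℓ) * Real.sqrt (numParts k ℓ)) = 1 := by
    rw [hκ, ← Real.sqrt_mul hN.le]
    field_simp
  have hp2 : Real.sqrt (numParts k ℓ) ^ 2 = numParts k ℓ := Real.sq_sqrt hpc.le
  have hb : (β + s * τ) ^ c = β ^ c * (1 + s * τ / β) ^ c := by
    rw [← mul_pow]
    congr 1
    field_simp
  rw [hsum, hb, ← hℓ, hΛ]
  have e1 : 2 * (β ^ c * Real.sqrt (numParts k ℓ) * a) * κ *
      (β ^ c * (1 + s * τ / β) ^ c * numParts k ℓ * (Real.sqrt (n.choose ℓ) * a))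
      = β ^ (2 * c) * numParts k ℓ * (2 * a ^ 2 * (1 + s * τ / β) ^ c) := by
    rw [two_mul c, pow_add]
    linear_combination (2 * β ^ c * β ^ c * a ^ 2 * (1 + s * τ / β) ^ c * numParts k ℓ) * hκ'
  have e2 : (β ^ c * Real.sqrt (numParts k ℓ) * a) ^ 2 * Real.exp (n.choose k * τ ^ 2)
      = β ^ (2 * c) * numParts k ℓ * (a ^ 2 * Real.exp (n.choose k * τ ^ 2)) := by
    rw [mul_pow, mul_pow, hp2, two_mul c, pow_add]
    ring
  rw [e1, e2]
  linarith

/-- The second moment of the norm of the guiding vector. -/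
theorem integral_norm_guidingOf_sq (hk : 0 < k) (hℓ : ℓ = c * k) (hn : ℓ ≤ n)
    {z : Fin n → ℝ} (hz : ∀ i, z i = 1 ∨ z i = -1) (β s : ℝ) (hβ : 0 < β) :
    Integrable (fun y => ‖guidingOf k ℓ (noisy β z s y)‖ ^ 2) (gaussPi (Finset (Fin n))) ∧
      ∫ y, ‖guidingOf k ℓ (noisy β z s y)‖ ^ 2 ∂gaussPi (Finset (Fin n))
        = β ^ (2 * c) * ∑ j ∈ Finset.range (c + 1),
          (s ^ 2 / β ^ 2) ^ j * c.choose j * numParts k ((c - j) * k) := by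
  have hN : (0 : ℝ) < n.choose ℓ := by exact_mod_cast Nat.choose_pos hn
  have hpc : (0 : ℝ) < numParts k ℓ := by rw [hℓ]; exact_mod_cast numParts_pos hk c
  -- A single coordinate is the linear functional with an indicator as coefficient vector, so the
  -- general second moment formula applies coordinatewise.
  have hexp : ∀ y, ‖guidingOf k ℓ (noisy β z s y)‖ ^ 2
      = ∑ V : Sub n ℓ, (1 / ((n.choose ℓ : ℝ) * (numParts k ℓ : ℝ))) *
        partitionPoly k ℓ (Pi.single V.1 1) (noisy β z s y) ^ 2 := by
    intro y
    rw [EuclideanSpace.norm_sq_eq]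
    refine Finset.sum_congr rfl fun V _ => ?_
    rw [Real.norm_eq_abs, sq_abs]
    simp only [guidingOf]
    rw [mul_pow, div_pow, Real.sq_sqrt (by positivity), one_pow]
    congr 2
    rw [partitionPoly, Finset.sum_eq_single_of_mem V.1
      (Finset.mem_powersetCard_univ.2 V.2)]
    · rw [Pi.single_eq_same, one_mul]
    · intro U _ hU
      rw [Pi.single_eq_of_ne hU, zero_mul]
  simp_rw [hexp]
  have hV := fun V : Sub n ℓ => integral_partitionPoly_sq hk hℓ hz β s hβ.ne' (Pi.single V.1 1)
  refine ⟨integrable_finsetSum _ fun V _ => (hV V).1.const_mul _, ?_⟩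
  rw [integral_finsetSum _ fun V _ => (hV V).1.const_mul _]
  have hval : ∀ V : Sub n ℓ, ∫ y, (1 / ((n.choose ℓ : ℝ) * (numParts k ℓ : ℝ))) *
        partitionPoly k ℓ (Pi.single V.1 1) (noisy β z s y) ^ 2 ∂gaussPi (Finset (Fin n))
      = (1 / (n.choose ℓ : ℝ)) * (β ^ (2 * c) * ∑ j ∈ Finset.range (c + 1),
          (s ^ 2 / β ^ 2) ^ j * c.choose j * numParts k ((c - j) * k)) := by
    intro V
    rw [integral_const_mul, (hV V).2, Finset.mul_sum, Finset.mul_sum, Finset.mul_sum,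
      Finset.mul_sum]
    refine Finset.sum_congr rfl fun j hj => ?_
    have hjc : j ≤ c := by
      rw [Finset.mem_range] at hj
      omega
    have hS : ∀ W ∈ level (Fin n) (j * k), supersetSum ℓ
        (fun U => (Pi.single V.1 1 : Finset (Fin n) → ℝ) U * signProd z U) W ^ 2
        = if W ⊆ V.1 then 1 else 0 := by
      intro W _
      rw [supersetSum, Finset.sum_filter, Finset.sum_eq_single_of_mem V.1
        (Finset.mem_powersetCard_univ.2 V.2)]
      · rw [Pi.single_eq_same, one_mul]
        split_ifs
        · exact signProd_sq hz _
        · norm_num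
      · intro U _ hU
        rw [Pi.single_eq_of_ne hU, zero_mul, ite_self]
    have hcount : ((level (Fin n) (j * k)).filter (· ⊆ V.1)).card = ℓ.choose (j * k) := by
      have : (level (Fin n) (j * k)).filter (· ⊆ V.1) = V.1.powersetCard (j * k) := by
        ext W
        simp [Finset.mem_powersetCard, and_comm]
      rw [this, Finset.card_powersetCard, V.2]
    rw [Finset.sum_congr rfl hS, ← Finset.sum_filter, Finset.sum_const, hcount, nsmul_eq_mul,
      mul_one]
    have hc2 := choose_mul_numParts_mul_numParts hk hjc
    rw [← hℓ] at hc2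
    have e2 : (c.choose j : ℝ) = ℓ.choose (j * k) * numParts k (j * k) *
        numParts k ((c - j) * k) / numParts k ℓ := by
      rw [eq_div_iff hpc.ne']
      exact hc2.symm
    rw [e2]
    field_simp
  rw [Finset.sum_congr rfl fun V _ => hval V, Finset.sum_const, Finset.card_univ, card_sub,
    nsmul_eq_mul]
  field_simp

end Guiding

end TensorPCA

namespace TensorPCA

/-! ### Estimates for the moment sums. -/

section Bounds

variable {n k ℓ c : ℕ}

/-- Cut the jk falling factors into j runs of length k; even the last run starts at n - (j-1)k ≥ m.
-/
theorem descFactorial_pow_le (m : ℕ) (j : ℕ) (hj : j * k + m ≤ n + k) :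
    (m.descFactorial k) ^ j ≤ n.descFactorial (j * k) := by
  induction j with
  | zero => simp
  | succ j ih =>
    have h1 := Nat.descFactorial_mul_descFactorial (n := n) (k := j * k) (m := (j + 1) * k)
      (Nat.mul_le_mul_right k (Nat.le_succ j))
    rw [← h1, pow_succ, mul_comm, show (j + 1) * k - j * k = k by
      rw [Nat.succ_mul, Nat.add_sub_cancel_left]]
    rw [Nat.succ_mul] at hj
    exact Nat.mul_le_mul (Nat.descFactorial_le k (by omega)) (ih (by omega))

/-- C(c,j)² is at most c^{2j}/j!², and the denominator, a falling factorial over k!^j j!, is at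
least C(m,k)^j/j!. What remains is a term of an exponential series. -/
theorem chaosWeight_le (hk : 0 < k) {ρ : ℝ} (hρ : 0 ≤ ρ) {m : ℕ} (hm : k ≤ m)
    (hcn : c * k + m ≤ n) {j : ℕ} (hj : j ≤ c) :
    chaosWeight n k c ρ j ≤ (c ^ 2 * ρ / m.choose k) ^ j / j.factorial := by
  have hjk : j * k ≤ c * k := Nat.mul_le_mul_right k hj
  have hjn : j * k ≤ n := by omega
  have hmk : (0 : ℝ) < m.choose k := by exact_mod_cast Nat.choose_pos hm
  have hden : (numParts k (j * k) : ℝ) * n.choose (j * k)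
      = n.descFactorial (j * k) / (k.factorial ^ j * j.factorial) := by
    rw [numParts_eq_div hk, Nat.descFactorial_eq_factorial_mul_choose]
    push_cast
    ring
  have hdf : ((k.factorial : ℝ) * m.choose k) ^ j ≤ n.descFactorial (j * k) := by
    have := descFactorial_pow_le (n := n) (k := k) m j (by omega)
    rw [Nat.descFactorial_eq_factorial_mul_choose] at this
    exact_mod_cast this
  have hch : (c.choose j : ℝ) ≤ c ^ j / j.factorial := Nat.choose_le_pow_div j c
  have hkf : (0 : ℝ) < k.factorial := by positivity
  have hjf : (0 : ℝ) < j.factorial := by positivity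
  have hpos : (0 : ℝ) < ((k.factorial : ℝ) * m.choose k) ^ j := by positivity
  rw [chaosWeight, hden]
  calc ρ ^ j * (c.choose j : ℝ) ^ 2 / (n.descFactorial (j * k) / (k.factorial ^ j * j.factorial))
      ≤ ρ ^ j * ((c : ℝ) ^ j / j.factorial) ^ 2 /
        (((k.factorial : ℝ) * m.choose k) ^ j / (k.factorial ^ j * j.factorial)) := by
        gcongr
    _ = (c ^ 2 * ρ / m.choose k) ^ j / j.factorial := by
        simp only [div_pow, mul_pow]
        field_simp
        ring

/-- Two exponential series; the factor j shifts the index of the second one and produces its factor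
x. -/
theorem sum_chaosWeight_le (hk : 0 < k) (hc : 0 < c) {ρ : ℝ} (hρ : 0 ≤ ρ) {m : ℕ} (hm : k ≤ m)
    (hcn : c * k + m ≤ n) (a : ℝ) :
    ∑ j ∈ Finset.range (c + 1), chaosWeight n k c ρ j * (a ^ 2 + j / c)
      ≤ a ^ 2 * Real.exp (c ^ 2 * ρ / m.choose k)
        + (c ^ 2 * ρ / m.choose k) * Real.exp (c ^ 2 * ρ / m.choose k) / c := by
  set x : ℝ := c ^ 2 * ρ / m.choose k with hx
  have hx0 : 0 ≤ x := by positivity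
  have hcpos : (0 : ℝ) < c := by exact_mod_cast hc
  have h1 : ∑ j ∈ Finset.range (c + 1), chaosWeight n k c ρ j * (a ^ 2 + j / c)
      ≤ ∑ j ∈ Finset.range (c + 1), (a ^ 2 * (x ^ j / j.factorial)
        + (j * (x ^ j / j.factorial)) / c) := by
    refine Finset.sum_le_sum fun j hj => ?_
    have hjc : j ≤ c := by
      rw [Finset.mem_range] at hj
      omega
    refine (mul_le_mul_of_nonneg_right (chaosWeight_le hk hρ hm hcn hjc)
      (by positivity)).trans (le_of_eq ?_)
    rw [← hx]
    ring
  have h2 : ∑ j ∈ Finset.range (c + 1), x ^ j / j.factorial ≤ Real.exp x :=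
    Real.sum_le_exp_of_nonneg hx0 _
  have h3 : ∑ j ∈ Finset.range (c + 1), (j : ℝ) * (x ^ j / j.factorial) ≤ x * Real.exp x := by
    rw [Finset.sum_range_succ']
    have : ∀ j ∈ Finset.range c, ((j + 1 : ℕ) : ℝ) * (x ^ (j + 1) / (j + 1).factorial)
        = x * (x ^ j / j.factorial) := by
      intro j _
      rw [Nat.factorial_succ]
      push_cast
      field_simp
      ring
    rw [Finset.sum_congr rfl this, ← Finset.mul_sum]
    simp only [Nat.cast_zero, zero_mul, add_zero]
    exact mul_le_mul_of_nonneg_left (Real.sum_le_exp_of_nonneg hx0 _) hx0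
  refine h1.trans ?_
  rw [Finset.sum_add_distrib, ← Finset.mul_sum, ← Finset.sum_div]
  gcongr

/-- From log(1 + y) ≥ y - y²/2 and exp(-t) ≥ 1 - t. It shows that the cross moment (1 + x/c)^c is
close to e^x. -/
theorem exp_mul_le_one_add_pow {y : ℝ} (hy : 0 ≤ y) (c : ℕ) :
    Real.exp (c * y) * (1 - c * y * y / 2) ≤ (1 + y) ^ c := by
  have h1 : Real.exp (y - y ^ 2 / 2) ≤ 1 + y := by
    have h := Real.le_log_one_add_of_nonneg hy
    have h' : y - y ^ 2 / 2 ≤ 2 * y / (y + 2) := by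
      rw [le_div_iff₀ (by positivity)]
      nlinarith [pow_nonneg hy 3, sq_nonneg y]
    calc Real.exp (y - y ^ 2 / 2) ≤ Real.exp (Real.log (1 + y)) :=
          Real.exp_le_exp.2 (h'.trans h)
      _ = 1 + y := Real.exp_log (by positivity)
  have h2 : Real.exp (c * y) * Real.exp (-(c * y * y / 2)) ≤ (1 + y) ^ c := by
    rw [← Real.exp_add]
    calc Real.exp (c * y + -(c * y * y / 2)) = Real.exp (y - y ^ 2 / 2) ^ c := by
          rw [← Real.exp_nat_mul]
          congr 1
          ring
      _ ≤ (1 + y) ^ c := pow_le_pow_left₀ (Real.exp_pos _).le h1 c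
  refine le_trans (mul_le_mul_of_nonneg_left ?_ (Real.exp_pos _).le) h2
  have := Real.add_one_le_exp (-(c * y * y / 2))
  linarith

/-- The deviation bound, in terms of the tilting parameter `x` and of its inflation `x'`. -/
theorem deviation_le (hc : 0 < c) {a x x' : ℝ} (ha : a ^ 2 ≤ 1) (hx : 0 ≤ x) (hxx : x ≤ x') :
    a ^ 2 * Real.exp x' + x' * Real.exp x' / c - 2 * a ^ 2 * (1 + x / c) ^ c
        + a ^ 2 * Real.exp x
      ≤ (Real.exp x' - Real.exp x) + x * (x / c) * Real.exp x + x' * Real.exp x' / c := by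
  have hcpos : (0 : ℝ) < c := by exact_mod_cast hc
  have hy : 0 ≤ x / c := by positivity
  have h := exp_mul_le_one_add_pow hy c
  have hcx : (c : ℝ) * (x / c) = x := by field_simp
  rw [hcx] at h
  have he : Real.exp x ≤ Real.exp x' := Real.exp_le_exp.2 hxx
  have hpos : 0 ≤ (Real.exp x' - Real.exp x) + x * (x / c) * Real.exp x := by
    have : 0 ≤ x * (x / c) * Real.exp x := by positivity
    linarith
  have h1 : a ^ 2 * (Real.exp x' + Real.exp x - 2 * (1 + x / c) ^ c)
      ≤ a ^ 2 * ((Real.exp x' - Real.exp x) + x * (x / c) * Real.exp x) := by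
    refine mul_le_mul_of_nonneg_left ?_ (sq_nonneg a)
    nlinarith
  have h2 := mul_le_of_le_one_left hpos ha
  linarith

theorem pow_self_div_factorial_sq_le (m : ℕ) :
    (m : ℝ) ^ m / (m.factorial : ℝ) ^ 2 ≤ 3 ^ m := by
  have h1 : (m : ℝ) ^ m / m.factorial ≤ Real.exp m :=
    Real.pow_div_factorial_le_exp (m : ℝ) (Nat.cast_nonneg m) m
  have h2 : Real.exp m ≤ 3 ^ m := by
    rw [← mul_one (m : ℝ), Real.exp_nat_mul]
    have := Real.exp_one_lt_d9
    exact pow_le_pow_left₀ (Real.exp_pos _).le (by linarith) m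
  have h3 : (1 : ℝ) ≤ m.factorial := by exact_mod_cast Nat.factorial_pos m
  calc (m : ℝ) ^ m / (m.factorial : ℝ) ^ 2 = (m : ℝ) ^ m / m.factorial / m.factorial := by
        rw [pow_two, div_div]
    _ ≤ (m : ℝ) ^ m / m.factorial := div_le_self (by positivity) h3
    _ ≤ _ := h1.trans h2

/-- Part_k(mk) is at most (mk)^{mk}/m!, so the smallness of β²(ck)^k beats the number of partitions
and leaves 100^{-m} m^m/m!² ≤ (3/100)^m. -/
theorem pow_mul_choose_mul_numParts_le (hk : 0 < k) (hc : 0 < c) {β : ℝ}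
    (hβ : β ^ 2 * ((c * k : ℕ) : ℝ) ^ k ≤ 1 / 100) {m : ℕ} (hm : m ≤ c) :
    (β ^ 2) ^ m * c.choose m * numParts k (m * k) ≤ (1 / 2) ^ m := by
  have hcpos : (0 : ℝ) < c := by exact_mod_cast hc
  have hkpos : (0 : ℝ) < k := by exact_mod_cast hk
  have hβ' : β ^ 2 ≤ 1 / 100 / ((c * k : ℕ) : ℝ) ^ k := by
    rw [le_div_iff₀ (by push_cast; positivity)]
    exact hβ
  have hch : (c.choose m : ℝ) ≤ c ^ m / m.factorial := Nat.choose_le_pow_div m c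
  have hkf : (1 : ℝ) ≤ (k.factorial : ℝ) ^ m :=
    one_le_pow₀ (by exact_mod_cast Nat.factorial_pos k)
  have hmf : (0 : ℝ) < m.factorial := by positivity
  have hp : (numParts k (m * k) : ℝ) ≤ ((m : ℝ) * k) ^ (m * k) / m.factorial := by
    rw [numParts_eq_div hk]
    have h1 : ((m * k).factorial : ℝ) ≤ ((m : ℝ) * k) ^ (m * k) := by
      exact_mod_cast Nat.factorial_le_pow (m * k)
    have h2 : (m.factorial : ℝ) ≤ k.factorial ^ m * m.factorial :=
      le_mul_of_one_le_left hmf.le hkf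
    gcongr
  -- As m ≤ c, the exponent mk may be lowered to m; the remaining c^{-m} exactly offsets c^m from
  -- C(c,m).
  have hr : ((m : ℝ) / c) ^ (m * k) ≤ ((m : ℝ) / c) ^ m := by
    refine pow_le_pow_of_le_one (by positivity) ?_ (Nat.le_mul_of_pos_right m hk)
    rw [div_le_one hcpos]
    exact_mod_cast hm
  calc (β ^ 2) ^ m * c.choose m * numParts k (m * k)
      ≤ (1 / 100 / ((c * k : ℕ) : ℝ) ^ k) ^ m * (c ^ m / m.factorial) *
        (((m : ℝ) * k) ^ (m * k) / m.factorial) := by gcongr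
    _ = (1 / 100) ^ m * (c : ℝ) ^ m / (m.factorial : ℝ) ^ 2 * ((m : ℝ) / c) ^ (m * k) := by
        push_cast
        simp only [div_pow, mul_pow, ← pow_mul, mul_comm m k]
        field_simp
    _ ≤ (1 / 100) ^ m * (c : ℝ) ^ m / (m.factorial : ℝ) ^ 2 * ((m : ℝ) / c) ^ m := by gcongr
    _ = (1 / 100) ^ m * ((m : ℝ) ^ m / (m.factorial : ℝ) ^ 2) := by
        rw [div_pow (m : ℝ)]
        field_simp
    _ ≤ (1 / 100) ^ m * 3 ^ m := by
        gcongr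
        exact pow_self_div_factorial_sq_le m
    _ = (3 / 100) ^ m := by
        rw [← mul_pow]
        norm_num
    _ ≤ (1 / 2) ^ m := pow_le_pow_left₀ (by norm_num) (by norm_num) m

/-- The pure-noise term j = c dominates, and each replacement of a noise block by signal loses a
factor 2: a geometric series. -/
theorem sum_guiding_norm_le (hk : 0 < k) (hc : 0 < c) {β s : ℝ} (hβ0 : 0 < β) (hs : 1 ≤ s ^ 2)
    (hβ : β ^ 2 * ((c * k : ℕ) : ℝ) ^ k ≤ 1 / 100) :
    β ^ (2 * c) * ∑ j ∈ Finset.range (c + 1),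
        (s ^ 2 / β ^ 2) ^ j * c.choose j * numParts k ((c - j) * k) ≤ 2 * (s ^ 2) ^ c := by
  have hterm : ∀ j ∈ Finset.range (c + 1),
      β ^ (2 * c) * ((s ^ 2 / β ^ 2) ^ j * c.choose j * numParts k ((c - j) * k))
        ≤ (s ^ 2) ^ c * (1 / 2) ^ (c - j) := by
    intro j hj
    have hjc : j ≤ c := by
      rw [Finset.mem_range] at hj
      omega
    have h := pow_mul_choose_mul_numParts_le hk hc hβ (Nat.sub_le c j)
    rw [Nat.choose_symm hjc] at h
    calc β ^ (2 * c) * ((s ^ 2 / β ^ 2) ^ j * c.choose j * numParts k ((c - j) * k))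
        = (s ^ 2) ^ j * ((β ^ 2) ^ (c - j) * c.choose j * numParts k ((c - j) * k)) := by
          have : β ^ (2 * c) = (β ^ 2) ^ j * (β ^ 2) ^ (c - j) := by
            rw [← pow_add, Nat.add_sub_cancel' hjc, pow_mul]
          rw [this, div_pow]
          field_simp
      _ ≤ (s ^ 2) ^ c * (1 / 2) ^ (c - j) :=
          mul_le_mul (pow_le_pow_right₀ hs hjc) h (by positivity) (by positivity)
  rw [Finset.mul_sum]
  refine (Finset.sum_le_sum hterm).trans ?_
  rw [← Finset.mul_sum, mul_comm]
  refine mul_le_mul_of_nonneg_right ?_ (by positivity)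
  rw [Finset.sum_flip (fun j => ((1 : ℝ) / 2) ^ j)]
  exact sum_geometric_two_le _

end Bounds

end TensorPCA

namespace TensorPCA

/-! ### The exceptional event at fixed parameters. -/

section FixedParameters

/-- Markov's inequality in the form used below. -/
theorem measure_ge_le_of_integral_le {Ω : Type*} [MeasurableSpace Ω] {μ : Measure Ω}
    [IsFiniteMeasure μ] {f : Ω → ℝ} (hf : Integrable f μ) (h0 : ∀ x, 0 ≤ f x) {t C : ℝ}
    (ht : 0 < t) (hC : ∫ x, f x ∂μ ≤ C) : μ {x | t ≤ f x} ≤ ENNReal.ofReal (C / t) := by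
  have h := mul_meas_ge_le_integral_of_nonneg (Filter.Eventually.of_forall h0) hf t
  rw [← ofReal_measureReal]
  refine ENNReal.ofReal_le_ofReal ?_
  rw [le_div_iff₀ ht, mul_comm]
  exact h.trans hC

variable {n k ℓ c : ℕ}

/-- The component of the planted vector in the window `[a - b, a + b]` of eigenvalues of the
Kikuchi matrix. -/
noncomputable def windowComponent (k ℓ : ℕ) (z : Fin n → ℝ) (a b : ℝ)
    (t : Finset (Fin n) → ℝ) : EuclideanSpace ℝ (Sub n ℓ) :=
  Filter.limUnder Filter.atTop (fun m => windowVec (kikuchiOf k ℓ t) a b (plantedVec ℓ z) m)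

theorem windowComponent_spec (hℓ : ℓ ≤ n) {z : Fin n → ℝ} (hz : ∀ i, z i = 1 ∨ z i = -1)
    (a b : ℝ) (hb : 0 < b) (t : Finset (Fin n) → ℝ) :
    Filter.Tendsto (fun m => windowVec (kikuchiOf k ℓ t) a b (plantedVec ℓ z) m) Filter.atTop
        (nhds (windowComponent k ℓ z a b t)) ∧
      windowComponent k ℓ z a b t ∈ cutoffEigenspace (kikuchiOf k ℓ t) (a - b) ∧
      ‖windowComponent k ℓ z a b t‖ ≤ 1 ∧
      1 - ‖Matrix.toEuclideanLin (kikuchiOf k ℓ t) (plantedVec ℓ z) - a • plantedVec ℓ z‖ ^ 2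
          / b ^ 2 ≤ inner ℝ (plantedVec ℓ z) (windowComponent k ℓ z a b t) := by
  obtain ⟨v, h1, h2, h3, h4⟩ :=
    exists_tendsto_windowVec (kikuchiOf_isHermitian (k := k) (ℓ := ℓ) t) a b hb (plantedVec ℓ z)
  rw [norm_plantedVec hz hℓ] at h3 h4
  have : windowComponent k ℓ z a b t = v := h1.limUnder_eq
  rw [this]
  exact ⟨h1, h2, h3, by simpa using h4⟩

theorem measurable_windowComponent (hℓ : ℓ ≤ n) {z : Fin n → ℝ}
    (hz : ∀ i, z i = 1 ∨ z i = -1) (a b : ℝ) (hb : 0 < b) :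
    Measurable (windowComponent (n := n) k ℓ z a b) := by
  refine measurable_of_tendsto_metrizable
    (f := fun m t => windowVec (kikuchiOf k ℓ t) a b (plantedVec ℓ z) m) (fun m => ?_) ?_
  · exact (continuous_windowVec continuous_kikuchiOf kikuchiOf_isHermitian a b _ m).measurable
  · exact tendsto_pi_nhds.2 fun t => (windowComponent_spec hℓ hz a b hb t).1

/-- This and the next congruences say that only coordinates at k-sets matter, so the Gaussian vector
may be indexed by all subsets of [n]. -/
theorem kikuchiOf_congr {t t' : Finset (Fin n) → ℝ} (h : ∀ S, S.card = k → t S = t' S) :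
    kikuchiOf k ℓ t = kikuchiOf k ℓ t' := by
  refine Finset.sum_congr rfl fun S hS => ?_
  rw [h S (Finset.mem_powersetCard_univ.1 hS)]

theorem guidingOf_congr {t t' : Finset (Fin n) → ℝ} (h : ∀ S, S.card = k → t S = t' S) :
    guidingOf k ℓ t = guidingOf k ℓ t' := by
  unfold guidingOf
  congr 1
  funext V
  congr 1
  refine Finset.sum_congr rfl fun P hP => Finset.prod_congr rfl fun S hS => h S ?_
  exact ((mem_parts.1 hP).1 S hS).2

theorem tiltWeight_congr {z : Fin n → ℝ} {τ : ℝ} {y y' : Finset (Fin n) → ℝ}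
    (h : ∀ S, S.card = k → y S = y' S) : tiltWeight k z τ y = tiltWeight k z τ y' := by
  refine Finset.prod_congr rfl fun S hS => ?_
  rw [h S (Finset.mem_powersetCard_univ.1 hS)]

theorem truncate_apply_of_card {x : Finset (Fin n) → ℝ} {S : Finset (Fin n)} (h : S.card = k) :
    truncate k x S = x S := if_pos h

theorem noisy_truncate_apply (β : ℝ) (z : Fin n → ℝ) (s : ℝ) (x : Finset (Fin n) → ℝ) :
    ∀ S : Finset (Fin n), S.card = k → noisy β z s (truncate k x) S = noisy β z s x S :=
  fun S h => by rw [noisy, noisy, truncate_apply_of_card h]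

theorem windowComponent_congr {z : Fin n → ℝ} {a b : ℝ} {t t' : Finset (Fin n) → ℝ}
    (h : ∀ S, S.card = k → t S = t' S) :
    windowComponent k ℓ z a b t = windowComponent k ℓ z a b t' := by
  rw [windowComponent, windowComponent, kikuchiOf_congr h]

/-- The squared error of the planted vector as an approximate eigenvector. -/
noncomputable def eigenError (k ℓ : ℕ) (z : Fin n → ℝ) (a : ℝ) (t : Finset (Fin n) → ℝ) : ℝ :=
  ‖Matrix.toEuclideanLin (kikuchiOf k ℓ t) (plantedVec ℓ z) - a • plantedVec ℓ z‖ ^ 2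

theorem continuous_eigenError (z : Fin n → ℝ) (a : ℝ) : Continuous (eigenError k ℓ z a) := by
  unfold eigenError
  have : Continuous fun t : Finset (Fin n) → ℝ =>
      Matrix.toEuclideanLin (kikuchiOf k ℓ t) (plantedVec ℓ z) :=
    (PiLp.continuous_toLp 2 _).comp (continuous_kikuchiOf.matrix_mulVec continuous_const)
  fun_prop

/-- The event that some estimate fails, for the noise vectors `x` of `T⁺` and `y` of `T⁻`. -/
def exceptionalSet (n k ℓ c : ℕ) (z : Fin n → ℝ) (β s' s τ a b η r : ℝ) :
    Set ((Finset (Fin n) → ℝ) × (Finset (Fin n) → ℝ)) :=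
  {w | b ^ 2 / 2 ≤ eigenError k ℓ z a (noisy β z s' w.1)} ∪
  {w | β ^ (2 * c) * numParts k ℓ * η ^ 2 ≤
    (inner ℝ (windowComponent k ℓ z a b (noisy β z s' w.1)) (guidingOf k ℓ (noisy β z s w.2))
      - β ^ c * Real.sqrt (numParts k ℓ) *
        inner ℝ (plantedVec ℓ z) (windowComponent k ℓ z a b (noisy β z s' w.1)) *
        tiltWeight k z τ w.2) ^ 2} ∪
  {w | (4 * η)⁻¹ ≤ (tiltWeight k z τ w.2)⁻¹} ∪
  {w | 2 * r * (s ^ 2) ^ c ≤ ‖guidingOf k ℓ (noisy β z s w.2)‖ ^ 2}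

theorem truncate_mem_exceptionalSet_iff {z : Fin n → ℝ} {β s' s τ a b η r : ℝ}
    (x y : Finset (Fin n) → ℝ) :
    (truncate k x, truncate k y) ∈ exceptionalSet n k ℓ c z β s' s τ a b η r ↔
      (x, y) ∈ exceptionalSet n k ℓ c z β s' s τ a b η r := by
  have h1 := fun u : ℝ => noisy_truncate_apply (k := k) β z u
  simp only [exceptionalSet, Set.mem_union, Set.mem_ofPred_eq, eigenError,
    kikuchiOf_congr (h1 s' x), windowComponent_congr (h1 s' x), guidingOf_congr (h1 s y),
    tiltWeight_congr fun S h => truncate_apply_of_card (x := y) h]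

/-- Outside of the exceptional set the window component is a good guiding witness. -/
theorem exists_unit_of_notMem_exceptionalSet (hℓ : ℓ ≤ n) (hk : 0 < k) (hc : ℓ = c * k)
    {z : Fin n → ℝ} (hz : ∀ i, z i = 1 ∨ z i = -1)
    {β s' s τ a b η r θ q : ℝ} (hβ : 0 < β) (hb : 0 < b) (hη : 0 < η) (hr : 0 < r) (hs : 0 < s)
    (hθ : θ = a - b) (hq : q ≤ η ^ 2 / (2 * r))
    {x y : Finset (Fin n) → ℝ}
    (h : (x, y) ∉ exceptionalSet n k ℓ c z β s' s τ a b η r) :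
    ∃ v ∈ cutoffEigenspace (kikuchiOf k ℓ (noisy β z s' x)) θ, ‖v‖ = 1 ∧
      β ^ (2 * c) * (numParts k ℓ * q * (1 / s ^ 2) ^ c) ≤
        (inner ℝ v (‖guidingOf k ℓ (noisy β z s y)‖⁻¹ • guidingOf k ℓ (noisy β z s y))) ^ 2 := by
  simp only [exceptionalSet, Set.mem_union, Set.mem_ofPred_eq, not_or, not_le] at h
  obtain ⟨⟨⟨h1, h2⟩, h3⟩, h4⟩ := h
  obtain ⟨-, hmem, hnorm, hin⟩ :=
    windowComponent_spec (k := k) hℓ hz a b hb (noisy β z s' x)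
  set v := windowComponent k ℓ z a b (noisy β z s' x)
  set Γ := guidingOf k ℓ (noisy β z s y)
  set Y := tiltWeight k z τ y
  set u : ℝ := inner ℝ (plantedVec ℓ z) v
  set Q : ℝ := inner ℝ v Γ
  have hY0 : 0 < Y := tiltWeight_pos k z τ y
  have hp : (0 : ℝ) < numParts k ℓ := by rw [hc]; exact_mod_cast numParts_pos hk c
  set A : ℝ := β ^ c * Real.sqrt (numParts k ℓ) with hA
  have hApos : 0 < A := by positivity
  have hA2 : A ^ 2 = β ^ (2 * c) * numParts k ℓ := by
    rw [hA, mul_pow, Real.sq_sqrt hp.le, mul_comm 2 c, pow_mul]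
  clear_value A
  have hu : 1 / 2 ≤ u := by
    refine le_trans ?_ hin
    have : eigenError k ℓ z a (noisy β z s' x) / b ^ 2 ≤ 1 / 2 := by
      rw [div_le_iff₀ (by positivity)]
      linarith
    unfold eigenError at this
    linarith
  have hY : 4 * η < Y := by
    have := (inv_lt_inv₀ hY0 (by positivity)).1 h3
    exact this
  have hdev : |Q - A * u * Y| < A * η := by
    refine abs_lt_of_sq_lt_sq ?_ (by positivity)
    rw [mul_pow, hA2]
    exact h2
  -- u ≥ 1/2 and Y > 4η give AuY ≥ 2Aη, and the deviation uses up at most half of it.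
  have hQ : A * η < Q := by
    have h5 := (abs_lt.1 hdev).1
    have h6 : A * (2 * η) ≤ A * u * Y := by
      rw [mul_assoc]
      refine mul_le_mul_of_nonneg_left ?_ hApos.le
      nlinarith
    linarith
  have hQ0 : 0 < Q := lt_trans (by positivity) hQ
  have hv0 : v ≠ 0 := fun e => hQ0.ne' (by simp [Q, e])
  have hΓ0 : Γ ≠ 0 := fun e => hQ0.ne' (by simp [Q, e])
  have hvn : 0 < ‖v‖ := norm_pos_iff.2 hv0
  have hΓn : 0 < ‖Γ‖ := norm_pos_iff.2 hΓ0
  refine ⟨‖v‖⁻¹ • v, ?_, ?_, ?_⟩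
  · rw [hθ]
    exact Submodule.smul_mem _ _ hmem
  · rw [norm_smul, norm_inv, norm_norm, inv_mul_cancel₀ hvn.ne']
  · rw [real_inner_smul_left, real_inner_smul_right]
    change _ ≤ (‖v‖⁻¹ * (‖Γ‖⁻¹ * Q)) ^ 2
    have hs2 : (0 : ℝ) < (s ^ 2) ^ c := by positivity
    calc β ^ (2 * c) * (numParts k ℓ * q * (1 / s ^ 2) ^ c)
        = A ^ 2 * q / (s ^ 2) ^ c := by rw [hA2, div_pow, one_pow]; ring
      _ ≤ A ^ 2 * (η ^ 2 / (2 * r)) / (s ^ 2) ^ c := by gcongr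
      _ = (A * η) ^ 2 / (2 * r * (s ^ 2) ^ c) := by rw [mul_pow]; field_simp
      _ ≤ Q ^ 2 / ‖Γ‖ ^ 2 := by
          refine div_le_div₀ (sq_nonneg _) ?_ (by positivity) h4.le
          exact pow_le_pow_left₀ (by positivity) hQ.le 2
      -- The window component has norm at most 1, so normalizing it can only increase the overlap.
      _ ≤ (‖v‖ ^ 2)⁻¹ * (Q ^ 2 / ‖Γ‖ ^ 2) := by
          refine le_mul_of_one_le_left (by positivity) ?_
          exact (one_le_inv₀ (by positivity)).2 (pow_le_one₀ hvn.le hnorm)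
      _ = (‖v‖⁻¹ * (‖Γ‖⁻¹ * Q)) ^ 2 := by
          rw [mul_pow, mul_pow, inv_pow, inv_pow]
          ring

theorem measurableSet_deviation (hℓ : ℓ ≤ n) {z : Fin n → ℝ}
    (hz : ∀ i, z i = 1 ∨ z i = -1) (β s' s τ a b : ℝ) (hb : 0 < b) (t A : ℝ) :
    MeasurableSet {w : (Finset (Fin n) → ℝ) × (Finset (Fin n) → ℝ) | t ≤
      (inner ℝ (windowComponent k ℓ z a b (noisy β z s' w.1)) (guidingOf k ℓ (noisy β z s w.2))
        - A * inner ℝ (plantedVec ℓ z) (windowComponent k ℓ z a b (noisy β z s' w.1)) *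
        tiltWeight k z τ w.2) ^ 2} := by
  have hv : Measurable fun w : (Finset (Fin n) → ℝ) × (Finset (Fin n) → ℝ) =>
      windowComponent k ℓ z a b (noisy β z s' w.1) :=
    (measurable_windowComponent hℓ hz a b hb).comp
      ((continuous_noisy β z s').measurable.comp measurable_fst)
  have hΓ : Measurable fun w : (Finset (Fin n) → ℝ) × (Finset (Fin n) → ℝ) =>
      guidingOf k ℓ (noisy β z s w.2) :=
    continuous_guidingOf.measurable.comp ((continuous_noisy β z s).measurable.comp measurable_snd)
  have hY : Measurable fun w : (Finset (Fin n) → ℝ) × (Finset (Fin n) → ℝ) =>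
      tiltWeight k z τ w.2 := (continuous_tiltWeight k z τ).measurable.comp measurable_snd
  refine measurableSet_le measurable_const (Measurable.pow_const (Measurable.sub ?_ ?_) 2)
  · exact Measurable.inner hv hΓ
  · exact (measurable_const.mul (Measurable.inner measurable_const hv)).mul hY

theorem measurableSet_exceptionalSet (hℓ : ℓ ≤ n) {z : Fin n → ℝ}
    (hz : ∀ i, z i = 1 ∨ z i = -1) (β s' s τ a b η r : ℝ) (hb : 0 < b) :
    MeasurableSet (exceptionalSet n k ℓ c z β s' s τ a b η r) := by
  refine MeasurableSet.union (MeasurableSet.union (MeasurableSet.union ?_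
    (measurableSet_deviation hℓ hz β s' s τ a b hb _ _)) ?_) ?_
  · exact measurableSet_le measurable_const ((continuous_eigenError z a).measurable.comp
      ((continuous_noisy β z s').measurable.comp measurable_fst))
  · exact measurableSet_le measurable_const
      ((continuous_tiltWeight k z τ).measurable.comp measurable_snd).inv
  · exact measurableSet_le measurable_const ((continuous_guidingOf.measurable.comp
      ((continuous_noisy β z s).measurable.comp measurable_snd)).norm.pow_const 2)

/-- The signal part is cancelled exactly by its eigenvalue, so the error is the noise matrix applied
to the planted vector. -/
theorem integral_eigenError (hk : Even k) (hℓ : ℓ ≤ n) {z : Fin n → ℝ}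
    (hz : ∀ i, z i = 1 ∨ z i = -1) (β s' : ℝ) :
    Integrable (fun x => eigenError k ℓ z (kikuchiDegree n k ℓ * β) (noisy β z s' x))
        (gaussPi (Finset (Fin n))) ∧
      ∫ x, eigenError k ℓ z (kikuchiDegree n k ℓ * β) (noisy β z s' x)
        ∂gaussPi (Finset (Fin n)) = s' ^ 2 * kikuchiDegree n k ℓ := by
  have h : ∀ x, eigenError k ℓ z (kikuchiDegree n k ℓ * β) (noisy β z s' x)
      = s' ^ 2 * ‖Matrix.toEuclideanLin (kikuchiOf k ℓ x) (plantedVec ℓ z)‖ ^ 2 := by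
    intro x
    have hK : kikuchiOf k ℓ (noisy β z s' x)
        = β • kikuchiOf k ℓ (signProd z) + s' • kikuchiOf k ℓ x :=
      kikuchiOf_add_smul (signProd z) x β s'
    rw [eigenError, hK, map_add, map_smul, map_smul, LinearMap.add_apply, LinearMap.smul_apply,
      LinearMap.smul_apply, toEuclideanLin_kikuchiOf_signProd hz hk, smul_smul, mul_comm β,
      add_sub_cancel_left, norm_smul, mul_pow, Real.norm_eq_abs, sq_abs]
  have hI := integral_norm_sq_kikuchiOf (k := k) hz hk hℓ
  simp_rw [h]
  exact ⟨hI.1.const_mul _, by rw [integral_const_mul, hI.2]⟩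

/-- The probability of the exceptional set. -/
theorem measure_exceptionalSet_le (hk : Even k) (hk0 : 0 < k) (hc : 0 < c) (hℓ : ℓ = c * k)
    (hn : ℓ + k ≤ n) {z : Fin n → ℝ} (hz : ∀ i, z i = 1 ∨ z i = -1)
    {β s' s x x' b η r : ℝ} (hβ : 0 < β) (hs : 1 ≤ s ^ 2) (hb : 0 < b) (hη : 0 < η) (hr : 0 < r)
    (hx : x = c ^ 2 * s ^ 2 / (β ^ 2 * n.choose k))
    (hx' : c ^ 2 * s ^ 2 / (β ^ 2 * (n - ℓ).choose k) ≤ x')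
    (hβℓ : β ^ 2 * (ℓ : ℝ) ^ k ≤ 1 / 100) :
    ((gaussPi (Finset (Fin n))).prod (gaussPi (Finset (Fin n))))
        (exceptionalSet n k ℓ c z β s' s (c * s / (β * n.choose k))
          (kikuchiDegree n k ℓ * β) b η r)
      ≤ ENNReal.ofReal (2 * s' ^ 2 * kikuchiDegree n k ℓ / b ^ 2) +
        ENNReal.ofReal (((Real.exp x' - Real.exp x) + x * (x / c) * Real.exp x
          + x' * Real.exp x' / c) / η ^ 2) +
        ENNReal.ofReal (4 * η * Real.exp x) + ENNReal.ofReal (1 / r) := by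
  have hℓn : ℓ ≤ n := by omega
  have hℓ0 : 0 < ℓ := by rw [hℓ]; positivity
  -- With this tilt both C(n,k)τ² = x and sτ/β = x/c hold: the second moment of the weight is e^x
  -- and the cross moment is (1 + x/c)^c.
  set τ : ℝ := c * s / (β * n.choose k) with hτ
  set a : ℝ := kikuchiDegree n k ℓ * β with ha
  have hM : (0 : ℝ) < n.choose k := by exact_mod_cast Nat.choose_pos (by omega)
  have hM' : (0 : ℝ) < (n - ℓ).choose k := by exact_mod_cast Nat.choose_pos (by omega)
  have hcpos : (0 : ℝ) < c := by exact_mod_cast hc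
  have hp : (0 : ℝ) < numParts k ℓ := by rw [hℓ]; exact_mod_cast numParts_pos hk0 c
  have hx0 : 0 ≤ x := by rw [hx]; positivity
  have hMM : ((n - ℓ).choose k : ℝ) ≤ n.choose k := by
    exact_mod_cast Nat.choose_le_choose k (Nat.sub_le n ℓ)
  have hτx : n.choose k * τ ^ 2 = x := by
    rw [hx, hτ]
    field_simp
  have hyx : s * τ / β = x / c := by
    rw [hx, hτ]
    field_simp
  set X' : ℝ := c ^ 2 * s ^ 2 / (β ^ 2 * (n - ℓ).choose k) with hX'
  have hxX' : x ≤ X' := by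
    rw [hx, hX']
    gcongr
  have hxx' : x ≤ x' := hxX'.trans hx'
  refine (measure_union_le _ _).trans (add_le_add ((measure_union_le _ _).trans
    (add_le_add ((measure_union_le _ _).trans (add_le_add ?_ ?_)) ?_)) ?_)
  · have hm : MeasurableSet {y | b ^ 2 / 2 ≤ eigenError k ℓ z a (noisy β z s' y)} :=
      measurableSet_le measurable_const
        ((continuous_eigenError z a).measurable.comp (continuous_noisy β z s').measurable)
    have := (measurePreserving_fst (μ := gaussPi (Finset (Fin n)))
      (ν := gaussPi (Finset (Fin n)))).measure_preimage hm.nullMeasurableSet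
    refine (le_of_eq this).trans ?_
    have hI := integral_eigenError hk hℓn hz β s'
    refine (measure_ge_le_of_integral_le hI.1 (fun _ => sq_nonneg _) (by positivity)
      hI.2.le).trans (ENNReal.ofReal_le_ofReal (le_of_eq ?_))
    field_simp
  · have hm2 := measurableSet_deviation (k := k) hℓn hz β s' s τ a b hb
      (β ^ (2 * c) * numParts k ℓ * η ^ 2) (β ^ c * Real.sqrt (numParts k ℓ))
    -- Fubini: for a fixed noise of T⁺ the window component is a deterministic vector of norm at
    -- most 1, and the moment bound is uniform over such vectors.
    rw [Measure.prod_apply hm2]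
    refine (lintegral_mono (g := fun _ => ENNReal.ofReal (((Real.exp x' - Real.exp x)
      + x * (x / c) * Real.exp x + x' * Real.exp x' / c) / η ^ 2)) fun w => ?_).trans ?_
    · obtain ⟨-, -, hnorm, -⟩ := windowComponent_spec (k := k) hℓn hz a b hb (noisy β z s' w)
      set v := windowComponent k ℓ z a b (noisy β z s' w)
      have hu1 : (inner ℝ (plantedVec ℓ z) v : ℝ) ^ 2 ≤ 1 := by
        have h1 := abs_real_inner_le_norm (plantedVec ℓ z) v
        rw [norm_plantedVec hz hℓn, one_mul] at h1
        rw [← sq_abs]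
        exact pow_le_one₀ (abs_nonneg _) (h1.trans hnorm)
      have hI := integral_inner_guidingOf_sub_sq_le hk0 hc hℓ hℓn hz β s τ hβ v hnorm
      have hsum := sum_chaosWeight_le (n := n) hk0 hc (ρ := s ^ 2 / β ^ 2) (by positivity)
        (m := n - ℓ) (by omega) (by omega) (inner ℝ (plantedVec ℓ z) v)
      have hX : (c : ℝ) ^ 2 * (s ^ 2 / β ^ 2) / (n - ℓ).choose k = X' := by
        rw [hX']
        field_simp
      rw [hX] at hsum
      have hdev := deviation_le hc hu1 hx0 hxX'
      rw [hτx, hyx] at hI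
      have hmono : (Real.exp X' - Real.exp x) + x * (x / c) * Real.exp x
          + X' * Real.exp X' / c ≤ (Real.exp x' - Real.exp x) + x * (x / c) * Real.exp x
          + x' * Real.exp x' / c := by
        have h0 : 0 ≤ X' := hx0.trans hxX'
        have h0' : 0 ≤ x' := h0.trans hx'
        gcongr
      have hA : 0 < β ^ (2 * c) * (numParts k ℓ : ℝ) := by positivity
      have hle := hI.2.trans (mul_le_mul_of_nonneg_left
        (((add_le_add_left (sub_le_sub_right hsum _) _).trans hdev).trans hmono) hA.le)
      refine (measure_ge_le_of_integral_le hI.1 (fun _ => sq_nonneg _) (by positivity)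
        hle).trans (ENNReal.ofReal_le_ofReal (le_of_eq ?_))
      rw [mul_div_mul_left _ _ hA.ne']
    · rw [lintegral_const]
      simp
  · have hm : MeasurableSet {y | (4 * η)⁻¹ ≤ (tiltWeight k z τ y)⁻¹} :=
      measurableSet_le measurable_const (continuous_tiltWeight k z τ).measurable.inv
    have := (measurePreserving_snd (μ := gaussPi (Finset (Fin n)))
      (ν := gaussPi (Finset (Fin n)))).measure_preimage hm.nullMeasurableSet
    refine (le_of_eq this).trans ?_
    have hI := integral_tiltWeight_inv (k := k) hz τ
    rw [hτx] at hI
    refine (measure_ge_le_of_integral_le hI.1 (fun y => (inv_pos.2 (tiltWeight_pos k z τ y)).le)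
      (by positivity) hI.2.le).trans (ENNReal.ofReal_le_ofReal (le_of_eq ?_))
    field_simp
  · have hm : MeasurableSet {y | 2 * r * (s ^ 2) ^ c ≤ ‖guidingOf k ℓ (noisy β z s y)‖ ^ 2} :=
      measurableSet_le measurable_const
        ((continuous_guidingOf.measurable.comp (continuous_noisy β z s).measurable).norm.pow_const
          2)
    have := (measurePreserving_snd (μ := gaussPi (Finset (Fin n)))
      (ν := gaussPi (Finset (Fin n)))).measure_preimage hm.nullMeasurableSet
    refine (le_of_eq this).trans ?_
    have hI := integral_norm_guidingOf_sq hk0 hℓ hℓn hz β s hβ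
    have hle := sum_guiding_norm_le (s := s) hk0 hc hβ hs (by rw [← hℓ]; exact hβℓ)
    rw [← hI.2] at hle
    have hs2 : (0 : ℝ) < (s ^ 2) ^ c := by positivity
    refine (measure_ge_le_of_integral_le hI.1 (fun y => sq_nonneg _)
      (by positivity) hle).trans (ENNReal.ofReal_le_ofReal (le_of_eq ?_))
    field_simp

end FixedParameters

end TensorPCA

namespace TensorPCA

/-! ### From the tensors G, H to the rotated independent noise vectors. -/

section Transfer

variable {n k : ℕ}

theorem prod_orderEmbOfFin_eq_signProd (z : Fin n → ℝ) {S : Finset (Fin n)} (h : S.card = k) :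
    ∏ j, z (S.orderEmbOfFin h j) = signProd z S := by
  rw [signProd, ← Finset.prod_coe_sort S]
  exact Fintype.prod_equiv (S.orderIsoOfFin h).toEquiv _ _ fun j => rfl

theorem entries_splitPlus_spiked (ζ β : ℝ) (z : Fin n → ℝ) (G H : Tensor n k)
    {S : Finset (Fin n)} (h : S.card = k) :
    entries (splitPlus ζ (spiked β z G) H) S
      = β * signProd z S + (entries G S + ζ * entries H S) := by
  simp only [entries, entry, h, dite_true, splitPlus, spiked, Pi.add_apply, Pi.smul_apply,
    smul_eq_mul, prod_orderEmbOfFin_eq_signProd]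
  ring

theorem entries_splitMinus_spiked (ζ β : ℝ) (z : Fin n → ℝ) (G H : Tensor n k)
    {S : Finset (Fin n)} (h : S.card = k) :
    entries (splitMinus ζ (spiked β z G) H) S
      = β * signProd z S + (entries G S - 1 / ζ * entries H S) := by
  simp only [entries, entry, h, dite_true, splitMinus, spiked, Pi.sub_apply, Pi.smul_apply,
    smul_eq_mul, prod_orderEmbOfFin_eq_signProd]
  ring

theorem truncate_add_smul (p q : ℝ) (x y : Finset (Fin n) → ℝ) :
    p • truncate k x + q • truncate k y = truncate k (p • x + q • y) := by
  funext S
  simp only [truncate, Pi.add_apply, Pi.smul_apply, smul_eq_mul]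
  split_ifs <;> simp

/-- The law of the rotated pair of the entries of two independent symmetrized Gaussian tensors. -/
theorem measure_rotated_entries {Ω : Type*} [MeasurableSpace Ω] {P : Measure Ω}
    [IsProbabilityMeasure P] {G H : Ω → Tensor n k} (hG : HasLaw G (symmGaussianLaw n k) P)
    (hH : HasLaw H (symmGaussianLaw n k) P) (hGH : IndepFun G H P) {p q : ℝ}
    (hpq : p ^ 2 + q ^ 2 = 1) {E : Set ((Finset (Fin n) → ℝ) × (Finset (Fin n) → ℝ))}
    (hE : MeasurableSet E) (hEt : ∀ x y, (truncate k x, truncate k y) ∈ E ↔ (x, y) ∈ E) :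
    P {ω | (p • entries (G ω) + q • entries (H ω), q • entries (G ω) - p • entries (H ω)) ∈ E}
      = ((gaussPi (Finset (Fin n))).prod (gaussPi (Finset (Fin n)))) E := by
  set R : (Finset (Fin n) → ℝ) × (Finset (Fin n) → ℝ) →
      (Finset (Fin n) → ℝ) × (Finset (Fin n) → ℝ) :=
    fun w => (p • w.1 + q • w.2, q • w.1 - p • w.2) with hR
  have hRm : Measurable R := by fun_prop
  have hGa := measurable_entries.comp_aemeasurable hG.aemeasurable
  have hHa := measurable_entries.comp_aemeasurable hH.aemeasurable
  have hind : IndepFun (entries ∘ G) (entries ∘ H) P :=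
    hGH.comp measurable_entries measurable_entries
  have hlaw : ∀ {A : Ω → Tensor n k}, HasLaw A (symmGaussianLaw n k) P →
      P.map (entries ∘ A) = (gaussPi (Finset (Fin n))).map (truncate k) := by
    intro A hA
    rw [← AEMeasurable.map_map_of_aemeasurable measurable_entries.aemeasurable hA.aemeasurable,
      hA.map_eq, symmGaussianLaw_map_entries]
  have hmap : P.map (fun ω => (entries (G ω), entries (H ω)))
      = ((gaussPi (Finset (Fin n))).prod (gaussPi (Finset (Fin n)))).map
        (Prod.map (truncate k) (truncate k)) := by
    have := (indepFun_iff_map_prod_eq_prod_map_map hGa hHa).1 hind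
    rw [hlaw hG, hlaw hH, Measure.map_prod_map _ _ measurable_truncate measurable_truncate] at this
    exact this
  -- Truncation commutes with the rotation and does not affect membership in E, so it can be dropped
  -- before rotation invariance is used.
  have hpre : (Prod.map (truncate k) (truncate k)) ⁻¹' (R ⁻¹' E) = R ⁻¹' E := by
    ext ⟨x, y⟩
    have h2 : q • truncate k x - p • truncate k y = truncate k (q • x - p • y) := by
      have := truncate_add_smul (k := k) q (-p) x y
      rwa [neg_smul, neg_smul, ← sub_eq_add_neg, ← sub_eq_add_neg] at this
    simp only [Set.mem_preimage, Prod.map_apply, hR, truncate_add_smul, h2, hEt]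
  change P ((fun ω => (entries (G ω), entries (H ω))) ⁻¹' (R ⁻¹' E)) = _
  have hpair : AEMeasurable (fun ω => (entries (G ω), entries (H ω))) P := hGa.prodMk hHa
  rw [← Measure.map_apply_of_aemeasurable hpair (hRm hE), hmap,
    Measure.map_apply (measurable_truncate.prodMap measurable_truncate) (hRm hE), hpre,
    ← Measure.map_apply hRm hE, gaussPi_prod_map_rotation p q hpq]

/-- The failure probability, at fixed parameters. -/
theorem measure_not_exists_guided_le {c ℓ : ℕ} (hk : Even k) (hk0 : 0 < k) (hc : 0 < c)
    (hℓ : ℓ = c * k) (hn : ℓ + k ≤ n) {γ : ℝ} (hγ : 0 < γ) {L : ℝ} (hL : 0 < L)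
    {z : Fin n → ℝ} (hz : ∀ i, z i = 1 ∨ z i = -1) {β x x' η r : ℝ} (hβ : 0 < β)
    (hη : 0 < η) (hr : 0 < r) (hq : γ / 10 * (1 / L) ≤ η ^ 2 / (2 * r))
    (hx : x = c ^ 2 * (1 + L ^ 2) / (β ^ 2 * n.choose k))
    (hx' : c ^ 2 * (1 + L ^ 2) / (β ^ 2 * (n - ℓ).choose k) ≤ x')
    (hβℓ : β ^ 2 * (ℓ : ℝ) ^ k ≤ 1 / 100)
    {Ω : Type*} [MeasurableSpace Ω] {P : Measure Ω}
    [IsProbabilityMeasure P] {G H : Ω → Tensor n k} (hG : HasLaw G (symmGaussianLaw n k) P)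
    (hH : HasLaw H (symmGaussianLaw n k) P) (hGH : IndepFun G H P) :
    P {ω | ¬ ∃ v ∈ cutoffEigenspace
          (kikuchi ℓ (splitPlus (1 / L) (spiked β z (G ω)) (H ω)))
          ((1 - γ) * (kikuchiDegree n k ℓ : ℝ) * β),
        ‖v‖ = 1 ∧
        β ^ (2 * c) *
            ((numParts k ℓ : ℝ) * (γ / 10) * (1 / (1 + L ^ 2)) ^ c * (1 / L))
          ≤ (inner ℝ v
              (guidingState ℓ (splitMinus (1 / L) (spiked β z (G ω)) (H ω)))) ^ 2}
      ≤ ENNReal.ofReal (2 * (1 + 1 / L ^ 2) / (γ ^ 2 * (β ^ 2 * kikuchiDegree n k ℓ))) +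
        ENNReal.ofReal (((Real.exp x' - Real.exp x) + x * (x / c) * Real.exp x
          + x' * Real.exp x' / c) / η ^ 2) +
        ENNReal.ofReal (4 * η * Real.exp x) + ENNReal.ofReal (1 / r) := by
  set s : ℝ := Real.sqrt (1 + L ^ 2) with hs
  have hs2 : s ^ 2 = 1 + L ^ 2 := Real.sq_sqrt (by positivity)
  have hs0 : 0 < s := Real.sqrt_pos.2 (by positivity)
  have hd : (0 : ℝ) < kikuchiDegree n k ℓ := by
    have hkℓ : k ≤ ℓ := by
      rw [hℓ]
      exact Nat.le_mul_of_pos_left k hc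
    unfold kikuchiDegree
    exact_mod_cast Nat.mul_pos (Nat.choose_pos (by omega)) (Nat.choose_pos (by omega))
  have hb : 0 < γ * (kikuchiDegree n k ℓ * β) := by positivity
  set E := exceptionalSet n k ℓ c z β (s / L) s (c * s / (β * n.choose k))
    (kikuchiDegree n k ℓ * β) (γ * (kikuchiDegree n k ℓ * β)) η r with hE
  have hmE : MeasurableSet E := measurableSet_exceptionalSet (by omega) hz _ _ _ _ _ _ _ _ hb
  -- The noises are G + H/L = (s/L)(pG + qH) and G - LH = s(qG - pH) with p = L/s and q = 1/s.
  have hpq : (L / s) ^ 2 + (1 / s) ^ 2 = 1 := by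
    rw [div_pow, div_pow, hs2]
    field_simp
    exact add_comm _ _
  have hmeas := measure_rotated_entries hG hH hGH hpq hmE truncate_mem_exceptionalSet_iff
  have hbound := measure_exceptionalSet_le (n := n) (x := x) (x' := x') (s' := s / L) (s := s) hk hk0 hc hℓ hn hz hβ
    (by rw [hs2]; nlinarith) hb hη hr (by rw [hs2]; exact hx) (by rw [hs2]; exact hx') hβℓ
  refine (measure_mono fun ω hω => ?_).trans ((hmeas.trans_le hbound).trans (le_of_eq ?_))
  · by_contra hnot
    refine hω ?_
    have hw := exists_unit_of_notMem_exceptionalSet (n := n)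
      (θ := (1 - γ) * (kikuchiDegree n k ℓ : ℝ) * β) (q := γ / 10 * (1 / L))
      (by omega) hk0 hℓ hz hβ hb hη hr hs0 (by ring) hq hnot
    have hplus : kikuchi ℓ (splitPlus (1 / L) (spiked β z (G ω)) (H ω))
        = kikuchiOf k ℓ (noisy β z (s / L)
          ((L / s) • entries (G ω) + (1 / s) • entries (H ω))) := by
      rw [kikuchi_eq_kikuchiOf]
      refine kikuchiOf_congr fun S h => ?_
      rw [entries_splitPlus_spiked _ _ _ _ _ h]
      simp only [noisy, Pi.add_apply, Pi.smul_apply, smul_eq_mul]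
      field_simp
    have hminus : guidingState ℓ (splitMinus (1 / L) (spiked β z (G ω)) (H ω))
        = ‖guidingOf k ℓ (noisy β z s ((1 / s) • entries (G ω) - (L / s) • entries (H ω)))‖⁻¹ •
          guidingOf k ℓ (noisy β z s
            ((1 / s) • entries (G ω) - (L / s) • entries (H ω))) := by
      rw [guidingState, guidingVector_eq_guidingOf]
      rw [guidingOf_congr (t' := noisy β z s
        ((1 / s) • entries (G ω) - (L / s) • entries (H ω))) fun S h => ?_]
      rw [entries_splitMinus_spiked _ _ _ _ _ h]
      simp only [noisy, Pi.sub_apply, Pi.smul_apply, smul_eq_mul]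
      field_simp
    rw [hplus, hminus]
    obtain ⟨v, hv, hv1, hv2⟩ := hw
    refine ⟨v, hv, hv1, le_trans (le_of_eq ?_) hv2⟩
    rw [hs2]
    ring
  · congr 3
    congr 1
    rw [div_pow, hs2]
    field_simp
    ring

end Transfer

end TensorPCA

namespace TensorPCA

/-! ### Consequences of the threshold, and the error function. -/

section Asymptotics

variable {κ n c ℓ : ℕ} {A L δ β : ℝ}

theorem choose_cast_le_pow (n k : ℕ) : (n.choose k : ℝ) ≤ (n : ℝ) ^ k := by
  exact_mod_cast Nat.choose_le_pow n k

theorem pow_le_factorial_mul_choose {m κ : ℕ} {u : ℝ} (hu : 0 ≤ u)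
    (h : u ≤ ((m + 1 - κ : ℕ) : ℝ)) : u ^ κ ≤ κ.factorial * m.choose κ := by
  refine (pow_le_pow_left₀ hu h κ).trans ?_
  exact_mod_cast (Nat.pow_sub_le_descFactorial m κ).trans_eq
    (Nat.descFactorial_eq_factorial_mul_choose m κ)

/-- The signal-to-noise hypothesis, cleared of denominators. -/
theorem mul_pow_le_of_threshold (hn : 2 * κ ≤ n) (hβ : 0 < β)
    (h : A * ((n : ℝ) ^ κ / (β ^ 2 * n.choose (2 * κ))) * L ≤ (ℓ : ℝ) ^ (κ - 1)) :
    A * L * (n : ℝ) ^ κ ≤ (ℓ : ℝ) ^ (κ - 1) * (β ^ 2 * n.choose (2 * κ)) := by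
  have hM : (0 : ℝ) < n.choose (2 * κ) := by exact_mod_cast Nat.choose_pos hn
  rw [← div_le_iff₀ (by positivity)]
  refine le_trans (le_of_eq ?_) h
  ring

/-- The hypotheses force `ℓ` to be of smaller order than `n`. -/
theorem pow_succ_le_of_threshold (hκ : 0 < κ) (hn : 0 < n) (hℓ : 0 < ℓ)
    (hβℓ : β ^ 2 * (ℓ : ℝ) ^ (2 * κ) ≤ 1 / 100)
    (h : A * L * (n : ℝ) ^ κ ≤ (ℓ : ℝ) ^ (κ - 1) * (β ^ 2 * n.choose (2 * κ))) :
    A * L * (ℓ : ℝ) ^ (κ + 1) ≤ (n : ℝ) ^ κ / 100 := by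
  have hn' : (0 : ℝ) < n := by exact_mod_cast hn
  have hℓ' : (0 : ℝ) < ℓ := by exact_mod_cast hℓ
  have h1 : (A * L * (ℓ : ℝ) ^ (κ + 1)) * (n : ℝ) ^ κ ≤ ((n : ℝ) ^ κ / 100) * (n : ℝ) ^ κ := by
    calc (A * L * (ℓ : ℝ) ^ (κ + 1)) * (n : ℝ) ^ κ
        = (ℓ : ℝ) ^ (κ + 1) * (A * L * (n : ℝ) ^ κ) := by ring
      _ ≤ (ℓ : ℝ) ^ (κ + 1) * ((ℓ : ℝ) ^ (κ - 1) * (β ^ 2 * (n : ℝ) ^ (2 * κ))) := by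
          refine mul_le_mul_of_nonneg_left (h.trans ?_) (by positivity)
          gcongr
          exact choose_cast_le_pow _ _
      _ = (β ^ 2 * (ℓ : ℝ) ^ (2 * κ)) * (n : ℝ) ^ (2 * κ) := by
          rw [show (ℓ : ℝ) ^ (2 * κ) = (ℓ : ℝ) ^ (κ + 1) * (ℓ : ℝ) ^ (κ - 1) by
            rw [← pow_add]; congr 1; omega]
          ring
      _ ≤ 1 / 100 * (n : ℝ) ^ (2 * κ) := by gcongr
      _ = _ := by ring
  exact le_of_mul_le_mul_right h1 (by positivity)

/-- ℓ^{κ+1} ≤ n^κ means (ℓ/n)^{κ+1} ≤ 1/n. It is applied with δ = n^{-1/(κ+1)}. -/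
theorem div_le_of_pow_succ_le (hn : 0 < n) (hAL : 1 ≤ A * L) (hδ : 0 ≤ δ)
    (hδn : 1 / (n : ℝ) ≤ δ ^ (κ + 1)) (h : A * L * (ℓ : ℝ) ^ (κ + 1) ≤ (n : ℝ) ^ κ / 100) :
    (ℓ : ℝ) / n ≤ δ := by
  have hn' : (0 : ℝ) < n := by exact_mod_cast hn
  refine le_of_pow_le_pow_left₀ (Nat.succ_ne_zero κ) hδ (le_trans ?_ hδn)
  rw [div_pow, div_le_div_iff₀ (by positivity) hn']
  have h1 : (ℓ : ℝ) ^ (κ + 1) ≤ (n : ℝ) ^ κ := by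
    have h2 : (0 : ℝ) ≤ (ℓ : ℝ) ^ (κ + 1) := by positivity
    have h3 : (0 : ℝ) ≤ (n : ℝ) ^ κ := by positivity
    nlinarith
  calc (ℓ : ℝ) ^ (κ + 1) * n ≤ (n : ℝ) ^ κ * n := by gcongr
    _ = 1 * (n : ℝ) ^ (κ + 1) := by ring

/-- The tilting parameter is bounded. -/
theorem tilt_le (hA : 0 < A) (hL : 1 ≤ L) (hn : 2 * κ ≤ n) (hκ : 0 < κ) (hc : c ≤ ℓ) (hβ : 0 < β)
    (h : A * L * (n : ℝ) ^ κ ≤ (ℓ : ℝ) ^ (κ - 1) * (β ^ 2 * n.choose (2 * κ)))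
    (h' : A * L * (ℓ : ℝ) ^ (κ + 1) ≤ (n : ℝ) ^ κ / 100) :
    (c : ℝ) ^ 2 * (1 + L ^ 2) / (β ^ 2 * n.choose (2 * κ)) ≤ 1 / (50 * A ^ 2) ∧
      (c : ℝ) * (1 + L ^ 2) / (β ^ 2 * n.choose (2 * κ)) ≤ 2 * L / A * ((ℓ : ℝ) / n) ^ κ := by
  have hn' : (0 : ℝ) < n := by exact_mod_cast (by omega : 0 < n)
  have hM : (0 : ℝ) < n.choose (2 * κ) := by exact_mod_cast Nat.choose_pos hn
  have hc' : (c : ℝ) ≤ ℓ := by exact_mod_cast hc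
  have hL2 : 1 + L ^ 2 ≤ 2 * L ^ 2 := by nlinarith
  have hL0 : 0 < L := by linarith
  -- One factor L of 1 + L² ≤ 2L² is paid by the logarithm in the threshold, the other one survives.
  -- In the first bound it is absorbed by `h'`; in the second it remains beside a power of ℓ/n.
  have key : (1 + L ^ 2) / (β ^ 2 * n.choose (2 * κ))
      ≤ 2 * L * (ℓ : ℝ) ^ (κ - 1) / (A * (n : ℝ) ^ κ) := by
    rw [div_le_div_iff₀ (by positivity) (by positivity)]
    calc (1 + L ^ 2) * (A * (n : ℝ) ^ κ) ≤ 2 * L ^ 2 * (A * (n : ℝ) ^ κ) := by gcongr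
      _ = 2 * L * (A * L * (n : ℝ) ^ κ) := by ring
      _ ≤ 2 * L * ((ℓ : ℝ) ^ (κ - 1) * (β ^ 2 * n.choose (2 * κ))) := by gcongr
      _ = _ := by ring
  constructor
  · calc (c : ℝ) ^ 2 * (1 + L ^ 2) / (β ^ 2 * n.choose (2 * κ))
        = (c : ℝ) ^ 2 * ((1 + L ^ 2) / (β ^ 2 * n.choose (2 * κ))) := by ring
      _ ≤ (ℓ : ℝ) ^ 2 * (2 * L * (ℓ : ℝ) ^ (κ - 1) / (A * (n : ℝ) ^ κ)) := by gcongr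
      _ = 2 * (A * L * (ℓ : ℝ) ^ (κ + 1)) / (A ^ 2 * (n : ℝ) ^ κ) := by
          rw [show κ + 1 = (κ - 1) + 2 by omega, pow_add]
          field_simp
      _ ≤ 2 * ((n : ℝ) ^ κ / 100) / (A ^ 2 * (n : ℝ) ^ κ) := by gcongr
      _ = 1 / (50 * A ^ 2) := by
          field_simp
          norm_num
  · calc (c : ℝ) * (1 + L ^ 2) / (β ^ 2 * n.choose (2 * κ))
        = (c : ℝ) * ((1 + L ^ 2) / (β ^ 2 * n.choose (2 * κ))) := by ring
      _ ≤ (ℓ : ℝ) * (2 * L * (ℓ : ℝ) ^ (κ - 1) / (A * (n : ℝ) ^ κ)) := by gcongr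
      _ = 2 * L / A * ((ℓ : ℝ) / n) ^ κ := by
          rw [div_pow, show (ℓ : ℝ) ^ κ = ℓ ^ (κ - 1) * ℓ by
            rw [← pow_succ, Nat.sub_add_cancel hκ]]
          field_simp

/-- Removing few elements hardly changes the number of sets of cardinality `k`. -/
theorem choose_le_mul_choose_sub {k : ℕ} (hk : 0 < k) (hkℓ : k ≤ ℓ) (hn : 0 < n)
    (hδ : 4 * k * δ ≤ 1) (hρ : (ℓ : ℝ) / n ≤ δ) :
    (n.choose k : ℝ) ≤ (1 + 4 * k * δ) * (n - ℓ).choose k := by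
  have hn' : (0 : ℝ) < n := by exact_mod_cast hn
  have hk' : (1 : ℝ) ≤ k := by exact_mod_cast hk
  have hδ0 : 0 ≤ δ := le_trans (by positivity) hρ
  have hkδ : 0 ≤ (k : ℝ) * δ := by positivity
  have hℓn : (ℓ : ℝ) ≤ δ * n := by rwa [div_le_iff₀ hn'] at hρ
  have hδ4 : 4 * δ ≤ 1 := by nlinarith
  have hkℓ' : (k : ℝ) ≤ ℓ := by exact_mod_cast hkℓ
  have hnat : ℓ + k ≤ n := by
    have : ((ℓ + k : ℕ) : ℝ) ≤ n := by
      push_cast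
      nlinarith
    exact_mod_cast this
  -- Both ℓ and k are at most δn, since k ≤ ℓ.
  have hcast : (n : ℝ) * (1 - 2 * δ) ≤ ((n - ℓ + 1 - k : ℕ) : ℝ) := by
    rw [Nat.cast_sub (by omega), Nat.cast_add, Nat.cast_sub (by omega), Nat.cast_one]
    nlinarith
  have h1 := pow_le_factorial_mul_choose (m := n - ℓ) (mul_nonneg hn'.le (by linarith)) hcast
  have h2 : 1 - 2 * k * δ ≤ (1 - 2 * δ) ^ k := by
    have := one_add_mul_le_pow (a := -(2 * δ)) (by linarith) k
    calc 1 - 2 * k * δ = 1 + k * (-(2 * δ)) := by ring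
      _ ≤ _ := this
      _ = _ := by ring
  have h3 : (k.factorial : ℝ) * n.choose k ≤ (n : ℝ) ^ k := by
    exact_mod_cast (Nat.descFactorial_eq_factorial_mul_choose n k).symm.trans_le
      (Nat.descFactorial_le_pow n k)
  have hf : (0 : ℝ) < k.factorial := by positivity
  have h4 : (1 : ℝ) ≤ (1 + 4 * k * δ) * (1 - 2 * k * δ) := by nlinarith
  rw [mul_pow] at h1
  refine le_of_mul_le_mul_left ?_ hf
  calc (k.factorial : ℝ) * n.choose k ≤ (n : ℝ) ^ k * 1 := by rw [mul_one]; exact h3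
    _ ≤ (n : ℝ) ^ k * ((1 + 4 * k * δ) * (1 - 2 * k * δ)) := by gcongr
    _ ≤ (n : ℝ) ^ k * ((1 + 4 * k * δ) * (1 - 2 * δ) ^ k) := by gcongr
    _ = (1 + 4 * k * δ) * ((n : ℝ) ^ k * (1 - 2 * δ) ^ k) := by ring
    _ ≤ (1 + 4 * k * δ) * (k.factorial * (n - ℓ).choose k) := by gcongr
    _ = _ := by ring

/-- The signal strength `β² d` is at least of the order of `L`. -/
theorem le_sq_mul_kikuchiDegree (hκ : 0 < κ) (hκℓ : 2 * κ ≤ ℓ)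
    (hn : 0 < n) (hρ : (ℓ : ℝ) / n ≤ 1 / 4)
    (h : A * L * (n : ℝ) ^ κ ≤ (ℓ : ℝ) ^ (κ - 1) * (β ^ 2 * n.choose (2 * κ))) :
    A * L / (4 ^ κ * (κ.factorial : ℝ) ^ 2) ≤ β ^ 2 * kikuchiDegree n (2 * κ) ℓ := by
  have hn' : (0 : ℝ) < n := by exact_mod_cast hn
  have hκ' : (0 : ℝ) < κ := by exact_mod_cast hκ
  have hκℓ' : 2 * (κ : ℝ) ≤ ℓ := by exact_mod_cast hκℓ
  have hℓ1 : (1 : ℝ) ≤ ℓ := by exact_mod_cast (by omega : 1 ≤ ℓ)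
  have hℓn : (ℓ : ℝ) ≤ 1 / 4 * n := by rwa [div_le_iff₀ hn'] at hρ
  have hnat : ℓ + κ ≤ n := by
    have : ((ℓ + κ : ℕ) : ℝ) ≤ n := by
      push_cast
      linarith
    exact_mod_cast this
  have h1 := pow_le_factorial_mul_choose (m := ℓ) (κ := κ) (u := ℓ / 2) (by positivity) (by
    rw [Nat.cast_sub (by omega)]
    push_cast
    linarith)
  have h2 := pow_le_factorial_mul_choose (m := n - ℓ) (κ := κ) (u := n / 2) (by positivity) (by
    rw [Nat.cast_sub (by omega), Nat.cast_add, Nat.cast_sub (by omega), Nat.cast_one]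
    linarith)
  -- ℓ^{κ-1} is replaced by ℓ^κ, which has the order of the factor C(ℓ,κ) of the degree.
  have hβ : A * L ≤ β ^ 2 * (ℓ : ℝ) ^ κ * (n : ℝ) ^ κ := by
    refine le_of_mul_le_mul_right ?_ (by positivity : (0 : ℝ) < (n : ℝ) ^ κ)
    calc A * L * (n : ℝ) ^ κ ≤ (ℓ : ℝ) ^ (κ - 1) * (β ^ 2 * n.choose (2 * κ)) := h
      _ ≤ (ℓ : ℝ) ^ κ * (β ^ 2 * (n : ℝ) ^ (2 * κ)) := by
          gcongr
          · omega
          · exact choose_cast_le_pow _ _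
      _ = _ := by ring
  have hdeg : (kikuchiDegree n (2 * κ) ℓ : ℝ) = (n - ℓ).choose κ * ℓ.choose κ := by
    rw [kikuchiDegree, Nat.mul_div_cancel_left κ (by norm_num)]
    push_cast
    rfl
  rw [div_le_iff₀ (by positivity), hdeg]
  calc A * L ≤ β ^ 2 * (ℓ : ℝ) ^ κ * (n : ℝ) ^ κ := hβ
    _ = β ^ 2 * 4 ^ κ * (((ℓ : ℝ) / 2) ^ κ * ((n : ℝ) / 2) ^ κ) := by
        rw [div_pow, div_pow, show (4 : ℝ) ^ κ = 2 ^ κ * 2 ^ κ by rw [← mul_pow]; norm_num]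
        field_simp
    _ ≤ β ^ 2 * 4 ^ κ * ((κ.factorial * ℓ.choose κ) * (κ.factorial * (n - ℓ).choose κ)) := by
        gcongr
    _ = _ := by ring

/-- The deviation term is of the order of `L δ`. -/
theorem deviation_term_le {X K x y t : ℝ} (hA : 0 < A) (hL : 1 ≤ L) (hδ : 0 ≤ δ) (hx : 0 ≤ x)
    (hxX : x ≤ X) (hy : 0 ≤ y) (hyδ : y ≤ 2 * L / A * δ) (ht : 0 ≤ t) (ht1 : t * δ ≤ 1)
    (hK : K = Real.exp (2 * X) * (t * X + 2 * X / A + 4 / A)) :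
    (Real.exp (x * (1 + t * δ)) - Real.exp x) + x * y * Real.exp x
      + y * (1 + t * δ) * Real.exp (x * (1 + t * δ)) ≤ K * (L * δ) := by
  have hX : 0 ≤ X := hx.trans hxX
  have htδ : 0 ≤ t * δ := by positivity
  have hL0 : 0 < L := by linarith
  have h2 : Real.exp (x * (1 + t * δ)) ≤ Real.exp (2 * X) := by
    refine Real.exp_le_exp.2 ?_
    nlinarith
  have h1 : Real.exp x ≤ Real.exp (2 * X) := Real.exp_le_exp.2 (by linarith)
  -- Convexity: the increment of exp is at most the step xtδ times the value at the right endpoint.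
  have h3 : Real.exp (x * (1 + t * δ)) - Real.exp x ≤ (X * (t * δ)) * Real.exp (2 * X) := by
    have h4 := Real.add_one_le_exp (-(x * (t * δ)))
    have h5 : Real.exp x = Real.exp (x * (1 + t * δ)) * Real.exp (-(x * (t * δ))) := by
      rw [← Real.exp_add]
      congr 1
      ring
    have h6 : Real.exp (x * (1 + t * δ)) - Real.exp x
        ≤ (x * (t * δ)) * Real.exp (x * (1 + t * δ)) := by
      rw [h5]
      nlinarith [Real.exp_pos (x * (1 + t * δ))]
    exact h6.trans (by gcongr)
  have hE := Real.exp_pos (2 * X)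
  calc (Real.exp (x * (1 + t * δ)) - Real.exp x) + x * y * Real.exp x
        + y * (1 + t * δ) * Real.exp (x * (1 + t * δ))
      ≤ (X * (t * δ)) * Real.exp (2 * X) + X * (2 * L / A * δ) * Real.exp (2 * X)
        + (2 * L / A * δ) * (1 + 1) * Real.exp (2 * X) := by gcongr
    _ ≤ (X * (t * (L * δ))) * Real.exp (2 * X) + X * (2 * L / A * δ) * Real.exp (2 * X)
        + (2 * L / A * δ) * (1 + 1) * Real.exp (2 * X) := by
        have : δ ≤ L * δ := le_mul_of_one_le_left hδ hL
        gcongr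
    _ = K * (L * δ) := by
        rw [hK]
        ring

/-- The error function: it bounds the failure probability for large `n`. -/
noncomputable def errorBound (κ : ℕ) (γ A : ℝ) (n : ℕ) : ℝ :=
  4 * (4 ^ κ * (κ.factorial : ℝ) ^ 2) / (γ ^ 2 * A) * (Real.log n)⁻¹ +
  (Real.exp (2 * (1 / (50 * A ^ 2))) * (4 * (2 * κ : ℕ) * (1 / (50 * A ^ 2))
      + 2 * (1 / (50 * A ^ 2)) / A + 4 / A)) *
    (Real.log n ^ 2 * (n : ℝ) ^ (-(1 / ((κ : ℝ) + 1)))) +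
  (4 * Real.exp (1 / (50 * A ^ 2)) + 1) * (Real.sqrt (Real.sqrt (Real.log n)))⁻¹

theorem tendsto_log_natCast : Filter.Tendsto (fun n : ℕ => Real.log n) Filter.atTop Filter.atTop :=
  Real.tendsto_log_atTop.comp tendsto_natCast_atTop_atTop

theorem tendsto_natCast_rpow_neg (κ : ℕ) :
    Filter.Tendsto (fun n : ℕ => (n : ℝ) ^ (-(1 / ((κ : ℝ) + 1)))) Filter.atTop (nhds 0) :=
  (tendsto_rpow_neg_atTop (by positivity)).comp tendsto_natCast_atTop_atTop

theorem tendsto_sqrt_sqrt_log :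
    Filter.Tendsto (fun n : ℕ => Real.sqrt (Real.sqrt (Real.log n))) Filter.atTop Filter.atTop :=
  Real.tendsto_sqrt_atTop.comp (Real.tendsto_sqrt_atTop.comp tendsto_log_natCast)

theorem tendsto_errorBound (κ : ℕ) (γ A : ℝ) :
    Filter.Tendsto (errorBound κ γ A) Filter.atTop (nhds 0) := by
  have h1 : Filter.Tendsto (fun n : ℕ => (Real.log n)⁻¹) Filter.atTop (nhds 0) :=
    tendsto_inv_atTop_zero.comp tendsto_log_natCast
  have h3 : Filter.Tendsto (fun n : ℕ => (Real.sqrt (Real.sqrt (Real.log n)))⁻¹) Filter.atTop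
      (nhds 0) := tendsto_inv_atTop_zero.comp tendsto_sqrt_sqrt_log
  have h2 : Filter.Tendsto (fun n : ℕ => Real.log n ^ 2 * (n : ℝ) ^ (-(1 / ((κ : ℝ) + 1))))
      Filter.atTop (nhds 0) := by
    have h := (isLittleO_log_rpow_rpow_atTop (s := 1 / ((κ : ℝ) + 1)) 2
      (by positivity)).tendsto_div_nhds_zero
    refine (h.comp tendsto_natCast_atTop_atTop).congr fun n => ?_
    simp only [Function.comp_apply]
    rw [Real.rpow_neg (Nat.cast_nonneg n), div_eq_mul_inv]
    norm_cast
  have := ((h1.const_mul (4 * (4 ^ κ * (κ.factorial : ℝ) ^ 2) / (γ ^ 2 * A))).add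
    (h2.const_mul (Real.exp (2 * (1 / (50 * A ^ 2))) * (4 * (2 * κ : ℕ) * (1 / (50 * A ^ 2))
      + 2 * (1 / (50 * A ^ 2)) / A + 4 / A)))).add
    (h3.const_mul (4 * Real.exp (1 / (50 * A ^ 2)) + 1))
  simp only [mul_zero, add_zero] at this
  exact this

end Asymptotics

end TensorPCA

namespace TensorPCA

/-! ### Choice of parameters and uniformity in the remaining variables. -/

section Main

variable {κ n c ℓ : ℕ}

/-- For large `n` the failure probability is at most the error function. -/
theorem measure_not_exists_guided_le_errorBound {γ A : ℝ} (hκ : 0 < κ) (hγ : 0 < γ) (hA : 0 < A)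
    (hn : 2 * κ ≤ n) (hL : 1 ≤ Real.log n) (hAL : 1 ≤ A * Real.log n)
    (hδ : 4 * (2 * κ : ℕ) * (n : ℝ) ^ (-(1 / ((κ : ℝ) + 1))) ≤ 1)
    (hγL : γ ≤ Real.sqrt (Real.sqrt (Real.log n)))
    (hc : 0 < c) (hℓ : ℓ = c * (2 * κ)) {β : ℝ} (hβ : 0 < β)
    (hβℓ : β ^ 2 * (ℓ : ℝ) ^ (2 * κ) ≤ 1 / 100)
    (h : A * ((n : ℝ) ^ κ / (β ^ 2 * n.choose (2 * κ))) * Real.log n ≤ (ℓ : ℝ) ^ (κ - 1))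
    {z : Fin n → ℝ} (hz : ∀ i, z i = 1 ∨ z i = -1)
    {Ω : Type*} [MeasurableSpace Ω] {P : Measure Ω} [IsProbabilityMeasure P]
    {G H : Ω → Tensor n (2 * κ)} (hG : HasLaw G (symmGaussianLaw n (2 * κ)) P)
    (hH : HasLaw H (symmGaussianLaw n (2 * κ)) P) (hGH : IndepFun G H P) :
    P {ω | ¬ ∃ v ∈ cutoffEigenspace
          (kikuchi ℓ (splitPlus (1 / Real.log n) (spiked β z (G ω)) (H ω)))
          ((1 - γ) * (kikuchiDegree n (2 * κ) ℓ : ℝ) * β),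
        ‖v‖ = 1 ∧
        β ^ (2 * c) *
            ((numParts (2 * κ) ℓ : ℝ) * (γ / 10) * (1 / (1 + Real.log n ^ 2)) ^ c *
              (1 / Real.log n))
          ≤ (inner ℝ v
              (guidingState ℓ (splitMinus (1 / Real.log n) (spiked β z (G ω)) (H ω)))) ^ 2}
      ≤ ENNReal.ofReal (errorBound κ γ A n) := by
  have hn0 : 0 < n := by omega
  have hn' : (0 : ℝ) < n := by exact_mod_cast hn0
  have hκℓ : 2 * κ ≤ ℓ := by
    rw [hℓ]
    exact Nat.le_mul_of_pos_left _ hc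
  have hcℓ : c ≤ ℓ := by
    rw [hℓ]
    exact Nat.le_mul_of_pos_right _ (by omega)
  have hcpos : (0 : ℝ) < c := by exact_mod_cast hc
  unfold errorBound
  -- w = L^{1/4} grows slowly enough that dividing the deviation by η² = 1/w² costs less than a
  -- factor L, while η and 1/r = 1/w still tend to 0.
  set w : ℝ := Real.sqrt (Real.sqrt (Real.log n)) with hw
  set L : ℝ := Real.log n with hLdef
  set δ : ℝ := (n : ℝ) ^ (-(1 / ((κ : ℝ) + 1))) with hδdef
  set X : ℝ := 1 / (50 * A ^ 2) with hX
  set K : ℝ := Real.exp (2 * X) * (4 * (2 * κ : ℕ) * X + 2 * X / A + 4 / A) with hK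
  have hL0 : 0 < L := by linarith
  have hw0 : 0 < w := Real.sqrt_pos.2 (Real.sqrt_pos.2 hL0)
  have hw4 : w ^ 4 = L := by
    rw [show 4 = 2 * 2 from rfl, pow_mul, hw, Real.sq_sqrt (Real.sqrt_nonneg _),
      Real.sq_sqrt hL0.le]
  have hw1 : 1 ≤ w := by
    rw [hw, Real.one_le_sqrt, Real.one_le_sqrt]
    exact hL
  have hδ0 : 0 < δ := Real.rpow_pos_of_pos hn' _
  have hδn : 1 / (n : ℝ) ≤ δ ^ (κ + 1) := by
    rw [hδdef, ← Real.rpow_natCast, ← Real.rpow_mul hn'.le]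
    push_cast
    rw [neg_mul, one_div_mul_cancel (by positivity), Real.rpow_neg_one, one_div]
  have hthr := mul_pow_le_of_threshold hn hβ h
  have hsmall := pow_succ_le_of_threshold hκ hn0 (by omega) hβℓ hthr
  have hρ := div_le_of_pow_succ_le hn0 hAL hδ0.le hδn hsmall
  have hk1 : (1 : ℝ) ≤ (2 * κ : ℕ) := by exact_mod_cast (by omega : 1 ≤ 2 * κ)
  have hδ4 : δ ≤ 1 / 4 := by nlinarith
  have hρ0 : 0 ≤ (ℓ : ℝ) / n := by positivity
  have hnℓ : ℓ + 2 * κ ≤ n := by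
    have h1 : (ℓ : ℝ) ≤ 1 / 4 * n := by
      rw [← div_le_iff₀ hn']
      exact hρ.trans hδ4
    have h2 : ((4 * ℓ : ℕ) : ℝ) ≤ n := by
      push_cast
      linarith
    have h3 : 4 * ℓ ≤ n := by exact_mod_cast h2
    omega
  have hM : (0 : ℝ) < n.choose (2 * κ) := by exact_mod_cast Nat.choose_pos hn
  have hM' : (0 : ℝ) < (n - ℓ).choose (2 * κ) := by exact_mod_cast Nat.choose_pos (by omega)
  obtain ⟨hxX, hxc⟩ := tilt_le hA hL hn hκ hcℓ hβ hthr hsmall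
  set x : ℝ := (c : ℝ) ^ 2 * (1 + L ^ 2) / (β ^ 2 * n.choose (2 * κ)) with hx
  have hx0 : 0 ≤ x := by positivity
  have hxcle : x / c ≤ 2 * L / A * δ := by
    have : x / c = (c : ℝ) * (1 + L ^ 2) / (β ^ 2 * n.choose (2 * κ)) := by
      rw [hx]
      field_simp
    rw [this]
    refine hxc.trans ?_
    gcongr
    exact (pow_le_of_le_one hρ0 (hρ.trans (by linarith)) hκ.ne').trans hρ
  have hx' : (c : ℝ) ^ 2 * (1 + L ^ 2) / (β ^ 2 * (n - ℓ).choose (2 * κ))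
      ≤ x * (1 + 4 * (2 * κ : ℕ) * δ) := by
    have hch := choose_le_mul_choose_sub (by omega) hκℓ hn0 hδ hρ
    rw [hx, div_mul_eq_mul_div, div_le_div_iff₀ (by positivity) (by positivity)]
    calc (c : ℝ) ^ 2 * (1 + L ^ 2) * (β ^ 2 * n.choose (2 * κ))
        ≤ (c : ℝ) ^ 2 * (1 + L ^ 2) *
          (β ^ 2 * ((1 + 4 * (2 * κ : ℕ) * δ) * (n - ℓ).choose (2 * κ))) := by gcongr
      _ = _ := by ring
  -- η²/(2r) = w^{-3}/2 = (w/2)/L, so γ ≤ w leaves room for the factor γ/10.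
  have hq : γ / 10 * (1 / L) ≤ (1 / w) ^ 2 / (2 * w) := by
    rw [← hw4]
    have : (1 / w) ^ 2 / (2 * w) = w / 2 * (1 / w ^ 4) := by
      field_simp
    rw [this]
    gcongr
    linarith
  refine (measure_not_exists_guided_le (even_two_mul κ) (by omega) hc hℓ hnℓ hγ hL0 hz hβ
    (x := x) (x' := x * (1 + 4 * (2 * κ : ℕ) * δ)) (η := 1 / w) (r := w) (by positivity) hw0 hq
    hx hx' hβℓ hG hH hGH).trans ?_
  have hdeg := le_sq_mul_kikuchiDegree hκ hκℓ hn0 (hρ.trans hδ4) hthr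
  have hdev := deviation_term_le (t := 4 * (2 * κ : ℕ)) hA hL hδ0.le hx0 hxX
    (div_nonneg hx0 hcpos.le) hxcle (by positivity) hδ hK
  have hX0 : 0 ≤ X := by positivity
  have hK0 : 0 ≤ K := by positivity
  have e1 : 2 * (1 + 1 / L ^ 2) / (γ ^ 2 * (β ^ 2 * kikuchiDegree n (2 * κ) ℓ))
      ≤ 4 * (4 ^ κ * (κ.factorial : ℝ) ^ 2) / (γ ^ 2 * A) * L⁻¹ := by
    have hL2 : 1 / L ^ 2 ≤ 1 := by
      rw [div_le_one (by positivity)]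
      exact one_le_pow₀ hL
    calc 2 * (1 + 1 / L ^ 2) / (γ ^ 2 * (β ^ 2 * kikuchiDegree n (2 * κ) ℓ))
        ≤ 2 * (1 + 1) / (γ ^ 2 * (A * L / (4 ^ κ * (κ.factorial : ℝ) ^ 2))) := by gcongr
      _ = _ := by
        field_simp
        norm_num
  have e2 : ((Real.exp (x * (1 + 4 * (2 * κ : ℕ) * δ)) - Real.exp x) + x * (x / c) * Real.exp x
      + x * (1 + 4 * (2 * κ : ℕ) * δ) * Real.exp (x * (1 + 4 * (2 * κ : ℕ) * δ)) / c)
        / (1 / w) ^ 2 ≤ K * (L ^ 2 * δ) := by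
    have hwL : w ^ 2 ≤ L := by
      rw [← hw4]
      exact pow_le_pow_right₀ hw1 (by norm_num)
    calc _ = ((Real.exp (x * (1 + 4 * (2 * κ : ℕ) * δ)) - Real.exp x)
          + x * (x / c) * Real.exp x
          + x / c * (1 + 4 * (2 * κ : ℕ) * δ) * Real.exp (x * (1 + 4 * (2 * κ : ℕ) * δ)))
            * w ^ 2 := by
          rw [one_div, inv_pow, div_inv_eq_mul]
          ring
      _ ≤ K * (L * δ) * w ^ 2 := by gcongr
      _ ≤ K * (L * δ) * L := by gcongr
      _ = _ := by ring
  have e3 : 4 * (1 / w) * Real.exp x + 1 / w ≤ (4 * Real.exp X + 1) * w⁻¹ := by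
    calc 4 * (1 / w) * Real.exp x + 1 / w = (4 * Real.exp x + 1) * w⁻¹ := by
          rw [one_div]
          ring
      _ ≤ _ := by gcongr
  have hxx' : x ≤ x * (1 + 4 * (2 * κ : ℕ) * δ) :=
    le_mul_of_one_le_right hx0 (by linarith [(by positivity : (0 : ℝ) ≤ 4 * (2 * κ : ℕ) * δ)])
  have hexp : 0 ≤ Real.exp (x * (1 + 4 * (2 * κ : ℕ) * δ)) - Real.exp x :=
    sub_nonneg.2 (Real.exp_le_exp.2 hxx')
  rw [← ENNReal.ofReal_add (by positivity) (by positivity),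
    ← ENNReal.ofReal_add (by positivity) (by positivity),
    ← ENNReal.ofReal_add (by positivity) (by positivity)]
  refine ENNReal.ofReal_le_ofReal ?_
  linarith

/-- The conditions under which the error function bounds the failure probability hold for all
large `n`. -/
theorem eventually_large (κ : ℕ) (γ : ℝ) {A : ℝ} (hA : 0 < A) :
    ∀ᶠ n : ℕ in Filter.atTop, 2 * κ ≤ n ∧ 1 ≤ Real.log n ∧ 1 ≤ A * Real.log n ∧
      4 * (2 * κ : ℕ) * (n : ℝ) ^ (-(1 / ((κ : ℝ) + 1))) ≤ 1 ∧
      γ ≤ Real.sqrt (Real.sqrt (Real.log n)) := by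
  have h4 : Filter.Tendsto (fun n : ℕ => 4 * (2 * κ : ℕ) * (n : ℝ) ^ (-(1 / ((κ : ℝ) + 1))))
      Filter.atTop (nhds 0) := by
    have := (tendsto_natCast_rpow_neg κ).const_mul (4 * ((2 * κ : ℕ) : ℝ))
    rwa [mul_zero] at this
  filter_upwards [Filter.eventually_ge_atTop (2 * κ), tendsto_log_natCast.eventually_ge_atTop 1,
    (tendsto_log_natCast.const_mul_atTop hA).eventually_ge_atTop 1,
    h4.eventually_le_const one_pos, tendsto_sqrt_sqrt_log.eventually_ge_atTop γ]
    with n h1 h2 h3 h4 h5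
  exact ⟨h1, h2, h3, h4, h5⟩

/-- Dropping ε from the constant makes the error function independent of it. -/
theorem threshold_mono {γ ε β L : ℝ} {κ : ℕ} (hε : 0 < ε) (hL : 0 ≤ L) {R : ℝ}
    (h : (2 * (1 + ε) / ((1 - γ) ^ 2 * ((2 * κ).choose κ : ℝ))) *
      ((n : ℝ) ^ κ / (β ^ 2 * (n.choose (2 * κ) : ℝ))) * L ≤ R) :
    (2 / ((1 - γ) ^ 2 * ((2 * κ).choose κ : ℝ))) *
      ((n : ℝ) ^ κ / (β ^ 2 * (n.choose (2 * κ) : ℝ))) * L ≤ R := by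
  refine le_trans ?_ h
  gcongr
  linarith

theorem sq_mul_pow_le_of_le {β : ℝ} {ℓ κ : ℕ} (hβ : 0 < β) (hℓ : 0 < ℓ)
    (h : β ≤ 0.1 / (ℓ : ℝ) ^ κ) : β ^ 2 * (ℓ : ℝ) ^ (2 * κ) ≤ 1 / 100 := by
  have hℓ' : (0 : ℝ) < ℓ := by exact_mod_cast hℓ
  rw [le_div_iff₀ (by positivity)] at h
  calc β ^ 2 * (ℓ : ℝ) ^ (2 * κ) = (β * (ℓ : ℝ) ^ κ) ^ 2 := by
        rw [mul_pow, ← pow_mul, mul_comm κ 2]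
    _ ≤ 0.1 ^ 2 := pow_le_pow_left₀ (by positivity) h 2
    _ = 1 / 100 := by norm_num

end Main

end TensorPCA

/-- The `o(1)` is uniform over `c`, `β`, `ε`, `z`: the function `err` depends on `k` and `γ` only.
The bound on the exceptional event is one for its outer measure. -/
theorem mainTheorem4 (k : ℕ) (hk : Even k) (hk4 : 4 ≤ k) (γ : ℝ) (hγ : 0 < γ) (hγ1 : γ ≠ 1) :
    ∃ err : ℕ → ℝ, Filter.Tendsto err Filter.atTop (nhds 0) ∧
      ∀ (n c ℓ : ℕ), 1 ≤ c → ℓ = c * k →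
      ∀ (β ε : ℝ), 0 < β → β ≤ 0.1 / (ℓ : ℝ) ^ (k / 2) → 0 < ε →
        (2 * (1 + ε) / ((1 - γ) ^ 2 * (k.choose (k / 2) : ℝ))) *
            ((n : ℝ) ^ (k / 2) / (β ^ 2 * (n.choose k : ℝ))) * Real.log n
          ≤ (ℓ : ℝ) ^ ((k - 2) / 2) →
      ∀ (z : Fin n → ℝ), (∀ i, z i = 1 ∨ z i = -1) →
      ∀ (Ω : Type*) [MeasurableSpace Ω] (P : MeasureTheory.Measure Ω)
        [MeasureTheory.IsProbabilityMeasure P] (G H : Ω → TensorPCA.Tensor n k),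
        ProbabilityTheory.HasLaw G (TensorPCA.symmGaussianLaw n k) P →
        ProbabilityTheory.HasLaw H (TensorPCA.symmGaussianLaw n k) P →
        ProbabilityTheory.IndepFun G H P →
        P {ω | ¬ ∃ v ∈ TensorPCA.cutoffEigenspace
              (TensorPCA.kikuchi ℓ
                (TensorPCA.splitPlus (1 / Real.log n) (TensorPCA.spiked β z (G ω)) (H ω)))
              ((1 - γ) * (TensorPCA.kikuchiDegree n k ℓ : ℝ) * β),
            ‖v‖ = 1 ∧
            β ^ (2 * c) *
                ((TensorPCA.numParts k ℓ : ℝ) * (γ / 10) * (1 / (1 + Real.log n ^ 2)) ^ c *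
                  (1 / Real.log n))
              ≤ (inner ℝ v
                  (TensorPCA.guidingState ℓ
                    (TensorPCA.splitMinus (1 / Real.log n) (TensorPCA.spiked β z (G ω))
                      (H ω)))) ^ 2}
          ≤ ENNReal.ofReal (err n) := by
  obtain ⟨κ, hκ⟩ := hk.two_dvd
  subst hκ
  have hdiv : 2 * κ / 2 = κ := Nat.mul_div_cancel_left κ (by norm_num)
  have hdiv' : (2 * κ - 2) / 2 = κ - 1 := by omega
  -- The threshold constant at ε = 0; γ ≠ 1 makes it positive.
  set A : ℝ := 2 / ((1 - γ) ^ 2 * ((2 * κ).choose κ : ℝ)) with hAdef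
  have hA : 0 < A := by
    have h1 : 0 < (1 - γ) ^ 2 := by
      have : 1 - γ ≠ 0 := sub_ne_zero.2 hγ1.symm
      positivity
    have h2 : (0 : ℝ) < (2 * κ).choose κ := by exact_mod_cast Nat.choose_pos (by omega)
    positivity
  obtain ⟨N, hN⟩ := Filter.eventually_atTop.1 (TensorPCA.eventually_large κ γ hA)
  -- Below N the value 1 is a trivial bound for a probability, and finitely many values do not
  -- affect the limit.
  refine ⟨fun n => if N ≤ n then TensorPCA.errorBound κ γ A n else 1, ?_, ?_⟩
  · refine (TensorPCA.tendsto_errorBound κ γ A).congr' ?_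
    filter_upwards [Filter.eventually_ge_atTop N] with n hn
    rw [if_pos hn]
  intro n c ℓ hc hℓ β ε hβ hβle hε hthr z hz Ω _ P _ G H hG hH hGH
  by_cases hn : N ≤ n
  · simp only [if_pos hn]
    obtain ⟨h1, h2, h3, h4, h5⟩ := hN n hn
    rw [hdiv] at hβle
    rw [hdiv, hdiv'] at hthr
    have hℓ0 : 0 < ℓ := by
      rw [hℓ]
      exact Nat.mul_pos hc (by omega)
    exact TensorPCA.measure_not_exists_guided_le_errorBound (by omega) hγ hA h1 h2 h3 h4 h5 hc hℓ
      hβ (TensorPCA.sq_mul_pow_le_of_le hβ hℓ0 hβle)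
      (TensorPCA.threshold_mono hε (by linarith) hthr) hz hG hH hGH
  · simp only [if_neg hn, ENNReal.ofReal_one]
    exact prob_le_one
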